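/- Let $n\ge 1$, let $S^n\subset\mathbb R^{n+1}$ be the unit sphere, $\mathbb{RP}^n=S^n/\{\pm1\}$, and let $g_0$ be the standard round metric on $\mathbb{RP}^n$ (the one for which $S^n\to\mathbb{RP}^n$ is a local isometry). For a nonnegative function $\bar f\in L^n(\mathbb{RP}^n,g_0)$ (possibly taking the value $+\infty$) consider the singular Riemannian metric $g=\bar f^2g_0$, with volume $\operatorname{vol}(\mathbb{RP}^n,g)=\int_{\mathbb{RP}^n}\bar f^{\,n}\,dg_0$ and systole $\operatorname{sys}(\mathbb{RP}^n,g)=\inf_\gamma\int_0^1\bar f(\gamma(t))\,|\gamma'(t)|_{g_0}\,dt$, where $\gamma$ runs over the noncontractible (piecewise) $C^1$ loops $\gamma:[0,1]\to\mathbb{RP}^n$. If $\operatorname{sys}(\mathbb{RP}^n,g)\neq0$, then $$\frac{\operatorname{vol}(\mathbb{RP}^n,g)}{\operatorname{sys}(\mathbb{RP}^n,g)^n}\ \ge\ \frac{\operatorname{vol}(\mathbb{RP}^n,g_0)}{\operatorname{sys}(\mathbb{RP}^n,g_0)^n}.$$ Furthermore, let $n=2$, let $\mu$ be a finite signed Borel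 measure on $S^2$ with $\mu(S^2)=0$, and let $$u(x)=\int_{S^2}G(x,y)\,d\mu(y),\qquad G(x,y)=-\frac1{2\pi}\log\frac{|x-y|}{2}-\frac1{4\pi},\quad G(x,x)=+\infty,$$ be its potential with respect to the Green function $G$ of the round sphere (so that $\mu=\Delta_{g_0}u$ in the distribution sense, with the nonnegative Laplacian). Suppose that $g=\bar f^2g_0$ is as above, with $\bar f\in L^2$ and nonzero systole, and that the lift of $\bar f$ to $S^2$ equals $e^u$ at every point at which the integral defining $u$ makes sense in $[-\infty,+\infty]$. Then equality $$\frac{\operatorname{vol}(\mathbb{RP}^2,g)}{\operatorname{sys}(\mathbb{RP}^2,g)^2}=\frac{\operatorname{vol}(\mathbb{RP}^2,g_0)}{\operatorname{sys}(\mathbb{RP}^2,g_0)^2}$$ holds if and only if $g$ has constant Gaussian curvature, that is, there is a constant $K\in\mathbb R$ such that the curvature measure $\omega=dg_0+\mu$ of $g$ (lifted to $S^2$) equals $K$ times the area measure $e^{2u}\,dg_0$ of $g$. -/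

import Mathlib

open MeasureTheory Set
open scoped ENNReal

noncomputable section

namespace PuInequality

/-- The unit sphere `Sⁿ` in `ℝⁿ⁺¹`. -/
abbrev Sph (n : ℕ) : Type := Metric.sphere (0 : EuclideanSpace ℝ (Fin (n + 1))) 1

/-- Two points of the sphere are identified when they are equal or antipodal. -/
def antipodalSetoid (n : ℕ) : Setoid (Sph n) where
  r x y := x = y ∨ x = -y
  iseqv :=
    { refl := fun _ => Or.inl rfl
      symm := by
        rintro x y (h | h)
        · exact Or.inl h.symm
        · exact Or.inr (by rw [h, neg_neg])
      trans := by
        rintro x y z (h | h) (h' | h')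
        · exact Or.inl (h.trans h')
        · exact Or.inr (h.trans h')
        · exact Or.inr (by rw [h, h'])
        · exact Or.inl (by rw [h, h', neg_neg]) }

/-- Real projective space `ℝPⁿ = Sⁿ/±1`, with the quotient topology and the quotient σ-algebra
(which are Mathlib's instances for quotients). -/
abbrev RP (n : ℕ) : Type := Quotient (antipodalSetoid n)

/-- The double covering `Sⁿ → ℝPⁿ`. -/
def proj {n : ℕ} (x : Sph n) : RP n := Quotient.mk (antipodalSetoid n) x

/-- The Riemannian volume measure of the round unit sphere `Sⁿ`. -/
def sphVol (n : ℕ) : Measure (Sph n) :=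
  (volume : Measure (EuclideanSpace ℝ (Fin (n + 1)))).toSphere

/-- The Riemannian volume measure of the round metric `g₀` on `ℝPⁿ`, for which the double
covering `Sⁿ → ℝPⁿ` is a local isometry: half of the image of the volume measure of `Sⁿ`. -/
def rpVol (n : ℕ) : Measure (RP n) := (2⁻¹ : ℝ≥0∞) • (sphVol n).map proj

/-- A `C¹` loop in `ℝPⁿ`: a loop together with a lift to `Sⁿ` (every path in `ℝPⁿ` has exactly
two lifts, which are antipodal to each other) that is of class `C¹` on `[0, 1]`. The velocity may
vanish and need not match at the end points, so that, up to reparametrization, all piecewise `C¹`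
loops are of this form. The values of `lift` outside `[0, 1]` play no role. -/
structure C1Loop (n : ℕ) where
  base : RP n
  loop : Path base base
  lift : ℝ → Sph n
  contDiffOn_lift : ContDiffOn ℝ 1 (fun t => (lift t : EuclideanSpace ℝ (Fin (n + 1)))) (Icc 0 1)
  proj_lift : ∀ t : unitInterval, proj (lift t) = loop t

/-- A loop is contractible if it is homotopic to the constant loop. -/
def C1Loop.Contractible {n : ℕ} (γ : C1Loop n) : Prop :=
  γ.loop.Homotopic (Path.refl γ.base)

/-- The length `∫₀¹ f(γ(t)) |γ'(t)| dt` of a loop for the singular metric `g = f² g₀` on `ℝPⁿ`.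
The speed for `g₀` is computed on the lift. For a Borel function `f` the integrand is measurable. -/
def C1Loop.length {n : ℕ} (γ : C1Loop n) (f : RP n → ℝ≥0∞) : ℝ≥0∞ :=
  ∫⁻ t in Icc (0 : ℝ) 1, f (proj (γ.lift t)) *
    ‖derivWithin (fun s => (γ.lift s : EuclideanSpace ℝ (Fin (n + 1)))) (Icc 0 1) t‖ₑ

/-- The systole of `(ℝPⁿ, f² g₀)`: the infimum of the lengths of the noncontractible loops. -/
def sys {n : ℕ} (f : RP n → ℝ≥0∞) : ℝ≥0∞ :=
  ⨅ (γ : C1Loop n) (_ : ¬ γ.Contractible), γ.length f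

/-- The volume of `(ℝPⁿ, f² g₀)`. -/
def vol {n : ℕ} (f : RP n → ℝ≥0∞) : ℝ≥0∞ := ∫⁻ p, f p ^ n ∂(rpVol n)

/-- The conformal factor of the round metric `g₀` itself. -/
def roundFactor (n : ℕ) : RP n → ℝ≥0∞ := fun _ => 1

/-- The Green function of the (nonnegative) Laplacian of the round unit sphere `S²`, normalized to
have mean zero: `G(x, y) = -(1/2π) log (|x - y|/2) - 1/(4π)`, where `|x - y|` is the Euclidean
distance in `ℝ³`, and `G(x, x) = +∞`. It satisfies `Δ G(x, ·) = δₓ - 1/(4π)`. -/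
def green (x y : Sph 2) : EReal :=
  open Classical in
  if x = y then ⊤
  else ((-(1 / (2 * Real.pi)) * Real.log (dist x y / 2) - 1 / (4 * Real.pi) : ℝ) : EReal)

/-- The positive part of the integral `∫ G(x, y) dμ(y)`. -/
def potentialPos (μ : SignedMeasure (Sph 2)) (x : Sph 2) : ℝ≥0∞ :=
  ∫⁻ y, (green x y).toENNReal ∂μ.toJordanDecomposition.posPart +
    ∫⁻ y, (-green x y).toENNReal ∂μ.toJordanDecomposition.negPart

/-- The negative part of the integral `∫ G(x, y) dμ(y)`. -/
def potentialNeg (μ : SignedMeasure (Sph 2)) (x : Sph 2) : ℝ≥0∞ :=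
  ∫⁻ y, (-green x y).toENNReal ∂μ.toJordanDecomposition.posPart +
    ∫⁻ y, (green x y).toENNReal ∂μ.toJordanDecomposition.negPart

/-- The integral `∫ G(x, y) dμ(y)` is defined, as an element of `[-∞, +∞]`. -/
def PotentialDefinedAt (μ : SignedMeasure (Sph 2)) (x : Sph 2) : Prop :=
  potentialPos μ x ≠ ⊤ ∨ potentialNeg μ x ≠ ⊤

/-- The potential `u(x) = ∫ G(x, y) dμ(y)`, meaningful where `PotentialDefinedAt μ x` holds. -/
def potential (μ : SignedMeasure (Sph 2)) (x : Sph 2) : EReal :=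
  (potentialPos μ x : EReal) - (potentialNeg μ x : EReal)

/-- The lift of `f` to `S²` is `e^u`, where `u` is the potential of `μ`, at every point at which
the integral defining `u` makes sense. -/
def IsExpPotential (f : RP 2 → ℝ≥0∞) (μ : SignedMeasure (Sph 2)) : Prop :=
  ∀ x : Sph 2, PotentialDefinedAt μ x → f (proj x) = (potential μ x).exp

/-- The curvature measure `ω = dg₀ + μ` (on the double cover `S²`) of the singular metric
`e^{2u} g₀`, where `u` is the potential of `μ`, evaluated on a set. For smooth `u` this is
`K dA = (1 + Δ u) dg₀`, with the nonnegative Laplacian `Δ`. -/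
def curvatureMeasure (μ : SignedMeasure (Sph 2)) (s : Set (Sph 2)) : ℝ :=
  (sphVol 2).real s + μ s

/-- The area, for the lift of `f² g₀` to `S²`, of a subset of `S²`. -/
def liftedArea (f : RP 2 → ℝ≥0∞) (s : Set (Sph 2)) : ℝ≥0∞ :=
  ∫⁻ x in s, f (proj x) ^ 2 ∂(sphVol 2)

/-- The metric `f² g₀`, where the lift of `f` is `e^u` and `u` is the potential of `μ`, has
constant Gaussian curvature: for some real constant `K`, its curvature measure is `K` times its
area measure. -/
def HasConstantCurvature (f : RP 2 → ℝ≥0∞) (μ : SignedMeasure (Sph 2)) : Prop :=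
  ∃ K : ℝ, ∀ s : Set (Sph 2), MeasurableSet s →
    curvatureMeasure μ s = K * (liftedArea f s).toReal

end PuInequality

end

open PuInequality

open scoped Pointwise

noncomputable section

namespace PuInequality


/-! The inequality is an averaging argument. A half great circle descends to a noncontractible loop
in projective space, so its `f`-length is at least the systole. Averaging over all its images under
the orthogonal group, with Haar probability, makes each of its points uniformly distributed, and
gives `sys f ≤ π · mean f` (`sys_le_average`). Jensen gives `(mean f)^n ≤ mean (f^n)`, and the right
side is `vol f / vol g₀`. A noncontractible loop lifts to a path reaching the antipode of its start,
so the round systole is at least `π` (`pi_le_sys_roundFactor`); only this bound is needed, the round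
systole being in a denominator.

In dimension two, equality forces equality in Cauchy–Schwarz, so `f` is constant almost everywhere,
and so is the logarithmic potential of `μ`. That potential determines `μ`
(`measure_eq_of_log_potential`): the kernel `-log (1 - ⟨x, y⟩) = ∑ ⟨x, y⟩^k / k` is positive
definite, which kills the zonal moments of `μ`, and these determine a measure through its
characteristic function. Hence `μ = 0`, then `u = 0`, and `f = 1` at every point; this metric is
round.

Conversely, constant curvature must force `μ = 0`. Gauss–Bonnet gives `K > 0`. After a shift by a
constant, `u` becomes a function `w` that equals a constant minus `1/4π` times the logarithmic
potential of its own density `e^{2w}`, of total mass `4π`. A Brezis–Merle argument bootstraps this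
to continuity: the density is in `L²`, then bounded, and then its potential is continuous. Since `f`
lives on the projective plane, `w` is even. The Liouville equation on the sphere has nonconstant
solutions, from conformal maps, and evenness must rule them out. This is done by moving planes in
integral form: on the conformal cylinder with coordinates `(t, θ)`, the circle of reflection `t = a`
is moved from infinity down to the equator, and evenness prevents it from stopping earlier
(`not_symmetric`). So `w` is symmetric in the equator for every choice of axis. Any two points are
exchanged by such a reflection, so `w` is constant, and the injectivity above gives `μ = 0`. -/

/-- The ambient Euclidean space of `Sⁿ`. -/
abbrev Amb (n : ℕ) : Type := EuclideanSpace ℝ (Fin (n + 1))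

/-! ### Isometries of the sphere and invariance of its measure -/

/-- The action of a linear isometry on the sphere. -/
def sphMap {n : ℕ} (A : Amb n ≃ₗᵢ[ℝ] Amb n) (x : Sph n) : Sph n :=
  ⟨A x, by simp⟩

@[simp]
theorem coe_sphMap {n : ℕ} (A : Amb n ≃ₗᵢ[ℝ] Amb n) (x : Sph n) :
    (sphMap A x : Amb n) = A x := rfl

theorem continuous_sphMap {n : ℕ} (A : Amb n ≃ₗᵢ[ℝ] Amb n) : Continuous (sphMap A) :=
  Continuous.subtype_mk (A.continuous.comp continuous_subtype_val) _

theorem sphMap_neg {n : ℕ} (A : Amb n ≃ₗᵢ[ℝ] Amb n) (x : Sph n) :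
    sphMap A (-x) = -sphMap A x := by
  ext1; simp

@[simp]
theorem sphMap_sphMap_symm {n : ℕ} (A : Amb n ≃ₗᵢ[ℝ] Amb n) (x : Sph n) :
    sphMap A (sphMap A.symm x) = x := by
  ext1; simp

theorem inner_sphMap {n : ℕ} (A : Amb n ≃ₗᵢ[ℝ] Amb n) (x y : Sph n) :
    inner ℝ (sphMap A x : Amb n) (sphMap A y : Amb n) = inner ℝ (x : Amb n) (y : Amb n) := by
  simp

instance (n : ℕ) : IsFiniteMeasure (sphVol n) := by unfold sphVol; infer_instance

instance (n : ℕ) : (sphVol n).IsOpenPosMeasure := by unfold sphVol; infer_instance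

theorem sphVol_univ_ne_zero (n : ℕ) : sphVol n univ ≠ 0 := by
  simp [sphVol, (Metric.measure_ball_pos _ _ _).ne']

/-- The spherical measure of a set is a multiple of the Lebesgue measure of the cone over it, and a
linear isometry carries cones to cones. -/
theorem measurePreserving_sphMap {n : ℕ} (A : Amb n ≃ₗᵢ[ℝ] Amb n) :
    MeasurePreserving (sphMap A) (sphVol n) (sphVol n) := by
  refine ⟨(continuous_sphMap A).measurable, ?_⟩
  ext s hs
  rw [Measure.map_apply (continuous_sphMap A).measurable hs, sphVol,
    Measure.toSphere_apply' _ hs,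
    Measure.toSphere_apply' _ ((continuous_sphMap A).measurable hs)]
  congr 1
  have key : Ioo (0 : ℝ) 1 • (((↑) : Sph n → Amb n) '' (sphMap A ⁻¹' s)) =
      A ⁻¹' (Ioo (0 : ℝ) 1 • (((↑) : Sph n → Amb n) '' s)) := by
    ext v
    constructor
    · rintro ⟨r, hr, _, ⟨x, hx, rfl⟩, rfl⟩
      exact ⟨r, hr, _, ⟨_, hx, rfl⟩, by simp⟩
    · rintro ⟨r, hr, _, ⟨x, hx, rfl⟩, h⟩
      refine ⟨r, hr, _, ⟨sphMap A.symm x, by simpa using hx, rfl⟩, ?_⟩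
      apply A.injective
      simpa using h
  rw [key]
  exact A.measurePreserving.measure_preimage_equiv (f := A.toHomeomorph.toMeasurableEquiv) _

theorem exists_sphMap_eq {n : ℕ} (x y : Sph n) : ∃ A : Amb n ≃ₗᵢ[ℝ] Amb n, sphMap A x = y := by
  refine ⟨(ℝ ∙ ((x : Amb n) - y))ᗮ.reflection, ?_⟩
  ext1
  rw [coe_sphMap]
  exact Submodule.reflection_sub (by simp)

/-- Two points of the sphere are swapped by an isometry. -/
theorem exists_sphMap_swap {n : ℕ} (x y : Sph n) :
    ∃ A : Amb n ≃ₗᵢ[ℝ] Amb n, sphMap A x = y ∧ sphMap A y = x := by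
  have h : (ℝ ∙ ((x : Amb n) - y))ᗮ.reflection (x : Amb n) = y :=
    Submodule.reflection_sub (by simp)
  refine ⟨(ℝ ∙ ((x : Amb n) - y))ᗮ.reflection, ?_, ?_⟩
  · ext1
    exact h
  · ext1
    rw [coe_sphMap]
    exact (congrArg _ h.symm).trans (Submodule.reflection_reflection _ _)

/-! ### Averaging over the orthogonal group -/

section Haar

variable (n : ℕ)

theorem continuousStar_clm : ContinuousStar (Amb n →L[ℝ] Amb n) :=
  ⟨(ContinuousLinearMap.adjoint (𝕜 := ℝ) (E := Amb n) (F := Amb n)).continuous⟩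

theorem isTopologicalGroup_unitary : IsTopologicalGroup (unitary (Amb n →L[ℝ] Amb n)) := by
  have : ContinuousStar (Amb n →L[ℝ] Amb n) := continuousStar_clm n
  infer_instance

/-- Compactness is what allows Haar measure to be a probability measure. -/
theorem compactSpace_unitary : CompactSpace (unitary (Amb n →L[ℝ] Amb n)) := by
  have : ContinuousStar (Amb n →L[ℝ] Amb n) := continuousStar_clm n
  have : ProperSpace (Amb n →L[ℝ] Amb n) := FiniteDimensional.proper ℝ _
  refine isCompact_iff_compactSpace.mp (Metric.isCompact_of_isClosed_isBounded
    (isClosed_unitary (R := Amb n →L[ℝ] Amb n)) ?_)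
  refine (Metric.isBounded_closedBall (x := (0 : Amb n →L[ℝ] Amb n)) (r := 1)).subset ?_
  intro U hU
  rw [mem_closedBall_zero_iff]
  refine ContinuousLinearMap.opNorm_le_bound _ zero_le_one fun v => ?_
  have := (Unitary.linearIsometryEquiv ⟨U, hU⟩).norm_map v
  rw [one_mul]
  exact this.le

/-- Averaging over the orthogonal group: there is a probability measure on a space of linear
isometries for which the image of each point of the sphere is uniformly distributed. -/
theorem exists_isometry_average :
    ∃ (Ω : Type) (_ : MeasurableSpace Ω) (P : Measure Ω) (A : Ω → Amb n ≃ₗᵢ[ℝ] Amb n),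
      IsProbabilityMeasure P ∧ Measurable (fun p : Ω × Sph n => sphMap (A p.1) p.2) ∧
      ∀ (F : Sph n → ℝ≥0∞), Measurable F → ∀ x : Sph n,
        ∫⁻ ω, F (sphMap (A ω) x) ∂P = (sphVol n univ)⁻¹ * ∫⁻ y, F y ∂(sphVol n) := by
  let G := unitary (Amb n →L[ℝ] Amb n)
  have : IsTopologicalGroup G := isTopologicalGroup_unitary n
  have : CompactSpace G := compactSpace_unitary n
  have : ProperSpace (Amb n →L[ℝ] Amb n) := FiniteDimensional.proper ℝ _
  have : SecondCountableTopology (Amb n →L[ℝ] Amb n) := secondCountable_of_proper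
  have : SecondCountableTopology G := TopologicalSpace.Subtype.secondCountableTopology _
  let P : Measure G := Measure.haarMeasure ⊤
  have hP : IsProbabilityMeasure P := ⟨by
    have := Measure.haarMeasure_self (K₀ := (⊤ : TopologicalSpace.PositiveCompacts G))
    simpa using this⟩
  -- With the inverse, left translation of `U` by `V` composes the isometry on the right with `V⁻¹`.
  -- Left invariance of Haar measure then moves the point on which it acts.
  let A : G → Amb n ≃ₗᵢ[ℝ] Amb n := fun U => Unitary.linearIsometryEquiv U⁻¹
  have hA : ∀ U : G, ∀ x : Amb n, A U x = ((U⁻¹ : G) : Amb n →L[ℝ] Amb n) x := fun U x => rfl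
  have hmeas : Measurable (fun p : G × Sph n => sphMap (A p.1) p.2) := by
    apply Continuous.measurable
    refine Continuous.subtype_mk ?_ _
    simp only [hA]
    exact (continuous_subtype_val.comp (continuous_inv.comp continuous_fst)).clm_apply
      (continuous_subtype_val.comp continuous_snd)
  refine ⟨G, inferInstance, P, A, hP, hmeas, fun F hF x => ?_⟩
  have hconst : ∀ y : Sph n, ∫⁻ U, F (sphMap (A U) y) ∂P = ∫⁻ U, F (sphMap (A U) x) ∂P := by
    intro y
    obtain ⟨B, hB⟩ := exists_sphMap_eq x y
    let V : G := Unitary.linearIsometryEquiv.symm B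
    have hV : ∀ v : Amb n, ((V : G) : Amb n →L[ℝ] Amb n) v = B v := fun v => rfl
    rw [← lintegral_mul_left_eq_self (μ := P) (fun U => F (sphMap (A U) y)) V]
    refine lintegral_congr fun U => ?_
    congr 1
    ext1
    simp only [coe_sphMap, hA, ← hB, mul_inv_rev]
    rw [← hV]
    change (((U⁻¹ : G) * V⁻¹ : G) : Amb n →L[ℝ] Amb n) ((V : Amb n →L[ℝ] Amb n) x) = _
    rw [← mul_apply_eq_comp, ← Submonoid.coe_mul]
    simp
  -- The orbit average does not depend on the point; integrating it over the sphere and exchanging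
  -- the integrals finds its value.
  have h1 : ∫⁻ y, ∫⁻ U, F (sphMap (A U) y) ∂P ∂(sphVol n) = ∫⁻ y, F y ∂(sphVol n) := by
    rw [lintegral_lintegral_swap]
    · have : ∀ U : G, ∫⁻ y, F (sphMap (A U) y) ∂(sphVol n) = ∫⁻ y, F y ∂(sphVol n) := fun U =>
        (measurePreserving_sphMap (A U)).lintegral_comp hF
      simp [this]
    · exact (hF.comp (hmeas.comp measurable_swap)).aemeasurable
  simp only [hconst, lintegral_const] at h1
  rw [← h1, mul_comm (∫⁻ U, F (sphMap (A U) x) ∂P), ← mul_assoc,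
    ENNReal.inv_mul_cancel (sphVol_univ_ne_zero n) (measure_ne_top _ _), one_mul]

end Haar


/-! ### The double covering of projective space -/

section Covering

variable {n : ℕ}

theorem proj_eq_proj_iff {x y : Sph n} : proj x = proj y ↔ x = y ∨ x = -y :=
  Quotient.eq (r := antipodalSetoid n)

@[simp]
theorem proj_neg (x : Sph n) : proj (-x) = proj x :=
  proj_eq_proj_iff.mpr (Or.inr rfl)

theorem isQuotientMap_proj : Topology.IsQuotientMap (proj : Sph n → RP n) :=
  isQuotientMap_quot_mk

theorem continuous_proj : Continuous (proj : Sph n → RP n) := isQuotientMap_proj.continuous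

theorem measurable_proj : Measurable (proj : Sph n → RP n) :=
  measurable_quot_mk (r := (antipodalSetoid n).r)

theorem sph_ne_neg (x : Sph n) : x ≠ -x := by
  intro h
  have h1 : (x : Amb n) = -x := congrArg Subtype.val h
  have h2 : (x : Amb n) = 0 := by
    ext i
    have := congrArg (fun v : Amb n => v i) h1
    simp only [PiLp.neg_apply] at this
    simpa using (by linarith : (x : Amb n) i = 0)
  have h3 : ‖(x : Amb n)‖ = 1 := by simp
  rw [h2] at h3
  simp at h3

/-- The action of `±1` on the sphere. -/
@[reducible]
def signAction (n : ℕ) : MulAction ℤˣ (Sph n) where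
  smul s x := if s = 1 then x else -x
  one_smul x := if_pos rfl
  mul_smul s t x := by
    change (if s * t = 1 then x else -x) = if s = 1 then (if t = 1 then x else -x)
      else -(if t = 1 then x else -x)
    rcases Int.units_eq_one_or s with rfl | rfl <;> rcases Int.units_eq_one_or t with rfl | rfl <;>
      simp

/-- The group `±1` is finite and acts freely by homeomorphisms, and the fibres of the projection are
its orbits. -/
theorem isCoveringMap_proj : IsCoveringMap (proj : Sph n → RP n) := by
  let _ := signAction n
  have h1 : ∀ x : Sph n, (1 : ℤˣ) • x = x := fun x => one_smul _ x
  have h2 : ∀ x : Sph n, (-1 : ℤˣ) • x = -x := fun x => if_neg (by decide)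
  have : ContinuousConstSMul ℤˣ (Sph n) := ⟨fun s => by
    rcases Int.units_eq_one_or s with rfl | rfl
    · simpa only [h1] using continuous_id'
    · simpa only [h2] using continuous_neg⟩
  have : IsCancelSMul ℤˣ (Sph n) := ⟨fun s t x h => by
    rcases Int.units_eq_one_or s with rfl | rfl <;> rcases Int.units_eq_one_or t with rfl | rfl
    · rfl
    · rw [h1, h2] at h
      exact absurd h (sph_ne_neg x)
    · rw [h1, h2] at h
      exact absurd h.symm (sph_ne_neg x)
    · rfl⟩
  have hq : IsQuotientCoveringMap (proj : Sph n → RP n) ℤˣ :=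
    isQuotientMap_proj.isQuotientCoveringMap_of_properlyDiscontinuousSMul (by
      intro x y
      rw [proj_eq_proj_iff]
      constructor
      · rintro (h | h)
        · exact ⟨1, by simp only [h1, h]⟩
        · exact ⟨-1, by simp only [h2, h]⟩
      · rintro ⟨s, hs⟩
        rcases Int.units_eq_one_or s with rfl | rfl
        · exact Or.inl (by rw [← hs]; exact (h1 y))
        · exact Or.inr (by rw [← hs]; exact (h2 y)))
  exact hq.isCoveringMap

end Covering

/-! ### Contractibility of loops and the round systole -/

section Loops

variable {n : ℕ}

theorem C1Loop.continuousOn_lift (γ : C1Loop n) : ContinuousOn γ.lift (Icc 0 1) := by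
  have := γ.contDiffOn_lift.continuousOn
  rw [continuousOn_iff_continuous_domRestrict] at this ⊢
  exact Topology.IsInducing.subtypeVal.continuous_iff.mpr this

/-- The lift of a loop as a continuous map on the unit interval. -/
def C1Loop.liftMap (γ : C1Loop n) : C(unitInterval, Sph n) where
  toFun t := γ.lift t
  continuous_toFun := continuousOn_iff_continuous_domRestrict.mp γ.continuousOn_lift

/-- Monodromy: homotopic loops have lifts with the same end point, and the constant loop lifts to a
constant path. -/
theorem C1Loop.not_contractible_of_lift_one (γ : C1Loop n) (h : γ.lift 1 = -γ.lift 0) :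
    ¬ γ.Contractible := by
  intro hc
  have h0 : γ.base = proj (γ.lift 0) := by
    have := γ.proj_lift 0
    simpa using this.symm
  have hrel : (γ.loop : C(unitInterval, RP n)).HomotopicRel
      (Path.refl γ.base : C(unitInterval, RP n)) {0, 1} := hc
  have key := isCoveringMap_proj.liftPath_apply_one_eq_of_homotopicRel hrel (γ.lift 0)
    (by simpa using h0) (by simpa using h0)
  have e1 : γ.liftMap = isCoveringMap_proj.liftPath (γ.loop : C(unitInterval, RP n))
      (γ.lift 0) (by simpa using h0) :=
    (isCoveringMap_proj.eq_liftPath_iff' _).mpr ⟨by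
      ext t
      exact γ.proj_lift t, rfl⟩
  have e2 : ContinuousMap.const unitInterval (γ.lift 0) =
      isCoveringMap_proj.liftPath (Path.refl γ.base : C(unitInterval, RP n))
      (γ.lift 0) (by simpa using h0) :=
    (isCoveringMap_proj.eq_liftPath_iff' _).mpr ⟨by
      ext t
      simp [h0], by simp⟩
  rw [← e1, ← e2] at key
  exact sph_ne_neg _ (key.symm.trans h)

theorem segment_ne_zero {x y : Sph n} (h : x ≠ -y) {s : ℝ} (hs : s ∈ Icc (0 : ℝ) 1) :
    (1 - s) • (x : Amb n) + s • (y : Amb n) ≠ 0 := by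
  intro h0
  have hn : ‖(1 - s) • (x : Amb n)‖ = ‖s • (y : Amb n)‖ := by
    rw [eq_neg_of_add_eq_zero_left h0, norm_neg]
  simp only [norm_smul, Real.norm_eq_abs, norm_eq_of_mem_sphere, mul_one,
    abs_of_nonneg hs.1, abs_of_nonneg (sub_nonneg.mpr hs.2)] at hn
  have hs2 : s = 1 / 2 := by linarith
  apply h
  ext1
  rw [hs2] at h0
  have : (1 / 2 : ℝ) • ((x : Amb n) + y) = 0 := by
    rw [smul_add]
    convert h0 using 2
    norm_num
  have := (smul_eq_zero.mp this).resolve_left (by norm_num)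
  simpa using eq_neg_of_add_eq_zero_left this

/-- A loop whose lift avoids the antipode of its starting point is contractible. -/
theorem C1Loop.contractible_of_forall_ne (γ : C1Loop n)
    (h : ∀ t ∈ Icc (0 : ℝ) 1, γ.lift t ≠ -γ.lift 0) : γ.Contractible := by
  have h0 : proj (γ.lift 0) = γ.base := by
    have := γ.proj_lift 0
    simpa using this
  have h1 : proj (γ.lift 1) = γ.base := by
    have := γ.proj_lift 1
    simpa using this
  have hclosed : γ.lift 1 = γ.lift 0 := by
    rcases proj_eq_proj_iff.mp (h1.trans h0.symm) with h2 | h2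
    · exact h2
    · exact absurd h2 (h 1 (by simp))
  -- The straight-line homotopy from the lift to its starting point. It never meets the origin
  -- because the antipode is avoided, so it can be normalized back to the sphere.
  let v : unitInterval × unitInterval → Amb n := fun p =>
    (1 - (p.1 : ℝ)) • (γ.lift p.2 : Amb n) + (p.1 : ℝ) • (γ.lift 0 : Amb n)
  have hv : ∀ p, v p ≠ 0 := fun p => segment_ne_zero (h _ p.2.2) p.1.2
  have hvc : Continuous v := by
    have : Continuous fun t : unitInterval => (γ.lift t : Amb n) :=
      continuous_subtype_val.comp γ.liftMap.continuous
    have h2 := this.comp (continuous_snd (X := unitInterval))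
    exact ((continuous_const.sub (continuous_subtype_val.comp continuous_fst)).smul h2).add
      ((continuous_subtype_val.comp continuous_fst).smul continuous_const)
  let w : unitInterval × unitInterval → Sph n := fun p =>
    ⟨‖v p‖⁻¹ • v p, by simp [norm_smul, hv p]⟩
  have hw : Continuous w := by
    refine Continuous.subtype_mk ?_ _
    exact (hvc.norm.inv₀ fun p => norm_ne_zero_iff.mpr (hv p)).smul hvc
  have hunit : ∀ x : Sph n, ∀ p, v p = x → w p = x := by
    intro x p hp
    ext1
    simp [w, hp]
  refine ⟨⟨⟨⟨fun p => proj (w p), continuous_proj.comp hw⟩, fun t => ?_, fun t => ?_⟩,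
    fun s t ht => ?_⟩⟩
  · change proj (w (0, t)) = γ.loop t
    rw [hunit (γ.lift t) (0, t) (by simp [v])]
    exact γ.proj_lift t
  · change proj (w (1, t)) = γ.base
    rw [hunit (γ.lift 0) (1, t) (by simp [v]), h0]
  · have hgoal : w (s, t) = γ.lift 0 → γ.loop t = γ.base → proj (w (s, t)) = γ.loop t := by
      intro ha hb
      rw [ha, hb, h0]
    rcases ht with rfl | rfl
    · refine hgoal (hunit _ _ ?_) (by simp)
      simp [v, ← add_smul]
    · refine hgoal (hunit _ _ ?_) (by simp)
      simp [v, hclosed, ← add_smul]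

/-- Comparison of the speed of a curve on the sphere with the derivative of its height. -/
theorem abs_mul_inner_div_sqrt_le {x y v : Amb n} (hx : ‖x‖ = 1) (hy : ‖y‖ = 1)
    (hv : inner ℝ y v = 0) {c : ℝ} (hc0 : 0 ≤ c) (hc1 : c < 1) :
    |1 / √(1 - (c * inner ℝ x y) ^ 2) * (c * inner ℝ x v)| ≤ ‖v‖ := by
  set s := inner ℝ x y with hs
  have hs1 : |s| ≤ 1 := by simpa [hx, hy] using abs_real_inner_le_norm x y
  have hs2 : s ^ 2 ≤ 1 := (sq_le_one_iff_abs_le_one s).mpr hs1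
  have hcs : (c * s) ^ 2 < 1 := by
    rw [mul_pow]
    have : c ^ 2 < 1 := by nlinarith
    nlinarith [sq_nonneg c]
  have hpos : 0 < 1 - (c * s) ^ 2 := by linarith
  have hsq : 0 < √(1 - (c * s) ^ 2) := Real.sqrt_pos.mpr hpos
  -- Since `v` is tangent at `y`, only the component of `x` orthogonal to `y` counts, and its
  -- squared norm is `1 - s²`.
  have hin : inner ℝ x v = inner ℝ (x - s • y) v := by
    rw [inner_sub_left, inner_smul_left, hv]
    simp
  have hnorm : ‖x - s • y‖ ^ 2 = 1 - s ^ 2 := by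
    rw [norm_sub_sq_real, hx, inner_smul_right, ← hs, norm_smul, hy, Real.norm_eq_abs, mul_one,
      sq_abs]
    ring
  have h1 : (c * ‖x - s • y‖) ≤ √(1 - (c * s) ^ 2) := by
    apply Real.le_sqrt_of_sq_le
    rw [mul_pow, hnorm]
    nlinarith [sq_nonneg c]
  rw [abs_mul, abs_of_pos (by positivity : 0 < 1 / √(1 - (c * s) ^ 2)), abs_mul,
    abs_of_nonneg hc0, one_div, inv_mul_le_iff₀ hsq, hin]
  calc c * |inner ℝ (x - s • y) v| ≤ c * (‖x - s • y‖ * ‖v‖) := by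
        gcongr
        exact abs_real_inner_le_norm _ _
    _ = (c * ‖x - s • y‖) * ‖v‖ := by ring
    _ ≤ _ := by gcongr

/-- A `C¹` curve on the sphere through two antipodal points has length at least `π`. -/
theorem C1Loop.pi_le_length (γ : C1Loop n) {t₀ : ℝ} (ht₀ : t₀ ∈ Icc (0 : ℝ) 1)
    (h : γ.lift t₀ = -γ.lift 0) :
    ENNReal.ofReal Real.pi ≤ γ.length (roundFactor n) := by
  let γ' : ℝ → Amb n := fun t => γ.lift t
  let d : ℝ → Amb n := derivWithin γ' (Icc 0 1)
  have hd : ∀ t ∈ Icc (0 : ℝ) 1, HasDerivWithinAt γ' (d t) (Icc 0 1) t := fun t ht =>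
    ((γ.contDiffOn_lift.differentiableOn (by simp)) t ht).hasDerivWithinAt
  have hdc : ContinuousOn d (Icc 0 1) :=
    γ.contDiffOn_lift.continuousOn_derivWithin (uniqueDiffOn_Icc zero_lt_one) le_rfl
  have hperp : ∀ t ∈ Icc (0 : ℝ) 1, inner ℝ (γ' t) (d t) = 0 := by
    intro t ht
    have h1 := (hd t ht).inner ℝ (hd t ht)
    have h2 : HasDerivWithinAt (fun s => inner ℝ (γ' s) (γ' s)) 0 (Icc 0 1) t := by
      have : (fun s => inner ℝ (γ' s) (γ' s)) = fun _ => (1 : ℝ) := by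
        funext s
        simp [γ']
      rw [this]
      exact hasDerivWithinAt_const _ _ _
    have h3 := (uniqueDiffOn_Icc zero_lt_one t ht).eq_deriv _ h1 h2
    rw [real_inner_comm (γ' t) (d t)] at h3
    linarith
  have hlen : ENNReal.ofReal (∫ t in (0 : ℝ)..t₀, ‖d t‖) ≤ γ.length (roundFactor n) := by
    rw [intervalIntegral.integral_of_le ht₀.1, ofReal_integral_norm_eq_lintegral_enorm]
    · unfold C1Loop.length roundFactor
      simp only [one_mul]
      exact lintegral_mono_set (Ioc_subset_Icc_self.trans (Icc_subset_Icc_right ht₀.2))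
    · exact ((hdc.mono (Icc_subset_Icc_right ht₀.2)).integrableOn_Icc).mono_set Ioc_subset_Icc_self
  refine le_trans (ENNReal.ofReal_le_ofReal ?_) hlen
  -- The spherical height `arcsin ⟨x, γ⟩` is 1-Lipschitz but `arcsin` is not differentiable at `±1`,
  -- the values at the two ends. The factor `c < 1` avoids this; the height then changes by `2
  -- arcsin c`, which tends to `π` as `c → 1`.
  have hkey : ∀ c ∈ Ioo (0 : ℝ) 1, 2 * Real.arcsin c ≤ ∫ t in (0 : ℝ)..t₀, ‖d t‖ := by
    intro c hc
    let x : Amb n := γ' 0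
    have hx : ‖x‖ = 1 := by simp [x, γ']
    let F : ℝ → ℝ := fun t => Real.arcsin (c * inner ℝ x (γ' t))
    let F' : ℝ → ℝ := fun t =>
      1 / √(1 - (c * inner ℝ x (γ' t)) ^ 2) * (c * inner ℝ x (d t))
    have hs : ∀ t, |c * inner ℝ x (γ' t)| < 1 := by
      intro t
      rw [abs_mul, abs_of_pos hc.1]
      have : |inner ℝ x (γ' t)| ≤ 1 := by
        simpa [hx, γ'] using abs_real_inner_le_norm x (γ' t)
      nlinarith [hc.1, hc.2]
    have hF : ∀ t ∈ Icc (0 : ℝ) 1, HasDerivWithinAt F (F' t) (Icc 0 1) t := by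
      intro t ht
      have h1 : HasDerivWithinAt (fun t => c * inner ℝ x (γ' t)) (c * inner ℝ x (d t))
          (Icc 0 1) t := by
        have := (hasDerivWithinAt_const t (Icc 0 1) x).inner ℝ (hd t ht)
        simpa using this.const_mul c
      have hab := abs_lt.mp (hs t)
      exact (Real.hasDerivAt_arcsin hab.1.ne' hab.2.ne).comp_hasDerivWithinAt t h1
    have hγc : ContinuousOn γ' (Icc 0 1) := γ.contDiffOn_lift.continuousOn
    have hF'c : ContinuousOn F' (Icc 0 1) := by
      refine ContinuousOn.mul (ContinuousOn.div continuousOn_const ?_ ?_) ?_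
      · refine ContinuousOn.sqrt (continuousOn_const.sub (ContinuousOn.pow ?_ 2))
        exact continuousOn_const.mul (continuousOn_const.inner hγc)
      · intro t _
        refine (Real.sqrt_pos.mpr ?_).ne'
        have := (sq_lt_one_iff_abs_lt_one _).mpr (hs t)
        linarith
      · exact continuousOn_const.mul (continuousOn_const.inner hdc)
    have hsub : Icc (0 : ℝ) t₀ ⊆ Icc 0 1 := Icc_subset_Icc_right ht₀.2
    have hFTC : ∫ t in (0 : ℝ)..t₀, F' t = F t₀ - F 0 := by
      refine intervalIntegral.integral_eq_sub_of_hasDeriv_right_of_le ht₀.1 ?_ ?_ ?_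
      · exact fun t ht => ((hF t (hsub ht)).continuousWithinAt).mono hsub
      · intro t ht
        have ht1 : t ∈ Icc (0 : ℝ) 1 := hsub (Ioo_subset_Icc_self ht)
        have : Icc (0 : ℝ) 1 ∈ nhds t := Icc_mem_nhds ht.1 (ht.2.trans_le ht₀.2)
        exact ((hF t ht1).hasDerivAt this).hasDerivWithinAt
      · exact ((hF'c.mono hsub).intervalIntegrable_of_Icc ht₀.1)
    have hF0 : F 0 = Real.arcsin c := by
      simp [F, x, hx, γ']
    have hF1 : F t₀ = -Real.arcsin c := by
      have : γ' t₀ = -x := by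
        simp only [γ', x, h]
        simp
      simp only [F, this, inner_neg_right, real_inner_self_eq_norm_sq, hx]
      simp [Real.arcsin_neg]
    have hle : ‖∫ t in (0 : ℝ)..t₀, F' t‖ ≤ ∫ t in (0 : ℝ)..t₀, ‖d t‖ := by
      refine intervalIntegral.norm_integral_le_of_norm_le ht₀.1 ?_ ?_
      · refine Filter.Eventually.of_forall fun t ht => ?_
        have ht1 : t ∈ Icc (0 : ℝ) 1 := hsub (Ioc_subset_Icc_self ht)
        exact abs_mul_inner_div_sqrt_le hx (by simp [γ']) (hperp t ht1) hc.1.le hc.2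
      · exact ((hdc.mono hsub).norm.intervalIntegrable_of_Icc ht₀.1)
    rw [hFTC, hF0, hF1, Real.norm_eq_abs] at hle
    have h5 := neg_abs_le (-Real.arcsin c - Real.arcsin c)
    linarith
  have hlim : Filter.Tendsto (fun c : ℝ => 2 * Real.arcsin c) (nhdsWithin 1 (Iio 1))
      (nhds Real.pi) := by
    have : Filter.Tendsto (fun c : ℝ => 2 * Real.arcsin c) (nhds 1)
        (nhds (2 * Real.arcsin 1)) := (Real.continuous_arcsin.const_mul 2).tendsto' _ _ rfl |>.comp
          Filter.tendsto_id
    rw [Real.arcsin_one, mul_div_cancel₀ _ (two_ne_zero)] at this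
    exact this.mono_left nhdsWithin_le_nhds
  refine le_of_tendsto hlim ?_
  filter_upwards [Ioo_mem_nhdsLT (zero_lt_one' ℝ)] with c hc using hkey c hc

/-- A lift that misses the antipode of its starting point can be contracted, so the lift of a
noncontractible loop reaches the antipode and has length at least `π`. -/
theorem pi_le_sys_roundFactor (n : ℕ) : ENNReal.ofReal Real.pi ≤ sys (roundFactor n) := by
  refine le_iInf₂ fun γ hγ => ?_
  by_contra hlt
  refine hγ (γ.contractible_of_forall_ne fun t ht h => hlt (γ.pi_le_length ht h))

end Loops


/-! ### Half great circles as noncontractible loops -/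

section GreatCircles

variable {n : ℕ}

theorem norm_cos_add_sin {u v : Amb n} (hu : ‖u‖ = 1) (hv : ‖v‖ = 1) (huv : inner ℝ u v = 0)
    (s : ℝ) : ‖Real.cos s • u + Real.sin s • v‖ = 1 := by
  have : ‖Real.cos s • u + Real.sin s • v‖ ^ 2 = 1 := by
    rw [norm_add_sq_real, inner_smul_left, inner_smul_right, huv, norm_smul, norm_smul, hu, hv]
    simp
  nlinarith [norm_nonneg (Real.cos s • u + Real.sin s • v)]

theorem inner_single_zero_last (hn : 1 ≤ n) :
    inner ℝ (EuclideanSpace.single 0 1 : Amb n) (EuclideanSpace.single (Fin.last n) 1) = 0 := by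
  have hne : Fin.last n ≠ 0 := fun h => by
    have h1 := congrArg Fin.val h
    rw [Fin.val_last, Fin.val_zero] at h1
    omega
  simp [EuclideanSpace.inner_single_left, hne.symm]

/-- The half great circle spanned by the first and the last vector of the standard basis. -/
def halfCircle (hn : 1 ≤ n) (t : ℝ) : Sph n :=
  ⟨Real.cos (Real.pi * t) • EuclideanSpace.single 0 1 +
    Real.sin (Real.pi * t) • EuclideanSpace.single (Fin.last n) 1, by
      rw [mem_sphere_zero_iff_norm]
      exact norm_cos_add_sin (by simp) (by simp) (inner_single_zero_last hn) _⟩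

theorem coe_halfCircle (hn : 1 ≤ n) (t : ℝ) : (halfCircle hn t : Amb n) =
    Real.cos (Real.pi * t) • EuclideanSpace.single 0 1 +
    Real.sin (Real.pi * t) • EuclideanSpace.single (Fin.last n) 1 := rfl

theorem contDiff_halfCircle (hn : 1 ≤ n) (A : Amb n ≃ₗᵢ[ℝ] Amb n) :
    ContDiff ℝ 1 fun t => (sphMap A (halfCircle hn t) : Amb n) := by
  simp only [coe_sphMap, coe_halfCircle]
  refine A.contDiff.comp ?_
  fun_prop

theorem continuous_halfCircle (hn : 1 ≤ n) : Continuous (halfCircle hn) := by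
  refine Continuous.subtype_mk ?_ _
  fun_prop

/-- The image of the half great circle under an isometry, as a loop in projective space. -/
def halfCircleLoop (hn : 1 ≤ n) (A : Amb n ≃ₗᵢ[ℝ] Amb n) : C1Loop n where
  base := proj (sphMap A (halfCircle hn 0))
  loop :=
    { toFun := fun t => proj (sphMap A (halfCircle hn t))
      continuous_toFun := continuous_proj.comp ((continuous_sphMap A).comp
        ((continuous_halfCircle hn).comp continuous_subtype_val))
      source' := by simp
      target' := by
        rw [proj_eq_proj_iff]
        right
        ext1
        simp [coe_halfCircle] }
  lift t := sphMap A (halfCircle hn t)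
  contDiffOn_lift := (contDiff_halfCircle hn A).contDiffOn
  proj_lift _ := rfl

theorem not_contractible_halfCircleLoop (hn : 1 ≤ n) (A : Amb n ≃ₗᵢ[ℝ] Amb n) :
    ¬ (halfCircleLoop hn A).Contractible := by
  apply C1Loop.not_contractible_of_lift_one
  ext1
  simp [halfCircleLoop, coe_halfCircle]

theorem length_halfCircleLoop (hn : 1 ≤ n) (A : Amb n ≃ₗᵢ[ℝ] Amb n) (f : RP n → ℝ≥0∞) :
    (halfCircleLoop hn A).length f =
      ENNReal.ofReal Real.pi * ∫⁻ t in Icc (0 : ℝ) 1, f (proj (sphMap A (halfCircle hn t))) := by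
  rw [← lintegral_const_mul' _ _ ENNReal.ofReal_ne_top]
  refine setLIntegral_congr_fun measurableSet_Icc fun t ht => ?_
  -- The velocity is `π` times the image of the point a quarter turn ahead, so the speed is
  -- constantly `π`.
  have hder : HasDerivAt (fun t => (sphMap A (halfCircle hn t) : Amb n))
      (A (Real.pi • (Real.cos (Real.pi * t + Real.pi / 2) • EuclideanSpace.single 0 1 +
        Real.sin (Real.pi * t + Real.pi / 2) • EuclideanSpace.single (Fin.last n) 1))) t := by
    simp only [coe_sphMap, coe_halfCircle]
    refine A.toContinuousLinearEquiv.hasFDerivAt.comp_hasDerivAt t ?_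
    have hlin : HasDerivAt (fun t : ℝ => Real.pi * t) Real.pi t := by
      simpa using (hasDerivAt_id t).const_mul Real.pi
    have h1 := (hlin.cos.smul_const (EuclideanSpace.single 0 1 : Amb n)).add
      (hlin.sin.smul_const (EuclideanSpace.single (Fin.last n) 1 : Amb n))
    refine h1.congr_deriv ?_
    rw [Real.cos_add_pi_div_two, Real.sin_add_pi_div_two, smul_add, smul_smul, smul_smul]
    congr 2 <;> ring
  have hnorm : ‖derivWithin (fun s => ((halfCircleLoop hn A).lift s : Amb n)) (Icc 0 1) t‖ₑ =
      ENNReal.ofReal Real.pi := by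
    rw [show derivWithin (fun s => ((halfCircleLoop hn A).lift s : Amb n)) (Icc 0 1) t = _ from
      hder.hasDerivWithinAt.derivWithin (uniqueDiffOn_Icc zero_lt_one t ht),
      ← ofReal_norm, A.norm_map, norm_smul,
      norm_cos_add_sin (by simp) (by simp) (inner_single_zero_last hn), mul_one, Real.norm_eq_abs,
      abs_of_pos Real.pi_pos]
  simp only [hnorm]
  rw [mul_comm]
  rfl

end GreatCircles

/-! ### The isosystolic inequality and its equality case -/

section Average

variable {n : ℕ}

/-- Membership in `Lⁿ` gives measurability only up to a null set, while the averaging needs a Borel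
function for Fubini. -/
theorem exists_measurable_lift {f : RP n → ℝ≥0∞} (hf : AEMeasurable f (rpVol n)) :
    ∃ F : Sph n → ℝ≥0∞, Measurable F ∧ (fun x => f (proj x)) =ᵐ[sphVol n] F := by
  have hac : (sphVol n).map proj ≪ rpVol n := by
    refine Measure.AbsolutelyContinuous.mk fun s _ hs => ?_
    rw [rpVol, Measure.smul_apply, smul_eq_mul, mul_eq_zero] at hs
    exact hs.resolve_left (by simp)
  have h1 : AEMeasurable (fun x => f (proj x)) (sphVol n) :=
    (hf.mono_ac hac).comp_measurable measurable_proj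
  exact ⟨h1.mk _, h1.measurable_mk, h1.ae_eq_mk⟩

theorem vol_eq {f : RP n → ℝ≥0∞} (hf : AEMeasurable f (rpVol n)) :
    vol f = 2⁻¹ * ∫⁻ x, f (proj x) ^ n ∂(sphVol n) := by
  have hac : (sphVol n).map proj ≪ rpVol n := by
    refine Measure.AbsolutelyContinuous.mk fun s _ hs => ?_
    rw [rpVol, Measure.smul_apply, smul_eq_mul, mul_eq_zero] at hs
    exact hs.resolve_left (by simp)
  rw [vol, rpVol, lintegral_smul_measure, smul_eq_mul,
    lintegral_map' ((hf.mono_ac hac).pow_const n) measurable_proj.aemeasurable]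

/-- The systole is at most `π` times the mean value of the conformal factor. -/
theorem sys_le_average (hn : 1 ≤ n) {f : RP n → ℝ≥0∞} {F : Sph n → ℝ≥0∞} (hF : Measurable F)
    (hfF : (fun x => f (proj x)) =ᵐ[sphVol n] F) :
    sys f ≤ ENNReal.ofReal Real.pi * ((sphVol n univ)⁻¹ * ∫⁻ x, F x ∂(sphVol n)) := by
  obtain ⟨Ω, mΩ, P, A, hP, hA, hav⟩ := exists_isometry_average n
  have hjoint : Measurable fun p : Ω × ℝ => sphMap (A p.1) (halfCircle hn p.2) :=
    hA.comp (measurable_fst.prodMk ((continuous_halfCircle hn).measurable.comp measurable_snd))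
  -- Lengths involve the values of `f` itself, not those of the Borel representative `F`. The two
  -- differ only inside the null set `N`, and by Fubini the half circle of almost every isometry
  -- spends no time in `N`.
  obtain ⟨N, hN, hNm, hN0⟩ := exists_measurable_superset_of_null (ae_iff.mp hfF)
  have hnull : ∀ᵐ ω ∂P, ∀ᵐ t ∂(volume.restrict (Icc (0 : ℝ) 1)),
      sphMap (A ω) (halfCircle hn t) ∉ N := by
    have hI : Measurable (N.indicator (fun _ => (1 : ℝ≥0∞))) := measurable_const.indicator hNm
    have h0 : ∫⁻ ω, (∫⁻ t in Icc (0 : ℝ) 1,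
        N.indicator (fun _ => (1 : ℝ≥0∞)) (sphMap (A ω) (halfCircle hn t))) ∂P = 0 := by
      rw [lintegral_lintegral_swap (by exact (hI.comp hjoint).aemeasurable)]
      simp [hav _ hI, hNm, hN0]
    rw [lintegral_eq_zero_iff (by exact Measurable.lintegral_prod_right' (hI.comp hjoint))] at h0
    filter_upwards [h0] with ω hω
    rw [Pi.zero_apply, lintegral_eq_zero_iff
      (by exact hI.comp (hjoint.comp (measurable_const.prodMk measurable_id)))] at hω
    filter_upwards [hω] with t ht hmem
    simp [hmem] at ht
  calc sys f = ∫⁻ _ω, sys f ∂P := by simp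
    _ ≤ ∫⁻ ω, (ENNReal.ofReal Real.pi *
          ∫⁻ t in Icc (0 : ℝ) 1, F (sphMap (A ω) (halfCircle hn t))) ∂P := by
        refine lintegral_mono_ae ?_
        filter_upwards [hnull] with ω hω
        refine (iInf₂_le (halfCircleLoop hn (A ω))
          (not_contractible_halfCircleLoop hn (A ω))).trans ?_
        rw [length_halfCircleLoop]
        gcongr 1
        refine lintegral_mono_ae ?_
        filter_upwards [hω] with t ht
        by_contra hne
        exact ht (hN fun heq => hne heq.le)
    _ = _ := by
        rw [lintegral_const_mul _ (by exact Measurable.lintegral_prod_right' (hF.comp hjoint)),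
          lintegral_lintegral_swap (by exact (hF.comp hjoint).aemeasurable)]
        simp [hav _ hF]

/-- For the normalized measure, the `L¹` norm is at most the `Lⁿ` norm. -/
theorem average_pow_le (hn : 1 ≤ n) {X : Type*} [MeasurableSpace X] {m : Measure X}
    [IsFiniteMeasure m] (hm : m univ ≠ 0) {F : X → ℝ≥0∞} (hF : Measurable F) :
    ((m univ)⁻¹ * ∫⁻ x, F x ∂m) ^ n ≤ (m univ)⁻¹ * ∫⁻ x, F x ^ n ∂m := by
  have hp : IsProbabilityMeasure ((m univ)⁻¹ • m) := ⟨by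
    rw [Measure.smul_apply, smul_eq_mul, ENNReal.inv_mul_cancel hm (measure_ne_top _ _)]⟩
  have h := eLpNorm'_le_eLpNorm'_of_exponent_le (μ := (m univ)⁻¹ • m) (p := 1) (q := n)
    (f := F) zero_lt_one (by exact_mod_cast hn) hF.aestronglyMeasurable
  have hn0 : (n : ℝ) ≠ 0 := by positivity
  simp only [eLpNorm'_eq_lintegral_enorm, enorm_eq_self, ENNReal.rpow_one, div_one,
    ENNReal.rpow_natCast, lintegral_smul_measure, smul_eq_mul] at h
  calc _ ≤ (((m univ)⁻¹ * ∫⁻ x, F x ^ n ∂m) ^ (1 / (n : ℝ))) ^ n := by gcongr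
    _ = _ := by
      rw [← ENNReal.rpow_natCast, ← ENNReal.rpow_mul, one_div_mul_cancel hn0, ENNReal.rpow_one]

/-- Equality in the Cauchy–Schwarz inequality for the mean value. -/
theorem ae_const_of_average_sq_le {X : Type*} [MeasurableSpace X] {m : Measure X}
    [IsFiniteMeasure m] (hm : m univ ≠ 0) {F : X → ℝ≥0∞} (hF : Measurable F)
    (hfin : ∫⁻ x, F x ^ 2 ∂m ≠ ⊤)
    (h : (m univ)⁻¹ * ∫⁻ x, F x ^ 2 ∂m ≤ ((m univ)⁻¹ * ∫⁻ x, F x ∂m) ^ 2) :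
    ∃ c : ℝ≥0∞, F =ᵐ[m] fun _ => c := by
  have hFfin : ∀ᵐ x ∂m, F x < ⊤ := by
    filter_upwards [ae_lt_top (hF.pow_const 2) hfin] with x hx
    exact lt_top_iff_ne_top.mpr fun htop => by simp [htop] at hx
  let g : X → ℝ := fun x => (F x).toReal
  have hg : Measurable g := hF.ennreal_toReal
  have hFg : ∀ᵐ x ∂m, F x = ENNReal.ofReal (g x) := by
    filter_upwards [hFfin] with x hx
    exact (ENNReal.ofReal_toReal hx.ne).symm
  have hsq : ∫⁻ x, F x ^ 2 ∂m = ∫⁻ x, ENNReal.ofReal (g x ^ 2) ∂m := by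
    refine lintegral_congr_ae ?_
    filter_upwards [hFg] with x hx
    rw [hx, ENNReal.ofReal_pow ENNReal.toReal_nonneg]
  have hint2 : Integrable (fun x => g x ^ 2) m := by
    refine ⟨(hg.pow_const 2).aestronglyMeasurable, ?_⟩
    rw [hasFiniteIntegral_iff_ofReal (Filter.Eventually.of_forall fun x => sq_nonneg _), ← hsq]
    exact lt_top_iff_ne_top.mpr hfin
  have hint : Integrable g m := by
    refine (hint2.add (integrable_const 1)).mono' hg.aestronglyMeasurable
      (Filter.Eventually.of_forall fun x => ?_)
    rw [Real.norm_eq_abs, abs_of_nonneg ENNReal.toReal_nonneg, Pi.add_apply]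
    nlinarith [sq_nonneg (g x - 1), sq_nonneg (g x)]
  have h1 : ∫⁻ x, F x ∂m = ENNReal.ofReal (∫ x, g x ∂m) := by
    rw [ofReal_integral_eq_lintegral_ofReal hint
      (Filter.Eventually.of_forall fun x => ENNReal.toReal_nonneg)]
    exact lintegral_congr_ae hFg
  have h2 : ∫⁻ x, F x ^ 2 ∂m = ENNReal.ofReal (∫ x, g x ^ 2 ∂m) := by
    rw [hsq, ofReal_integral_eq_lintegral_ofReal hint2
      (Filter.Eventually.of_forall fun x => sq_nonneg _)]
  set V := m.real univ with hV
  have hVpos : 0 < V := ENNReal.toReal_pos hm (measure_ne_top _ _)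
  have hmV : m univ = ENNReal.ofReal V := (ENNReal.ofReal_toReal (measure_ne_top _ _)).symm
  have hg0 : 0 ≤ ∫ x, g x ∂m := integral_nonneg fun x => ENNReal.toReal_nonneg
  rw [h1, h2, hmV, ← ENNReal.ofReal_inv_of_pos hVpos, ← ENNReal.ofReal_mul (by positivity),
    ← ENNReal.ofReal_mul (by positivity), ← ENNReal.ofReal_pow (by positivity),
    ENNReal.ofReal_le_ofReal_iff (by positivity)] at h
  set a := V⁻¹ * ∫ x, g x ∂m with ha
  have hga : ∫ x, g x ∂m = V * a := by rw [ha]; field_simp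
  have hg2 : ∫ x, g x ^ 2 ∂m ≤ V * a ^ 2 := by
    rwa [inv_mul_le_iff₀ hVpos] at h
  -- The variance: the second moment is at most the square of the mean, so the variance cannot be
  -- positive.
  have hzero : ∫ x, (g x - a) ^ 2 ∂m = 0 := by
    have hexp : ∫ x, (g x - a) ^ 2 ∂m = ∫ x, g x ^ 2 ∂m - 2 * a * (V * a) + V * a ^ 2 := by
      have : ∀ x, (g x - a) ^ 2 = g x ^ 2 - 2 * a * g x + a ^ 2 := fun x => by ring
      simp only [this]
      rw [integral_add (by exact hint2.sub (hint.const_mul _)) (integrable_const _),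
        integral_sub hint2 (hint.const_mul _), integral_const_mul, hga]
      simp [hV]
    have hnn : 0 ≤ ∫ x, (g x - a) ^ 2 ∂m := integral_nonneg fun x => sq_nonneg _
    nlinarith
  have hint3 : Integrable (fun x => (g x - a) ^ 2) m := by
    have : (fun x => (g x - a) ^ 2) = fun x => g x ^ 2 - 2 * a * g x + a ^ 2 := by
      funext x; ring
    rw [this]
    exact (hint2.sub (hint.const_mul _)).add (integrable_const _)
  rw [integral_eq_zero_iff_of_nonneg (fun x => sq_nonneg _) hint3] at hzero
  refine ⟨ENNReal.ofReal a, ?_⟩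
  filter_upwards [hzero, hFg] with x hx hx2
  have : g x - a = 0 := by simpa using hx
  rw [hx2, sub_eq_zero.mp this]

theorem vol_roundFactor (n : ℕ) : vol (roundFactor n) = 2⁻¹ * sphVol n univ := by
  rw [vol_eq (by unfold roundFactor; fun_prop)]
  simp [roundFactor]

theorem div_le_div_sys_roundFactor (n : ℕ) : vol (roundFactor n) / sys (roundFactor n) ^ n ≤
    vol (roundFactor n) / ENNReal.ofReal Real.pi ^ n := by
  gcongr
  exact pi_le_sys_roundFactor n

theorem vol_ne_top (hn : 1 ≤ n) {f : RP n → ℝ≥0∞} (hf : MemLp f (n : ℝ≥0∞) (rpVol n)) :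
    vol f ≠ ⊤ := by
  have hn0 : (n : ℝ≥0∞) ≠ 0 := by simp; omega
  have h := lintegral_rpow_enorm_lt_top_of_eLpNorm_lt_top hn0 (by simp) hf.2
  simpa [vol] using h.ne

/-- The isosystolic inequality for conformally round metrics on projective space. -/
theorem pu_inequality (hn : 1 ≤ n) {f : RP n → ℝ≥0∞} (hf : MemLp f (n : ℝ≥0∞) (rpVol n))
    (hsys : sys f ≠ 0) :
    vol (roundFactor n) / sys (roundFactor n) ^ n ≤ vol f / sys f ^ n := by
  obtain ⟨F, hF, hfF⟩ := exists_measurable_lift hf.1.aemeasurable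
  have hvol : vol f = 2⁻¹ * ∫⁻ x, F x ^ n ∂(sphVol n) := by
    rw [vol_eq hf.1.aemeasurable]
    congr 1
    refine lintegral_congr_ae ?_
    filter_upwards [hfF] with x hx
    rw [hx]
  have hpow : sys f ^ n ≤ ENNReal.ofReal Real.pi ^ n *
      ((sphVol n univ)⁻¹ * ∫⁻ x, F x ^ n ∂(sphVol n)) := by
    calc sys f ^ n ≤ _ := pow_le_pow_left' (sys_le_average hn hF hfF) n
      _ = _ := mul_pow _ _ _
      _ ≤ _ := by
        gcongr
        exact average_pow_le hn (sphVol_univ_ne_zero n) hF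
  have hpi0 : ENNReal.ofReal Real.pi ^ n ≠ 0 := pow_ne_zero _ (by simp [Real.pi_pos])
  have hpit : ENNReal.ofReal Real.pi ^ n ≠ ⊤ := by finiteness
  -- The round systole is replaced by its lower bound `π`. Afterwards, finiteness of the volume
  -- makes it legitimate to clear the denominator even if the systole were infinite.
  refine (div_le_div_sys_roundFactor n).trans ?_
  rw [ENNReal.le_div_iff_mul_le (Or.inl (pow_ne_zero _ hsys)) (Or.inr (vol_ne_top hn hf))]
  refine (mul_le_mul_right hpow _).trans ?_
  rw [← mul_assoc, ENNReal.div_mul_cancel hpi0 hpit, vol_roundFactor, mul_assoc, ← mul_assoc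
    (sphVol n univ), ENNReal.mul_inv_cancel (sphVol_univ_ne_zero n) (measure_ne_top _ _), one_mul,
    hvol]

/-- In the equality case of the isosystolic inequality for the projective plane, the conformal
factor is constant. -/
theorem ae_const_of_pu_equality {f : RP 2 → ℝ≥0∞} (hf : MemLp f 2 (rpVol 2)) (hsys : sys f ≠ 0)
    (heq : vol f / sys f ^ 2 = vol (roundFactor 2) / sys (roundFactor 2) ^ 2) :
    ∃ c : ℝ≥0∞, ∀ᵐ x ∂(sphVol 2), f (proj x) = c := by
  have hf' : MemLp f ((2 : ℕ) : ℝ≥0∞) (rpVol 2) := by exact_mod_cast hf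
  obtain ⟨F, hF, hfF⟩ := exists_measurable_lift hf.1.aemeasurable
  have hvol : vol f = 2⁻¹ * ∫⁻ x, F x ^ 2 ∂(sphVol 2) := by
    rw [vol_eq hf.1.aemeasurable]
    congr 1
    refine lintegral_congr_ae ?_
    filter_upwards [hfF] with x hx
    rw [hx]
  have hfin : ∫⁻ x, F x ^ 2 ∂(sphVol 2) ≠ ⊤ := by
    intro htop
    apply vol_ne_top (by norm_num) hf'
    rw [hvol, htop]
    simp [ENNReal.mul_top]
  have hV0 := sphVol_univ_ne_zero 2
  have hVt : sphVol 2 univ ≠ ⊤ := measure_ne_top _ _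
  have hpi0 : ENNReal.ofReal Real.pi ^ 2 ≠ 0 := pow_ne_zero _ (by simp [Real.pi_pos])
  have hpit : ENNReal.ofReal Real.pi ^ 2 ≠ ⊤ := by finiteness
  have hsle := sys_le_average (by norm_num : 1 ≤ 2) hF hfF
  have hs2 : sys f ^ 2 ≤ ENNReal.ofReal Real.pi ^ 2 *
      ((sphVol 2 univ)⁻¹ * ∫⁻ x, F x ∂(sphVol 2)) ^ 2 := by
    rw [← mul_pow]
    gcongr
  -- Equality bounds the ratio from above; with the averaging bound on the systole this is the
  -- reverse of Cauchy–Schwarz.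
  have hle : vol f / sys f ^ 2 ≤ vol (roundFactor 2) / ENNReal.ofReal Real.pi ^ 2 :=
    heq.le.trans (div_le_div_sys_roundFactor 2)
  rw [ENNReal.div_le_iff_le_mul (Or.inl (pow_ne_zero _ hsys)) (Or.inr (by
    rw [vol_roundFactor]
    refine (ENNReal.div_pos (mul_ne_zero (by simp) hV0) hpit).ne'))] at hle
  have hle2 := hle.trans (mul_le_mul_right hs2 _)
  rw [← mul_assoc, ENNReal.div_mul_cancel hpi0 hpit, vol_roundFactor, hvol, mul_assoc,
    ENNReal.mul_le_mul_iff_right (by simp) (by simp)] at hle2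
  obtain ⟨c, hc⟩ := ae_const_of_average_sq_le hV0 hF hfin (by
    rwa [ENNReal.inv_mul_le_iff hV0 hVt])
  exact ⟨c, by filter_upwards [hfF, hc] with x h1 h2; exact h1.trans h2⟩

end Average


/-! ### Conformal cylindrical coordinates on the two-sphere -/

section Cylinder

/-- Conformal cylindrical coordinates on the unit sphere of `ℝ³`. -/
def cyl (p : ℝ × ℝ) : Sph 2 :=
  ⟨!₂[Real.cos p.2 / Real.cosh p.1, Real.sin p.2 / Real.cosh p.1,
    Real.sinh p.1 / Real.cosh p.1], by
      have hc : Real.cosh p.1 ≠ 0 := (Real.cosh_pos _).ne'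
      rw [mem_sphere_zero_iff_norm, EuclideanSpace.norm_eq, Real.sqrt_eq_one]
      simp only [Fin.sum_univ_three, Real.norm_eq_abs, sq_abs]
      simp only [Matrix.cons_val_zero, Matrix.cons_val_one, Matrix.cons_val, div_pow]
      field_simp
      have h1 := Real.cosh_sq p.1
      have h2 := Real.sin_sq_add_cos_sq p.2
      linarith⟩

theorem coe_cyl (p : ℝ × ℝ) : (cyl p : Amb 2) = !₂[Real.cos p.2 / Real.cosh p.1,
    Real.sin p.2 / Real.cosh p.1, Real.sinh p.1 / Real.cosh p.1] := rfl

theorem continuous_cyl : Continuous cyl := by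
  refine Continuous.subtype_mk ?_ _
  have hc : ∀ p : ℝ × ℝ, Real.cosh p.1 ≠ 0 := fun p => (Real.cosh_pos _).ne'
  refine (PiLp.continuous_toLp 2 _).comp (continuous_pi fun i => ?_)
  have h1 : Continuous fun p : ℝ × ℝ => Real.cosh p.1 := Real.continuous_cosh.comp continuous_fst
  have h2 : Continuous fun p : ℝ × ℝ => Real.sinh p.1 := Real.continuous_sinh.comp continuous_fst
  fin_cases i
  · exact (Real.continuous_cos.comp continuous_snd).div h1 hc
  · exact (Real.continuous_sin.comp continuous_snd).div h1 hc
  · exact h2.div h1 hc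

/-- Lebesgue measure on the cylinder `ℝ × (-π, π)`. -/
def cylVol : Measure (ℝ × ℝ) :=
  (volume : Measure ℝ).prod ((volume : Measure ℝ).restrict (Ioo (-Real.pi) Real.pi))

/-- The coordinates `(X₂, (X₀, X₁))` of a point of `ℝ³`. -/
def splitCoord : Amb 2 ≃ᵐ ℝ × (ℝ × ℝ) :=
  ((MeasurableEquiv.toLp 2 (Fin 3 → ℝ)).symm.trans
    (MeasurableEquiv.piFinSuccAbove (fun _ => ℝ) 2)).trans
      (MeasurableEquiv.prodCongr (MeasurableEquiv.refl ℝ) MeasurableEquiv.finTwoArrow)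

theorem splitCoord_toLp (x y z : ℝ) : splitCoord !₂[x, y, z] = (z, (x, y)) := rfl

theorem measurePreserving_splitCoord : MeasurePreserving splitCoord volume volume := by
  refine ((MeasurePreserving.id volume).prod (volume_preserving_finTwoArrow ℝ)).comp
    ((volume_preserving_piFinSuccAbove (fun _ : Fin 3 => ℝ) 2).comp
      (EuclideanSpace.volume_preserving_symm_measurableEquiv_toLp (Fin 3)))

theorem lintegral_amb_two (H : Amb 2 → ℝ≥0∞) (hH : Measurable H) :
    ∫⁻ X, H X = ∫⁻ z : ℝ, ∫⁻ q : ℝ × ℝ, H !₂[q.1, q.2, z] := by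
  have hs : ∀ p : ℝ × (ℝ × ℝ), splitCoord.symm p = !₂[p.2.1, p.2.2, p.1] := fun p => by
    rw [MeasurableEquiv.symm_apply_eq, splitCoord_toLp]
  have h := measurePreserving_splitCoord.symm.lintegral_comp hH
  rw [← h, Measure.volume_eq_prod, lintegral_prod _ (by fun_prop)]
  simp only [hs]

/-- The substitution `z = ϱ sinh t`. -/
theorem lintegral_mul_sinh {ϱ : ℝ} (hϱ : 0 < ϱ) (g : ℝ → ℝ≥0∞) :
    ∫⁻ z, g z = ∫⁻ t, ENNReal.ofReal (ϱ * Real.cosh t) * g (ϱ * Real.sinh t) := by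
  have h := lintegral_image_eq_lintegral_abs_deriv_mul (s := univ)
    (f := fun t => ϱ * Real.sinh t) (f' := fun t => ϱ * Real.cosh t) MeasurableSet.univ
    (fun t _ => ((Real.hasDerivAt_sinh t).const_mul ϱ).hasDerivWithinAt)
    (fun t _ s _ hts => Real.sinh_injective (mul_left_cancel₀ hϱ.ne' hts)) g
  have himg : (fun t => ϱ * Real.sinh t) '' univ = univ := by
    rw [image_univ, range_eq_univ]
    intro z
    obtain ⟨t, ht⟩ := Real.sinh_surjective (z / ϱ)
    exact ⟨t, by simp only [ht]; field_simp⟩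
  rw [himg, Measure.restrict_univ] at h
  rw [h]
  refine lintegral_congr fun t => ?_
  rw [abs_of_pos (mul_pos hϱ (Real.cosh_pos t))]

theorem lintegral_sq_Ioo {a : ℝ} (ha : 0 ≤ a) :
    ∫⁻ r in Ioo 0 a, ENNReal.ofReal (r ^ 2) = ENNReal.ofReal (a ^ 3 / 3) := by
  rw [Measure.restrict_congr_set Ioo_ae_eq_Ioc,
    ← ofReal_integral_eq_lintegral_ofReal (intervalIntegral.intervalIntegrable_pow _).1,
    ← intervalIntegral.integral_of_le ha]
  · congr 1
    simp
    norm_num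
  · exact Filter.Eventually.of_forall fun y => sq_nonneg y

theorem smul_mem_cone_iff {s : Set (Sph 2)} {r : ℝ} (hr : 0 < r) (x : Sph 2) :
    r • (x : Amb 2) ∈ Ioo (0 : ℝ) 1 • (((↑) : Sph 2 → Amb 2) '' s) ↔ r < 1 ∧ x ∈ s := by
  constructor
  · rintro ⟨r', hr', _, ⟨y, hy, rfl⟩, h⟩
    have h : r' • (y : Amb 2) = r • (x : Amb 2) := h
    have hrr : r' = r := by
      have := congrArg norm h
      simpa [norm_smul, abs_of_pos hr, abs_of_pos hr'.1] using this
    rw [hrr] at h hr'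
    have : y = x := Subtype.ext (smul_right_injective _ hr.ne' h)
    exact ⟨hr'.2, this ▸ hy⟩
  · rintro ⟨h1, h2⟩
    exact ⟨r, ⟨hr, h1⟩, _, ⟨x, h2, rfl⟩, rfl⟩

theorem measurableSet_cone {s : Set (Sph 2)} (hs : MeasurableSet s) :
    MeasurableSet (Ioo (0 : ℝ) 1 • (((↑) : Sph 2 → Amb 2) '' s)) := by
  have h1 : MeasurableSet (((↑) : Sph 2 → Amb 2) '' s) :=
    (MeasurableEmbedding.subtype_coe
      (Metric.isClosed_sphere.measurableSet)).measurableSet_image.mpr hs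
  rw [← image_smul_prod]
  refine (measurableSet_Ioo.prod h1).image_of_continuousOn_injOn
    (continuous_fst.smul continuous_snd).continuousOn ?_
  rintro ⟨r, _⟩ ⟨hr, ⟨x, hx, rfl⟩⟩ ⟨r', _⟩ ⟨hr', ⟨y, hy, rfl⟩⟩ h
  have h : r • (x : Amb 2) = r' • (y : Amb 2) := h
  have hr0 : 0 < r := hr.1
  have hr0' : 0 < r' := hr'.1
  have hrr : r = r' := by
    have := congrArg norm h
    simpa [norm_smul, abs_of_pos hr0, abs_of_pos hr0'] using this
  subst hrr
  have := smul_right_injective (Amb 2) hr0.ne' h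
  rw [Prod.mk.injEq]
  exact ⟨rfl, this⟩

/-- The spherical measure is three times the volume of the cone. With polar coordinates `(r, θ)` in
the first two variables and `z = r sinh t`, a point of space is `r cosh t` times `cyl (t, θ)`, so
the cone is the region where `r < 1 / cosh t` and `cyl (t, θ)` lies in the set. -/
theorem sphVol_two_apply {s : Set (Sph 2)} (hs : MeasurableSet s) :
    sphVol 2 s = ∫⁻ p, ENNReal.ofReal ((Real.cosh p.1 ^ 2)⁻¹) *
      s.indicator (fun _ => 1) (cyl p) ∂cylVol := by
  let C : Set (Amb 2) := Ioo (0 : ℝ) 1 • (((↑) : Sph 2 → Amb 2) '' s)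
  have hC : MeasurableSet C := measurableSet_cone hs
  let H : Amb 2 → ℝ≥0∞ := C.indicator fun _ => 1
  have hH : Measurable H := measurable_const.indicator hC
  have hpt : ∀ r t θ : ℝ, 0 < r → H !₂[r * Real.cos θ, r * Real.sin θ, r * Real.sinh t] =
      (Ioo 0 (Real.cosh t)⁻¹).indicator (fun _ => 1) r * s.indicator (fun _ => 1) (cyl (t, θ)) := by
    intro r t θ hr
    have hc := Real.cosh_pos t
    have e : !₂[r * Real.cos θ, r * Real.sin θ, r * Real.sinh t] =
        (r * Real.cosh t) • (cyl (t, θ) : Amb 2) := by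
      rw [coe_cyl]
      ext i
      fin_cases i <;> simp <;> field_simp
    have hiff : !₂[r * Real.cos θ, r * Real.sin θ, r * Real.sinh t] ∈ C ↔
        r ∈ Ioo 0 (Real.cosh t)⁻¹ ∧ cyl (t, θ) ∈ s := by
      rw [e, smul_mem_cone_iff (mul_pos hr hc), mem_Ioo, ← one_div, lt_div_iff₀ hc]
      tauto
    by_cases h1 : r ∈ Ioo 0 (Real.cosh t)⁻¹ <;> by_cases h2 : cyl (t, θ) ∈ s
    · rw [show H _ = _ from indicator_of_mem (hiff.mpr ⟨h1, h2⟩) _, indicator_of_mem h1, indicator_of_mem h2, one_mul]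
    · rw [show H _ = _ from indicator_of_notMem (fun h => h2 (hiff.mp h).2) _, indicator_of_notMem h2, mul_zero]
    · rw [show H _ = _ from indicator_of_notMem (fun h => h1 (hiff.mp h).1) _, indicator_of_notMem h1, zero_mul]
    · rw [show H _ = _ from indicator_of_notMem (fun h => h1 (hiff.mp h).1) _, indicator_of_notMem h1, zero_mul]
  have hpolar : ∀ z, ∫⁻ q : ℝ × ℝ, H !₂[q.1, q.2, z] = ∫⁻ r in Ioi (0 : ℝ),
      ∫⁻ θ in Ioo (-Real.pi) Real.pi,
        ENNReal.ofReal r * H !₂[r * Real.cos θ, r * Real.sin θ, z] := by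
    intro z
    rw [← lintegral_comp_polarCoord_symm, polarCoord_target, Measure.volume_eq_prod,
      setLIntegral_prod]
    · simp [polarCoord_symm_apply]
    · simp only [polarCoord_symm_apply, smul_eq_mul]
      refine (Measurable.mul (by fun_prop) (hH.comp ?_)).aemeasurable
      fun_prop
  have hz : ∀ r ∈ Ioi (0 : ℝ), ∀ θ : ℝ,
      ∫⁻ z, ENNReal.ofReal r * H !₂[r * Real.cos θ, r * Real.sin θ, z] =
      ∫⁻ t, ENNReal.ofReal (r * Real.cosh t) *
        (ENNReal.ofReal r * H !₂[r * Real.cos θ, r * Real.sin θ, r * Real.sinh t]) :=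
    fun r hr θ => lintegral_mul_sinh hr _
  -- The Jacobian is `r · r cosh t`, and its integral up to `1 / cosh t` is `1 / (3 cosh² t)`; the
  -- `1/3` cancels the dimension.
  have hr : ∀ t θ : ℝ, ∫⁻ r in Ioi (0 : ℝ), ENNReal.ofReal (r * Real.cosh t) *
        (ENNReal.ofReal r * H !₂[r * Real.cos θ, r * Real.sin θ, r * Real.sinh t]) =
      3⁻¹ * (ENNReal.ofReal ((Real.cosh t ^ 2)⁻¹) * s.indicator (fun _ => 1) (cyl (t, θ))) := by
    intro t θ
    have hc := Real.cosh_pos t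
    calc _ = ∫⁻ r in Ioi (0 : ℝ), (Ioo 0 (Real.cosh t)⁻¹).indicator
            (fun r => ENNReal.ofReal (r ^ 2)) r *
              (ENNReal.ofReal (Real.cosh t) * s.indicator (fun _ => 1) (cyl (t, θ))) := by
          refine setLIntegral_congr_fun measurableSet_Ioi fun r hr => ?_
          have hr : 0 < r := hr
          simp only [hpt r t θ hr]
          rw [ENNReal.ofReal_mul hr.le]
          by_cases h1 : r ∈ Ioo 0 (Real.cosh t)⁻¹
          · simp only [indicator_of_mem h1, ENNReal.ofReal_pow hr.le]
            ring
          · simp only [indicator_of_notMem h1, zero_mul, mul_zero]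
      _ = (∫⁻ r in Ioo 0 (Real.cosh t)⁻¹, ENNReal.ofReal (r ^ 2)) *
              (ENNReal.ofReal (Real.cosh t) * s.indicator (fun _ => 1) (cyl (t, θ))) := by
          rw [lintegral_mul_const _ ((by fun_prop : Measurable fun r : ℝ =>
            ENNReal.ofReal (r ^ 2)).indicator measurableSet_Ioo),
            setLIntegral_indicator measurableSet_Ioo, inter_eq_left.mpr Ioo_subset_Ioi_self]
      _ = _ := by
          rw [lintegral_sq_Ioo (by positivity), ← mul_assoc, ← mul_assoc,
            ← ENNReal.ofReal_mul (by positivity)]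
          congr 1
          rw [show (3 : ℝ≥0∞)⁻¹ = ENNReal.ofReal (3⁻¹) by
            rw [ENNReal.ofReal_inv_of_pos (by norm_num)]; norm_num,
            ← ENNReal.ofReal_mul (by positivity)]
          congr 1
          field_simp
  have hfin : sphVol 2 s = 3 * ∫⁻ X, H X := by
    rw [sphVol, Measure.toSphere_apply' _ hs,
      show ∫⁻ X, H X = volume C from lintegral_indicator_one hC]
    simp [C]
  rw [hfin, lintegral_amb_two H hH]
  simp only [hpolar]
  rw [lintegral_lintegral_swap]
  swap
  · refine Measurable.aemeasurable ?_
    exact Measurable.lintegral_prod_right' (f := fun q : (ℝ × ℝ) × ℝ => ENNReal.ofReal q.1.2 *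
      H !₂[q.1.2 * Real.cos q.2, q.1.2 * Real.sin q.2, q.1.1])
      (by fun_prop)
  have step : ∀ r ∈ Ioi (0 : ℝ), ∫⁻ z, ∫⁻ θ in Ioo (-Real.pi) Real.pi,
        ENNReal.ofReal r * H !₂[r * Real.cos θ, r * Real.sin θ, z] =
      ∫⁻ t, ∫⁻ θ in Ioo (-Real.pi) Real.pi, ENNReal.ofReal (r * Real.cosh t) *
        (ENNReal.ofReal r * H !₂[r * Real.cos θ, r * Real.sin θ, r * Real.sinh t]) := by
    intro r hr
    refine (lintegral_lintegral_swap ?_).trans (Eq.trans ?_ (lintegral_lintegral_swap ?_).symm)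
    · exact (by fun_prop : Measurable fun q : ℝ × ℝ => ENNReal.ofReal r *
        H !₂[r * Real.cos q.2, r * Real.sin q.2, q.1]).aemeasurable
    · exact lintegral_congr fun θ => hz r hr θ
    · exact (by fun_prop : Measurable fun q : ℝ × ℝ => ENNReal.ofReal (r * Real.cosh q.1) *
        (ENNReal.ofReal r * H !₂[r * Real.cos q.2, r * Real.sin q.2,
          r * Real.sinh q.1])).aemeasurable
  rw [setLIntegral_congr_fun measurableSet_Ioi step, lintegral_lintegral_swap]
  swap
  · refine Measurable.aemeasurable ?_
    exact Measurable.lintegral_prod_right' (f := fun q : (ℝ × ℝ) × ℝ =>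
      ENNReal.ofReal (q.1.1 * Real.cosh q.1.2) * (ENNReal.ofReal q.1.1 *
      H !₂[q.1.1 * Real.cos q.2, q.1.1 * Real.sin q.2, q.1.1 * Real.sinh q.1.2]))
      (by fun_prop)
  have hind : Measurable fun p : ℝ × ℝ => ENNReal.ofReal ((Real.cosh p.1 ^ 2)⁻¹) *
      s.indicator (fun _ => (1 : ℝ≥0∞)) (cyl p) :=
    Measurable.mul (by fun_prop) ((measurable_const.indicator hs).comp continuous_cyl.measurable)
  rw [cylVol, lintegral_prod _ hind.aemeasurable, ← lintegral_const_mul' _ _ (by simp)]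
  refine lintegral_congr fun t => ?_
  rw [lintegral_lintegral_swap]
  · simp only [hr t]
    rw [lintegral_const_mul' _ _ (by simp), ← mul_assoc, ENNReal.mul_inv_cancel (by simp) (by simp),
      one_mul]
  · exact (by fun_prop : Measurable fun q : ℝ × ℝ => ENNReal.ofReal (q.1 * Real.cosh t) *
        (ENNReal.ofReal q.1 * H !₂[q.1 * Real.cos q.2, q.1 * Real.sin q.2,
          q.1 * Real.sinh t])).aemeasurable

/-- The round measure in conformal cylindrical coordinates. -/
theorem sphVol_two_eq : sphVol 2 =
    (cylVol.withDensity fun p => ENNReal.ofReal ((Real.cosh p.1 ^ 2)⁻¹)).map cyl := by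
  ext s hs
  have hm : Measurable fun p : ℝ × ℝ => ENNReal.ofReal ((Real.cosh p.1 ^ 2)⁻¹) := by fun_prop
  rw [sphVol_two_apply hs, Measure.map_apply continuous_cyl.measurable hs,
    withDensity_apply _ (continuous_cyl.measurable hs),
    ← lintegral_indicator (continuous_cyl.measurable hs)]
  refine lintegral_congr fun p => ?_
  by_cases hp : cyl p ∈ s
  · rw [indicator_of_mem hp, indicator_of_mem (by exact hp), mul_one]
  · rw [indicator_of_notMem hp, indicator_of_notMem (by exact hp), mul_zero]

theorem lintegral_sphVol_two {F : Sph 2 → ℝ≥0∞} (hF : Measurable F) :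
    ∫⁻ x, F x ∂(sphVol 2) =
      ∫⁻ p, ENNReal.ofReal ((Real.cosh p.1 ^ 2)⁻¹) * F (cyl p) ∂cylVol := by
  rw [sphVol_two_eq, lintegral_map hF continuous_cyl.measurable,
    lintegral_withDensity_eq_lintegral_mul _ (by fun_prop)
      (by exact hF.comp continuous_cyl.measurable)]
  rfl

theorem integral_sphVol_two {F : Sph 2 → ℝ} (hF : Measurable F) :
    ∫ x, F x ∂(sphVol 2) = ∫ p, (Real.cosh p.1 ^ 2)⁻¹ * F (cyl p) ∂cylVol := by
  have hm : Measurable fun p : ℝ × ℝ => ENNReal.ofReal ((Real.cosh p.1 ^ 2)⁻¹) := by fun_prop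
  rw [sphVol_two_eq, integral_map continuous_cyl.measurable.aemeasurable
    hF.aestronglyMeasurable, integral_withDensity_eq_integral_toReal_smul hm
    (Filter.Eventually.of_forall fun p => ENNReal.ofReal_lt_top)]
  refine integral_congr_ae (Filter.Eventually.of_forall fun p => ?_)
  simp only [smul_eq_mul]
  rw [ENNReal.toReal_ofReal (by positivity)]

theorem integrable_sphVol_two {F : Sph 2 → ℝ} (hF : Measurable F) :
    Integrable F (sphVol 2) ↔
      Integrable (fun p => (Real.cosh p.1 ^ 2)⁻¹ * F (cyl p)) cylVol := by
  have hm : Measurable fun p : ℝ × ℝ => ENNReal.ofReal ((Real.cosh p.1 ^ 2)⁻¹) := by fun_prop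
  rw [sphVol_two_eq, integrable_map_measure hF.aestronglyMeasurable
    continuous_cyl.measurable.aemeasurable, integrable_withDensity_iff_integrable_smul₀'
    hm.aemeasurable (Filter.Eventually.of_forall fun p => ENNReal.ofReal_lt_top)]
  refine integrable_congr (Filter.Eventually.of_forall fun p => ?_)
  simp only [smul_eq_mul, Function.comp]
  rw [ENNReal.toReal_ofReal (by positivity)]

theorem sphVol_two_univ : sphVol 2 univ = ENNReal.ofReal (4 * Real.pi) := by
  rw [sphVol, Measure.toSphere_apply_univ, EuclideanSpace.volume_ball_fin_three]
  simp only [finrank_euclideanSpace, Fintype.card_fin]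
  rw [ENNReal.ofReal_one, one_pow, one_mul, ← ENNReal.ofReal_natCast,
    ← ENNReal.ofReal_mul (by positivity)]
  congr 1
  push_cast
  ring

/-- In conformal cylindrical coordinates the chordal distance is a function of the difference of
the coordinates, up to conformal factors. -/
theorem one_sub_inner_cyl (p q : ℝ × ℝ) : 1 - inner ℝ (cyl p : Amb 2) (cyl q : Amb 2) =
    (Real.cosh (p.1 - q.1) - Real.cos (p.2 - q.2)) / (Real.cosh p.1 * Real.cosh q.1) := by
  have h1 := (Real.cosh_pos p.1).ne'
  have h2 := (Real.cosh_pos q.1).ne'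
  rw [coe_cyl, coe_cyl, PiLp.inner_apply, Fin.sum_univ_three, Real.cosh_sub, Real.cos_sub]
  simp
  field_simp
  ring

end Cylinder


/-! ### Integrability of the logarithmic kernel -/

section Kernel

/-- Half of the squared chordal distance, `1 - ⟨x, y⟩`. -/
def chord (x y : Sph 2) : ℝ := 1 - inner ℝ (x : Amb 2) (y : Amb 2)

theorem chord_eq_dist_sq (x y : Sph 2) : chord x y = dist x y ^ 2 / 2 := by
  rw [Subtype.dist_eq, dist_eq_norm, norm_sub_sq_real, chord]
  simp
  ring

theorem chord_nonneg (x y : Sph 2) : 0 ≤ chord x y := by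
  rw [chord_eq_dist_sq]; positivity

theorem chord_le_two (x y : Sph 2) : chord x y ≤ 2 := by
  have := abs_real_inner_le_norm (x : Amb 2) (y : Amb 2)
  simp only [norm_eq_of_mem_sphere, mul_one] at this
  have := (abs_le.mp this).1
  unfold chord
  linarith

theorem chord_eq_zero_iff {x y : Sph 2} : chord x y = 0 ↔ x = y := by
  rw [chord_eq_dist_sq]
  simp

theorem chord_pos {x y : Sph 2} (h : x ≠ y) : 0 < chord x y :=
  lt_of_le_of_ne (chord_nonneg x y) fun h0 => h (chord_eq_zero_iff.mp h0.symm)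

theorem chord_comm (x y : Sph 2) : chord x y = chord y x := by
  unfold chord
  rw [real_inner_comm]

theorem chord_sphMap (A : Amb 2 ≃ₗᵢ[ℝ] Amb 2) (x y : Sph 2) :
    chord (sphMap A x) (sphMap A y) = chord x y := by
  unfold chord
  rw [inner_sphMap]

theorem continuous_chord : Continuous fun p : Sph 2 × Sph 2 => chord p.1 p.2 := by
  unfold chord
  fun_prop

theorem measurable_chord : Measurable fun p : Sph 2 × Sph 2 => chord p.1 p.2 :=
  continuous_chord.measurable

theorem measurable_chord_right (x : Sph 2) : Measurable (chord x) :=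
  measurable_chord.comp measurable_prodMk_left

/-- The singular kernel `(1 - ⟨x, y⟩)^(-1/4)`, infinite on the diagonal. -/
def kap (x y : Sph 2) : ℝ≥0∞ := ENNReal.ofReal (chord x y) ^ (-(1 / 4) : ℝ)

theorem measurable_kap : Measurable fun p : Sph 2 × Sph 2 => kap p.1 p.2 :=
  measurable_chord.ennreal_ofReal.pow_const _

theorem measurable_kap_right (x : Sph 2) : Measurable (kap x) :=
  (measurable_chord_right x).ennreal_ofReal.pow_const _

theorem kap_comm (x y : Sph 2) : kap x y = kap y x := by
  unfold kap
  rw [chord_comm]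

theorem kap_self (x : Sph 2) : kap x x = ⊤ := by
  unfold kap
  rw [chord_eq_zero_iff.mpr rfl, ENNReal.ofReal_zero, ENNReal.zero_rpow_of_neg (by norm_num)]

theorem kap_eq {x y : Sph 2} (h : x ≠ y) : kap x y = ENNReal.ofReal (chord x y ^ (-(1 / 4) : ℝ)) :=
  ENNReal.ofReal_rpow_of_pos (chord_pos h)

/-- The point of the sphere on the last coordinate axis. -/
def north : Sph 2 := ⟨EuclideanSpace.single 2 1, by simp⟩

theorem chord_north_cyl (p : ℝ × ℝ) : chord north (cyl p) =
    Real.exp (-p.1) / Real.cosh p.1 := by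
  have hc := (Real.cosh_pos p.1).ne'
  unfold chord north
  rw [coe_cyl, EuclideanSpace.inner_single_left]
  simp
  rw [← Real.cosh_sub_sinh]
  field_simp

/-- The density `1 / cosh² t` is at most `4 e^{-2|t|}`, while the kernel is `(e^t cosh t)^{1/4}`, at
most `e^{|t|/2}`. There is room to spare for integrability on the cylinder. -/
theorem kap_north_cyl_le (p : ℝ × ℝ) :
    ENNReal.ofReal ((Real.cosh p.1 ^ 2)⁻¹) * kap north (cyl p) ≤
      ENNReal.ofReal (4 * Real.exp (-(1 * |p.1|))) := by
  have hc := Real.cosh_pos p.1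
  have h1 : Real.exp (-p.1) / Real.cosh p.1 > 0 := by positivity
  unfold kap
  rw [chord_north_cyl, ENNReal.ofReal_rpow_of_pos h1, ← ENNReal.ofReal_mul (by positivity)]
  apply ENNReal.ofReal_le_ofReal
  have h2 : Real.cosh p.1 ≤ Real.exp |p.1| := by
    rw [← Real.cosh_abs, Real.cosh_eq]
    have := Real.exp_le_exp.mpr (by linarith [abs_nonneg p.1] : -|p.1| ≤ |p.1|)
    linarith
  have h3 : Real.exp |p.1| ≤ 2 * Real.cosh p.1 := by
    rw [← Real.cosh_abs, Real.cosh_eq]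
    have := Real.exp_pos (-|p.1|)
    linarith
  have h4 : (Real.exp (-p.1) / Real.cosh p.1) ^ (-(1 / 4) : ℝ) ≤ Real.exp |p.1| := by
    rw [Real.rpow_neg h1.le, ← Real.inv_rpow h1.le, inv_div, Real.exp_neg, div_inv_eq_mul]
    have h5 : Real.cosh p.1 * Real.exp p.1 ≤ Real.exp |p.1| ^ 2 := by
      rw [sq]
      exact mul_le_mul h2 (Real.exp_le_exp.mpr (le_abs_self _)) (Real.exp_pos _).le
        (Real.exp_pos _).le
    calc (Real.cosh p.1 * Real.exp p.1) ^ (1 / 4 : ℝ)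
        ≤ (Real.exp |p.1| ^ 2) ^ (1 / 4 : ℝ) := Real.rpow_le_rpow (by positivity) h5 (by norm_num)
      _ = Real.exp (|p.1| / 2) := by
        rw [← Real.exp_nat_mul, ← Real.exp_mul]
        congr 1
        push_cast
        ring
      _ ≤ _ := Real.exp_le_exp.mpr (by linarith [abs_nonneg p.1])
  calc (Real.cosh p.1 ^ 2)⁻¹ * (Real.exp (-p.1) / Real.cosh p.1) ^ (-(1 / 4) : ℝ)
      ≤ ((Real.exp |p.1| / 2) ^ 2)⁻¹ * Real.exp |p.1| := by
        gcongr
        linarith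
    _ = 4 * Real.exp (-(1 * |p.1|)) := by
        rw [one_mul, Real.exp_neg]
        field_simp
        norm_num

theorem integrable_exp_neg_mul_abs {a : ℝ} (ha : 0 < a) :
    Integrable fun t : ℝ => Real.exp (-(a * |t|)) := by
  rw [← integrableOn_univ, ← Iic_union_Ioi (a := (0 : ℝ)), integrableOn_union]
  constructor
  · have h := integrableOn_exp_mul_Iic ha 0
    refine h.congr_fun (fun t ht => ?_) measurableSet_Iic
    have ht : t ≤ 0 := ht
    simp only [abs_of_nonpos ht]
    congr 1
    ring
  · have h := integrableOn_exp_mul_Ioi (neg_neg_of_pos ha) 0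
    refine h.congr_fun (fun t ht => ?_) measurableSet_Ioi
    have ht : 0 < t := ht
    simp only [abs_of_pos ht]
    congr 1
    ring

theorem lintegral_kap_eq (x : Sph 2) :
    ∫⁻ y, kap x y ∂(sphVol 2) = ∫⁻ y, kap north y ∂(sphVol 2) := by
  obtain ⟨A, hA⟩ := exists_sphMap_eq north x
  rw [← (measurePreserving_sphMap A).lintegral_comp (measurable_kap_right x)]
  refine lintegral_congr fun y => ?_
  simp only [kap, ← hA, chord_sphMap]

/-- The integral of the singular kernel over the sphere. -/
def kapMass : ℝ≥0∞ := ∫⁻ y, kap north y ∂(sphVol 2)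

theorem kapMass_ne_top : kapMass ≠ ⊤ := by
  unfold kapMass
  rw [lintegral_sphVol_two (measurable_kap_right north)]
  refine ne_top_of_le_ne_top ?_ (lintegral_mono kap_north_cyl_le)
  rw [cylVol, lintegral_prod _ (by fun_prop)]
  simp only [lintegral_const, Measure.restrict_apply_univ, Real.volume_Ioo]
  rw [lintegral_mul_const _ (by fun_prop)]
  refine ENNReal.mul_ne_top ?_ ENNReal.ofReal_ne_top
  exact ((integrable_exp_neg_mul_abs zero_lt_one).const_mul 4).lintegral_lt_top.ne

/-- An atom would make the kernel centred at it nonintegrable. -/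
theorem sphVol_two_singleton (x : Sph 2) : sphVol 2 {x} = 0 := by
  by_contra h
  have h1 : ∫⁻ y in {x}, kap x y ∂(sphVol 2) ≤ kapMass := by
    rw [kapMass, ← lintegral_kap_eq x]
    exact setLIntegral_le_lintegral _ _
  rw [lintegral_singleton, kap_self, ENNReal.top_mul h] at h1
  exact kapMass_ne_top (top_le_iff.mp h1)

instance : NullSingletonClass (sphVol 2) := ⟨sphVol_two_singleton⟩

/-- For `d ≤ 1` this is `log y ≤ y - 1` at `y = d^{-1/n}`; for `1 ≤ d ≤ 2` the left side is at most
`1` and the right side at least `n / 2`. The cases `n = 4` and `n = 8` bound both the logarithm and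
its square by the one kernel `d^{-1/4}`. -/
theorem abs_log_le {d : ℝ} (h0 : 0 ≤ d) (h2 : d ≤ 2) {n : ℕ} (hn : 2 ≤ n) :
    |Real.log d| ≤ n * d ^ (-(1 / n) : ℝ) := by
  have hn0 : (0 : ℝ) < n := by positivity
  have hn2 : (2 : ℝ) ≤ n := by exact_mod_cast hn
  rcases h0.eq_or_lt with rfl | hpos
  · rw [Real.log_zero, abs_zero]
    positivity
  · rcases le_total d 1 with h1 | h1
    · rw [abs_of_nonpos (Real.log_nonpos h0 h1)]
      have h := Real.log_le_sub_one_of_pos (Real.rpow_pos_of_pos hpos (-(1 / n) : ℝ))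
      rw [Real.log_rpow hpos] at h
      have : -Real.log d = n * (-(1 / n) * Real.log d) := by field_simp
      rw [this]
      gcongr
      linarith
    · rw [abs_of_nonneg (Real.log_nonneg h1)]
      have h3 : Real.log d ≤ 1 := (Real.log_le_sub_one_of_pos hpos).trans (by linarith)
      have h4 : (2 : ℝ)⁻¹ ≤ d ^ (-(1 / n) : ℝ) := by
        calc (2 : ℝ)⁻¹ ≤ d⁻¹ := by gcongr
          _ = d ^ (-1 : ℝ) := (Real.rpow_neg_one d).symm
          _ ≤ _ := Real.rpow_le_rpow_of_exponent_le h1 (by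
            rw [neg_le_neg_iff, div_le_one hn0]; linarith)
      nlinarith

theorem abs_log_chord_le (x y : Sph 2) :
    |Real.log (chord x y)| ≤ 4 * chord x y ^ (-(1 / 4) : ℝ) := by
  have := abs_log_le (chord_nonneg x y) (chord_le_two x y) (n := 4) (by norm_num)
  exact_mod_cast this

theorem sq_log_chord_le (x y : Sph 2) :
    Real.log (chord x y) ^ 2 ≤ 64 * chord x y ^ (-(1 / 4) : ℝ) := by
  have h := abs_log_le (chord_nonneg x y) (chord_le_two x y) (n := 8) (by norm_num)
  have h1 : (chord x y ^ (-(1 / (8 : ℕ)) : ℝ)) ^ 2 = chord x y ^ (-(1 / 4) : ℝ) := by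
    rw [← Real.rpow_natCast, ← Real.rpow_mul (chord_nonneg x y)]
    norm_num
  rw [← sq_abs, ← h1]
  calc |Real.log (chord x y)| ^ 2 ≤ ((8 : ℕ) * chord x y ^ (-(1 / (8 : ℕ)) : ℝ)) ^ 2 := by
        gcongr
    _ = _ := by push_cast; ring

theorem ofReal_rpow_le_kap (x y : Sph 2) :
    ENNReal.ofReal (chord x y ^ (-(1 / 4) : ℝ)) ≤ kap x y := by
  by_cases h : x = y
  · rw [h, kap_self]
    exact le_top
  · rw [kap_eq h]

theorem measurable_rpow_chord : Measurable fun p : Sph 2 × Sph 2 =>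
    chord p.1 p.2 ^ (-(1 / 4) : ℝ) := measurable_chord.pow_const _

theorem measurable_log_chord : Measurable fun p : Sph 2 × Sph 2 =>
    Real.log (chord p.1 p.2) := measurable_chord.log

/-- The kernel is integrable at each point where its `ℝ≥0∞`-valued integral is finite. -/
theorem integrable_rpow_chord {m : Measure (Sph 2)} {x : Sph 2} (h : ∫⁻ y, kap x y ∂m ≠ ⊤) :
    Integrable (fun y => chord x y ^ (-(1 / 4) : ℝ)) m := by
  refine ⟨((measurable_chord_right x).pow_const _).aestronglyMeasurable, ?_⟩
  rw [hasFiniteIntegral_iff_ofReal (Filter.Eventually.of_forall fun y =>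
    Real.rpow_nonneg (chord_nonneg x y) _)]
  exact (lintegral_mono fun y => ofReal_rpow_le_kap x y).trans_lt (lt_top_iff_ne_top.mpr h)

theorem integrable_log_chord {m : Measure (Sph 2)} {x : Sph 2} (h : ∫⁻ y, kap x y ∂m ≠ ⊤) :
    Integrable (fun y => Real.log (chord x y)) m :=
  ((integrable_rpow_chord h).const_mul 4).mono'
    (measurable_chord_right x).log.aestronglyMeasurable
    (Filter.Eventually.of_forall fun y => abs_log_chord_le x y)

theorem lintegral_kap_sphVol_ne_top (x : Sph 2) : ∫⁻ y, kap x y ∂(sphVol 2) ≠ ⊤ := by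
  rw [lintegral_kap_eq]
  exact kapMass_ne_top

/-- By Fubini, the kernel having the same finite integral around every point. At all such points the
potential is an honest finite integral. -/
theorem lintegral_kap_ae_ne_top (m : Measure (Sph 2)) [IsFiniteMeasure m] :
    ∀ᵐ x ∂(sphVol 2), ∫⁻ y, kap x y ∂m ≠ ⊤ := by
  have h : ∫⁻ x, ∫⁻ y, kap x y ∂m ∂(sphVol 2) ≠ ⊤ := by
    rw [lintegral_lintegral_swap (f := kap) measurable_kap.aemeasurable]
    have : ∀ y, ∫⁻ x, kap x y ∂(sphVol 2) = kapMass := fun y => by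
      simp only [kap_comm _ y]
      exact lintegral_kap_eq y
    simp only [this, lintegral_const]
    exact ENNReal.mul_ne_top kapMass_ne_top (measure_ne_top _ _)
  have hm : Measurable fun x => ∫⁻ y, kap x y ∂m :=
    Measurable.lintegral_prod_right' (f := fun p : Sph 2 × Sph 2 => kap p.1 p.2) measurable_kap
  filter_upwards [ae_lt_top hm h] with x hx
  exact hx.ne

theorem integrable_prod_rpow_chord (m m' : Measure (Sph 2)) [SFinite m] [IsFiniteMeasure m']
    {C : ℝ≥0∞} (hC : C ≠ ⊤) (h : ∀ x, ∫⁻ y, kap x y ∂m ≤ C) :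
    Integrable (fun p : Sph 2 × Sph 2 => chord p.1 p.2 ^ (-(1 / 4) : ℝ)) (m'.prod m) := by
  have hnn : ∀ p : Sph 2 × Sph 2, 0 ≤ chord p.1 p.2 ^ (-(1 / 4) : ℝ) := fun p =>
    Real.rpow_nonneg (chord_nonneg p.1 p.2) _
  refine ⟨measurable_rpow_chord.aestronglyMeasurable, ?_⟩
  rw [hasFiniteIntegral_iff_ofReal (Filter.Eventually.of_forall hnn)]
  have hle : ∫⁻ p : Sph 2 × Sph 2, ENNReal.ofReal (chord p.1 p.2 ^ (-(1 / 4) : ℝ)) ∂(m'.prod m) ≤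
      ∫⁻ p, kap p.1 p.2 ∂(m'.prod m) := lintegral_mono fun p => ofReal_rpow_le_kap p.1 p.2
  refine hle.trans_lt ?_
  rw [lintegral_prod (fun p : Sph 2 × Sph 2 => kap p.1 p.2) measurable_kap.aemeasurable]
  refine (lintegral_mono h).trans_lt ?_
  rw [lintegral_const]
  exact ENNReal.mul_lt_top (lt_top_iff_ne_top.mpr hC) (measure_lt_top _ _)

theorem integrable_prod_log_chord (m' : Measure (Sph 2)) [IsFiniteMeasure m'] :
    Integrable (fun p : Sph 2 × Sph 2 => Real.log (chord p.1 p.2)) (m'.prod (sphVol 2)) :=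
  ((integrable_prod_rpow_chord (sphVol 2) m' kapMass_ne_top
    fun x => (lintegral_kap_eq x).le).const_mul 4).mono'
    measurable_log_chord.aestronglyMeasurable
    (Filter.Eventually.of_forall fun p => abs_log_chord_le p.1 p.2)

end Kernel


/-! ### A measure is determined by its logarithmic potential -/

section Moments

/-- Monomials restricted to the sphere. -/
def mono {k : ℕ} (p : Fin k → Fin 3) (x : Sph 2) : ℝ := ∏ i, (x : Amb 2) (p i)

theorem continuous_mono {k : ℕ} (p : Fin k → Fin 3) : Continuous (mono p) := by
  unfold mono
  fun_prop

theorem inner_pow_eq_sum_mono (k : ℕ) (x y : Sph 2) :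
    (inner ℝ (x : Amb 2) (y : Amb 2)) ^ k = ∑ p : Fin k → Fin 3, mono p x * mono p y := by
  rw [PiLp.inner_apply, Fintype.sum_pow]
  refine Finset.sum_congr rfl fun p _ => ?_
  rw [mono, mono, ← Finset.prod_mul_distrib]
  refine Finset.prod_congr rfl fun i _ => ?_
  simp [mul_comm]

theorem abs_inner_le_one (x y : Sph 2) : |inner ℝ (x : Amb 2) (y : Amb 2)| ≤ 1 := by
  simpa using abs_real_inner_le_norm (x : Amb 2) (y : Amb 2)

theorem integrable_of_continuous {m : Measure (Sph 2)} [IsFiniteMeasure m] {g : Sph 2 → ℝ}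
    (hg : Continuous g) : Integrable g m := by
  rw [← integrableOn_univ]
  exact hg.continuousOn.integrableOn_compact isCompact_univ

theorem exists_bound_of_continuous {g : Sph 2 → ℝ} (hg : Continuous g) :
    ∃ B : ℝ, 0 ≤ B ∧ ∀ x, |g x| ≤ B := by
  obtain ⟨B, hB⟩ := isCompact_univ.exists_bound_of_continuousOn hg.continuousOn
  exact ⟨B, (norm_nonneg _).trans (hB north (mem_univ _)), fun x => hB x (mem_univ _)⟩

theorem integral_sphMap (A : Amb 2 ≃ₗᵢ[ℝ] Amb 2) {g : Sph 2 → ℝ} (hg : Measurable g) :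
    ∫ x, g (sphMap A x) ∂(sphVol 2) = ∫ x, g x ∂(sphVol 2) := by
  have h := integral_map (μ := sphVol 2) (continuous_sphMap A).measurable.aemeasurable
    (f := g) hg.aestronglyMeasurable
  rw [(measurePreserving_sphMap A).map_eq] at h
  exact h.symm

theorem integral_inner_pow_eq (k : ℕ) (x : Sph 2) :
    ∫ y, (inner ℝ (y : Amb 2) (x : Amb 2)) ^ k ∂(sphVol 2) =
      ∫ y, (inner ℝ (y : Amb 2) (north : Amb 2)) ^ k ∂(sphVol 2) := by
  obtain ⟨A, hA⟩ := exists_sphMap_eq north x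
  rw [← integral_sphMap A (by fun_prop)]
  simp only [← hA, inner_sphMap]

/-- The convolution of the logarithmic kernel with a zonal power. -/
theorem integral_log_mul_inner_pow_comm (k : ℕ) (x z : Sph 2) :
    ∫ y, Real.log (chord x y) * (inner ℝ (y : Amb 2) (z : Amb 2)) ^ k ∂(sphVol 2) =
      ∫ y, Real.log (chord z y) * (inner ℝ (y : Amb 2) (x : Amb 2)) ^ k ∂(sphVol 2) := by
  obtain ⟨A, hA, hA'⟩ := exists_sphMap_swap x z
  rw [← integral_sphMap A (by exact (measurable_chord_right x).log.mul (by fun_prop))]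
  refine integral_congr_ae (Filter.Eventually.of_forall fun y => ?_)
  have h1 : chord x (sphMap A y) = chord z y := by rw [← chord_sphMap A z y, hA']
  have h2 : inner ℝ (sphMap A y : Amb 2) (z : Amb 2) = inner ℝ (y : Amb 2) (x : Amb 2) := by
    rw [← inner_sphMap A y x, hA]
  simp only [h1, h2]

variable {P N : Measure (Sph 2)} [IsFiniteMeasure P] [IsFiniteMeasure N]

/-- The difference of the `k`-th zonal moments of two measures. -/
def momentDiff (P N : Measure (Sph 2)) (k : ℕ) (x : Sph 2) : ℝ :=
  ∫ z, (inner ℝ (x : Amb 2) (z : Amb 2)) ^ k ∂P - ∫ z, (inner ℝ (x : Amb 2) (z : Amb 2)) ^ k ∂N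

/-- The zonal kernel `⟨x, z⟩^k` separates into products of monomials, so its moments are homogeneous
polynomials of degree `k` in `x`. In particular they are continuous, however singular the measures.
-/
theorem momentDiff_eq (k : ℕ) (x : Sph 2) : momentDiff P N k x =
    ∑ p : Fin k → Fin 3, (∫ z, mono p z ∂P - ∫ z, mono p z ∂N) * mono p x := by
  unfold momentDiff
  simp only [inner_pow_eq_sum_mono]
  rw [integral_finsetSum _ fun p _ => (integrable_of_continuous (continuous_mono p)).const_mul _,
    integral_finsetSum _ fun p _ => (integrable_of_continuous (continuous_mono p)).const_mul _,
    ← Finset.sum_sub_distrib]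
  refine Finset.sum_congr rfl fun p _ => ?_
  rw [integral_const_mul, integral_const_mul]
  ring

theorem continuous_momentDiff (k : ℕ) : Continuous (momentDiff P N k) := by
  rw [show momentDiff P N k = _ from funext fun x => momentDiff_eq k x]
  exact continuous_finsetSum _ fun p _ => continuous_const.mul (continuous_mono p)

/-- Fubini for the logarithmic kernel against a continuous function. -/
theorem integral_integral_log_swap (Q : Measure (Sph 2)) [IsFiniteMeasure Q]
    {g : Sph 2 × Sph 2 → ℝ} (hg : Continuous g) :
    ∫ z, ∫ y, Real.log (chord z y) * g (z, y) ∂(sphVol 2) ∂Q =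
      ∫ y, ∫ z, Real.log (chord z y) * g (z, y) ∂Q ∂(sphVol 2) := by
  obtain ⟨B, hB⟩ := isCompact_univ.exists_bound_of_continuousOn hg.continuousOn
  refine integral_integral_swap (f := fun z y => Real.log (chord z y) * g (z, y)) ?_
  exact (integrable_prod_log_chord Q).mul_bdd (c := B) hg.aestronglyMeasurable
    (Filter.Eventually.of_forall fun p => hB p (mem_univ p))

/-- Convolution with the logarithm commutes with convolution with a zonal power: the isometry
exchanging `x` and `z` interchanges their roles. So the potential of the moment function is a zonal
moment of the potential of `P - N`. The latter is constant, and the value does not depend on `x`. -/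
theorem integral_log_mul_momentDiff (k : ℕ) {c : ℝ}
    (hc : ∀ᵐ x ∂(sphVol 2), ∫ y, Real.log (chord x y) ∂P - ∫ y, Real.log (chord x y) ∂N = c)
    (x : Sph 2) :
    ∫ y, Real.log (chord x y) * momentDiff P N k y ∂(sphVol 2) =
      c * ∫ y, (inner ℝ (y : Amb 2) (north : Amb 2)) ^ k ∂(sphVol 2) := by
  have hlogx : Integrable (fun y => Real.log (chord x y)) (sphVol 2) :=
    integrable_log_chord (lintegral_kap_sphVol_ne_top x)
  have hb : ∀ Q : Measure (Sph 2), ∀ [IsFiniteMeasure Q],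
      ∫ y, Real.log (chord x y) * (∫ z, (inner ℝ (y : Amb 2) (z : Amb 2)) ^ k ∂Q) ∂(sphVol 2) =
      ∫ y, (∫ z, Real.log (chord y z) ∂Q) * (inner ℝ (y : Amb 2) (x : Amb 2)) ^ k ∂(sphVol 2) := by
    intro Q _
    calc _ = ∫ y, ∫ z, Real.log (chord x y) * (inner ℝ (y : Amb 2) (z : Amb 2)) ^ k ∂Q
          ∂(sphVol 2) := by simp only [integral_const_mul]
      _ = ∫ z, ∫ y, Real.log (chord x y) * (inner ℝ (y : Amb 2) (z : Amb 2)) ^ k ∂(sphVol 2)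
          ∂Q := by
        refine integral_integral_swap (μ := sphVol 2) (ν := Q)
          (f := fun y z => Real.log (chord x y) * (inner ℝ (y : Amb 2) (z : Amb 2)) ^ k) ?_
        have h1 : Integrable (fun p : Sph 2 × Sph 2 => Real.log (chord x p.1))
          ((sphVol 2).prod Q) := hlogx.comp_fst Q
        refine h1.mul_bdd (c := 1) (by fun_prop) (Filter.Eventually.of_forall fun p => ?_)
        rw [norm_pow]
        exact pow_le_one₀ (norm_nonneg _) (abs_inner_le_one _ _)
      _ = ∫ z, ∫ y, Real.log (chord z y) * (inner ℝ (y : Amb 2) (x : Amb 2)) ^ k ∂(sphVol 2)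
          ∂Q := by simp only [integral_log_mul_inner_pow_comm k x]
      _ = ∫ y, ∫ z, Real.log (chord z y) * (inner ℝ (y : Amb 2) (x : Amb 2)) ^ k ∂Q
          ∂(sphVol 2) := integral_integral_log_swap Q (g := fun p =>
            (inner ℝ (p.2 : Amb 2) (x : Amb 2)) ^ k) (by fun_prop)
      _ = _ := by
        refine integral_congr_ae (Filter.Eventually.of_forall fun y => ?_)
        simp only [integral_mul_const, chord_comm y]
  have hcont : ∀ Q : Measure (Sph 2), ∀ [IsFiniteMeasure Q],
      Continuous fun y : Sph 2 => ∫ z, (inner ℝ (y : Amb 2) (z : Amb 2)) ^ k ∂Q := by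
    intro Q _
    have := continuous_momentDiff (P := Q) (N := 0) k
    unfold momentDiff at this
    simpa using this
  have hint : ∀ Q : Measure (Sph 2), ∀ [IsFiniteMeasure Q], Integrable (fun y =>
      Real.log (chord x y) * (∫ z, (inner ℝ (y : Amb 2) (z : Amb 2)) ^ k ∂Q)) (sphVol 2) := by
    intro Q _
    obtain ⟨B, -, hB⟩ := exists_bound_of_continuous (hcont Q)
    exact hlogx.mul_bdd (c := B) (hcont Q).aestronglyMeasurable (Filter.Eventually.of_forall hB)
  have hint2 : ∀ Q : Measure (Sph 2), ∀ [IsFiniteMeasure Q], Integrable (fun y =>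
      (∫ z, Real.log (chord y z) ∂Q) * (inner ℝ (y : Amb 2) (x : Amb 2)) ^ k) (sphVol 2) := by
    intro Q _
    refine Integrable.mul_bdd (c := 1) ?_ (by fun_prop) (Filter.Eventually.of_forall fun y => ?_)
    · have h := (integrable_prod_log_chord Q).integral_prod_right
      simpa only [chord_comm _ (_ : Sph 2)] using h
    · rw [norm_pow]
      exact pow_le_one₀ (norm_nonneg _) (abs_inner_le_one _ _)
  calc _ = ∫ y, (Real.log (chord x y) * (∫ z, (inner ℝ (y : Amb 2) (z : Amb 2)) ^ k ∂P) -
          Real.log (chord x y) * (∫ z, (inner ℝ (y : Amb 2) (z : Amb 2)) ^ k ∂N)) ∂(sphVol 2) := by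
        refine integral_congr_ae (Filter.Eventually.of_forall fun y => ?_)
        simp only [momentDiff]
        ring
    _ = ∫ y, ((∫ z, Real.log (chord y z) ∂P) * (inner ℝ (y : Amb 2) (x : Amb 2)) ^ k -
          (∫ z, Real.log (chord y z) ∂N) * (inner ℝ (y : Amb 2) (x : Amb 2)) ^ k) ∂(sphVol 2) := by
        rw [integral_sub (hint P) (hint N), hb P, hb N, integral_sub (hint2 P) (hint2 N)]
    _ = ∫ y, c * (inner ℝ (y : Amb 2) (x : Amb 2)) ^ k ∂(sphVol 2) := by
        refine integral_congr_ae ?_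
        filter_upwards [hc] with y hy
        rw [← sub_mul, hy]
    _ = _ := by rw [integral_const_mul, integral_inner_pow_eq k x]

/-- The integral of `⟨x, z⟩^k` over `x` does not depend on `z`, so only the difference of the total
masses enters. -/
theorem integral_momentDiff (k : ℕ) (hPN : P univ = N univ) :
    ∫ x, momentDiff P N k x ∂(sphVol 2) = 0 := by
  have h : ∀ Q : Measure (Sph 2), ∀ [IsFiniteMeasure Q],
      ∫ x, ∫ z, (inner ℝ (x : Amb 2) (z : Amb 2)) ^ k ∂Q ∂(sphVol 2) =
        Q.real univ * ∫ y, (inner ℝ (y : Amb 2) (north : Amb 2)) ^ k ∂(sphVol 2) := by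
    intro Q _
    rw [integral_integral_swap]
    · simp only [integral_inner_pow_eq k, integral_const, smul_eq_mul]
    · refine Integrable.of_bound (C := 1) (by fun_prop) (Filter.Eventually.of_forall fun p => ?_)
      simp only [Function.uncurry, norm_pow]
      exact pow_le_one₀ (norm_nonneg _) (abs_inner_le_one _ _)
  have hi : ∀ Q : Measure (Sph 2), ∀ [IsFiniteMeasure Q], Integrable
      (fun y : Sph 2 => ∫ z, (inner ℝ (y : Amb 2) (z : Amb 2)) ^ k ∂Q) (sphVol 2) := by
    intro Q _
    have := continuous_momentDiff (P := Q) (N := 0) k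
    unfold momentDiff at this
    exact integrable_of_continuous (by simpa using this)
  unfold momentDiff
  rw [integral_sub (hi P) (hi N), h P, h N]
  simp [measureReal_def, hPN]

/-- Positive definiteness of the kernel `⟨x, y⟩^k`: its energy is a sum of squares of moments. -/
theorem integral_inner_pow_mul_mul (k : ℕ) {v : Sph 2 → ℝ} (hv : Continuous v) :
    ∫ q : Sph 2 × Sph 2, (inner ℝ (q.1 : Amb 2) (q.2 : Amb 2)) ^ k * (v q.1 * v q.2)
      ∂((sphVol 2).prod (sphVol 2)) =
      ∑ p : Fin k → Fin 3, (∫ x, mono p x * v x ∂(sphVol 2)) ^ 2 := by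
  have hi : ∀ p : Fin k → Fin 3, Integrable (fun x => mono p x * v x) (sphVol 2) := fun p =>
    integrable_of_continuous ((continuous_mono p).mul hv)
  have : ∀ q : Sph 2 × Sph 2, (inner ℝ (q.1 : Amb 2) (q.2 : Amb 2)) ^ k * (v q.1 * v q.2) =
      ∑ p : Fin k → Fin 3, (mono p q.1 * v q.1) * (mono p q.2 * v q.2) := by
    intro q
    rw [inner_pow_eq_sum_mono, Finset.sum_mul]
    exact Finset.sum_congr rfl fun p _ => by ring
  simp only [this]
  rw [integral_finsetSum _ fun p _ => (hi p).mul_prod (hi p)]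
  refine Finset.sum_congr rfl fun p _ => ?_
  rw [integral_prod_mul (fun x => mono p x * v x) (fun x => mono p x * v x), sq]

/-- The series of absolute values of `∑ s^j / j` sums to the left side; the right side is an
integrable majorant for the exchange of sum and integral. -/
theorem neg_log_one_sub_abs_le (s : ℝ) :
    -Real.log (1 - |s|) ≤ |Real.log (1 - s)| + |Real.log (1 + s)| := by
  rcases abs_cases s with ⟨h, _⟩ | ⟨h, _⟩
  · rw [h]
    linarith [neg_abs_le (Real.log (1 - s)), abs_nonneg (Real.log (1 + s))]
  · rw [h, sub_neg_eq_add]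
    linarith [neg_abs_le (Real.log (1 + s)), abs_nonneg (Real.log (1 - s))]

theorem ae_prod_abs_inner_lt_one : ∀ᵐ q : Sph 2 × Sph 2 ∂((sphVol 2).prod (sphVol 2)),
    |inner ℝ (q.1 : Amb 2) (q.2 : Amb 2)| < 1 := by
  have hm : MeasurableSet {q : Sph 2 × Sph 2 | |inner ℝ (q.1 : Amb 2) (q.2 : Amb 2)| < 1} :=
    measurableSet_lt (by fun_prop) measurable_const
  refine (Measure.ae_prod_iff_ae_ae hm).mpr (Filter.Eventually.of_forall fun x => ?_)
  have h1 : ∀ᵐ y ∂(sphVol 2), y ∉ ({x, -x} : Set (Sph 2)) :=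
    measure_eq_zero_iff_ae_notMem.mp ((Set.toFinite _).measure_zero _)
  filter_upwards [h1] with y hy
  simp only [mem_insert_iff, mem_singleton_iff, not_or] at hy
  have h2 := chord_pos (x := x) (y := y) fun h => hy.1 h.symm
  have h3 := chord_pos (x := x) (y := -y) fun h => hy.2 (by rw [h, neg_neg])
  unfold chord at h2 h3
  simp only [coe_neg_sphere, inner_neg_right] at h3
  rw [abs_lt]
  constructor <;> linarith

theorem measurePreserving_neg_sphVol :
    MeasurePreserving (fun x : Sph 2 => -x) (sphVol 2) (sphVol 2) := by
  convert measurePreserving_sphMap (LinearIsometryEquiv.neg ℝ : Amb 2 ≃ₗᵢ[ℝ] Amb 2) using 1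
  funext x
  ext1
  simp

/-- Positivity of the logarithmic energy: if the energy of a continuous density vanishes then so
do all its moments of positive degree. -/
theorem integral_mono_mul_eq_zero {v : Sph 2 → ℝ} (hv : Continuous v)
    (h : ∫ q : Sph 2 × Sph 2, Real.log (chord q.1 q.2) * (v q.1 * v q.2)
      ∂((sphVol 2).prod (sphVol 2)) = 0) {k : ℕ} (hk : 1 ≤ k) (p : Fin k → Fin 3) :
    ∫ x, mono p x * v x ∂(sphVol 2) = 0 := by
  obtain ⟨B, hB0, hB⟩ := exists_bound_of_continuous hv
  have hvv : ∀ q : Sph 2 × Sph 2, |v q.1 * v q.2| ≤ B * B := fun q => by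
    rw [abs_mul]
    exact mul_le_mul (hB _) (hB _) (abs_nonneg _) hB0
  have hlog := integrable_prod_log_chord (sphVol 2)
  have hlog2 : Integrable (fun q : Sph 2 × Sph 2 => Real.log (chord q.1 (-q.2)))
      ((sphVol 2).prod (sphVol 2)) :=
    ((MeasurePreserving.id (sphVol 2)).prod measurePreserving_neg_sphVol).integrable_comp_of_integrable
      hlog
  -- Termwise integration of `-log (1 - ⟨x, y⟩) = ∑ ⟨x, y⟩^{j+1} / (j+1)`. Every term is
  -- nonnegative, so vanishing of the sum kills each of them.
  have hsum : HasSum (fun j : ℕ => ∫ q : Sph 2 × Sph 2,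
      (inner ℝ (q.1 : Amb 2) (q.2 : Amb 2)) ^ (j + 1) / (j + 1) * (v q.1 * v q.2)
        ∂((sphVol 2).prod (sphVol 2)))
      (∫ q : Sph 2 × Sph 2, -Real.log (chord q.1 q.2) * (v q.1 * v q.2)
        ∂((sphVol 2).prod (sphVol 2))) := by
    refine hasSum_integral_of_dominated_convergence (fun j q =>
      |inner ℝ (q.1 : Amb 2) (q.2 : Amb 2)| ^ (j + 1) / (j + 1) * (B * B)) ?_ ?_ ?_ ?_ ?_
    · intro j
      refine Continuous.aestronglyMeasurable ?_
      fun_prop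
    · refine fun j => Filter.Eventually.of_forall fun q => ?_
      rw [norm_mul, norm_div, norm_pow, Real.norm_eq_abs, Real.norm_eq_abs, Real.norm_eq_abs,
        abs_of_pos (by positivity : (0 : ℝ) < j + 1)]
      exact mul_le_mul_of_nonneg_left (hvv q) (by positivity)
    · filter_upwards [ae_prod_abs_inner_lt_one] with q hq
      exact (Real.hasSum_pow_div_log_of_abs_lt_one (by rwa [abs_abs])).summable.mul_right _
    · refine Integrable.congr (f := fun q : Sph 2 × Sph 2 =>
        -Real.log (1 - |inner ℝ (q.1 : Amb 2) (q.2 : Amb 2)|) * (B * B)) ?_ ?_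
      · refine Integrable.mul_const ?_ _
        refine (hlog.abs.add hlog2.abs).mono'
          (Measurable.aestronglyMeasurable (by fun_prop)) ?_
        filter_upwards [ae_prod_abs_inner_lt_one] with q hq
        rw [Real.norm_eq_abs, abs_neg, abs_of_nonpos
          (Real.log_nonpos (by linarith) (by linarith [abs_nonneg (inner ℝ (q.1 : Amb 2)
            (q.2 : Amb 2))]))]
        refine (neg_log_one_sub_abs_le _).trans_eq ?_
        simp [chord]
      · filter_upwards [ae_prod_abs_inner_lt_one] with q hq
        rw [tsum_mul_right, (Real.hasSum_pow_div_log_of_abs_lt_one (by rwa [abs_abs])).tsum_eq]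
    · filter_upwards [ae_prod_abs_inner_lt_one] with q hq
      exact (Real.hasSum_pow_div_log_of_abs_lt_one hq).mul_right _
  have hterm : ∀ j : ℕ, ∫ q : Sph 2 × Sph 2,
      (inner ℝ (q.1 : Amb 2) (q.2 : Amb 2)) ^ (j + 1) / (j + 1) * (v q.1 * v q.2)
        ∂((sphVol 2).prod (sphVol 2)) = ((j : ℝ) + 1)⁻¹ *
      ∑ p : Fin (j + 1) → Fin 3, (∫ x, mono p x * v x ∂(sphVol 2)) ^ 2 := by
    intro j
    rw [← integral_inner_pow_mul_mul (j + 1) hv, ← integral_const_mul]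
    refine integral_congr_ae (Filter.Eventually.of_forall fun q => ?_)
    simp only
    ring
  simp only [neg_mul, integral_neg, h, neg_zero, hterm] at hsum
  have hnn : ∀ j : ℕ, 0 ≤ ((j : ℝ) + 1)⁻¹ *
      ∑ p : Fin (j + 1) → Fin 3, (∫ x, mono p x * v x ∂(sphVol 2)) ^ 2 := fun j => by positivity
  obtain ⟨j, rfl⟩ : ∃ j, k = j + 1 := ⟨k - 1, by omega⟩
  have h0 := congrFun ((hasSum_zero_iff_of_nonneg hnn).mp hsum) j
  have h1 := (mul_eq_zero.mp h0).resolve_left (by positivity)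
  have h2 := (Finset.sum_eq_zero_iff_of_nonneg fun p _ => sq_nonneg _).mp h1 p (Finset.mem_univ p)
  exact pow_eq_zero_iff (two_ne_zero) |>.mp h2

/-- The moment function `v` has constant potential and integral zero, hence zero logarithmic energy,
and is therefore orthogonal to all monomials of degree `k ≥ 1`. It is itself a combination of these,
so `∫ v² = 0`. Degree zero is equality of the masses. -/
theorem momentDiff_eq_zero (hPN : P univ = N univ) {c : ℝ}
    (hc : ∀ᵐ x ∂(sphVol 2), ∫ y, Real.log (chord x y) ∂P - ∫ y, Real.log (chord x y) ∂N = c)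
    (k : ℕ) (x : Sph 2) : momentDiff P N k x = 0 := by
  rcases Nat.eq_zero_or_pos k with rfl | hk
  · simp [momentDiff, measureReal_def, hPN]
  have hv := continuous_momentDiff (P := P) (N := N) k
  set v := momentDiff P N k with hvdef
  have hE : ∫ q : Sph 2 × Sph 2, Real.log (chord q.1 q.2) * (v q.1 * v q.2)
      ∂((sphVol 2).prod (sphVol 2)) = 0 := by
    obtain ⟨B, hB0, hB⟩ := exists_bound_of_continuous hv
    have hint : Integrable (fun q : Sph 2 × Sph 2 => Real.log (chord q.1 q.2) * (v q.1 * v q.2))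
        ((sphVol 2).prod (sphVol 2)) := by
      refine (integrable_prod_log_chord (sphVol 2)).mul_bdd (c := B * B) (by fun_prop)
        (Filter.Eventually.of_forall fun q => ?_)
      rw [norm_mul]
      exact mul_le_mul (hB _) (hB _) (abs_nonneg _) hB0
    rw [integral_prod _ hint]
    have : ∀ x, ∫ y, Real.log (chord x y) * (v x * v y) ∂(sphVol 2) =
        v x * (c * ∫ y, (inner ℝ (y : Amb 2) (north : Amb 2)) ^ k ∂(sphVol 2)) := by
      intro x
      rw [← integral_log_mul_momentDiff k hc x, ← integral_const_mul]
      refine integral_congr_ae (Filter.Eventually.of_forall fun y => ?_)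
      simp only [← hvdef]
      ring
    simp only [this]
    rw [integral_mul_const, integral_momentDiff k hPN, zero_mul]
  have hmono := integral_mono_mul_eq_zero hv hE hk
  have hsq : ∫ x, v x ^ 2 ∂(sphVol 2) = 0 := by
    have : ∀ x, v x ^ 2 = ∑ p : Fin k → Fin 3,
        (∫ z, mono p z ∂P - ∫ z, mono p z ∂N) * (mono p x * v x) := by
      intro x
      rw [sq]
      nth_rewrite 1 [hvdef]
      rw [momentDiff_eq, Finset.sum_mul]
      exact Finset.sum_congr rfl fun p _ => by ring
    simp only [this]
    rw [integral_finsetSum _ fun p _ => by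
      exact (integrable_of_continuous ((continuous_mono p).mul hv)).const_mul _]
    simp [integral_const_mul, hmono]
  rw [integral_eq_zero_iff_of_nonneg (fun x => sq_nonneg _)
    (integrable_of_continuous (hv.pow 2))] at hsq
  have := congrFun ((Continuous.ae_eq_iff_eq (sphVol 2) (hv.pow 2) continuous_zero).mp hsq) x
  simpa using this

/-- A finite measure on the sphere is determined by its zonal moments. -/
theorem measure_eq_of_momentDiff_eq_zero (h : ∀ k x, momentDiff P N k x = 0) : P = N := by
  have hemb : MeasurableEmbedding ((↑) : Sph 2 → Amb 2) :=
    MeasurableEmbedding.subtype_coe Metric.isClosed_sphere.measurableSet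
  have hmap : P.map ((↑) : Sph 2 → Amb 2) = N.map ((↑) : Sph 2 → Amb 2) := by
    refine Measure.ext_of_charFun (funext fun ξ => ?_)
    obtain ⟨r, x, rfl⟩ : ∃ (r : ℝ) (x : Sph 2), ξ = r • (x : Amb 2) := by
      by_cases hξ : ξ = 0
      · exact ⟨0, north, by simp [hξ]⟩
      · exact ⟨‖ξ‖, ⟨‖ξ‖⁻¹ • ξ, by simp [norm_smul, hξ]⟩, by simp [smul_smul, hξ]⟩
    -- The exponential series of the characteristic function, in the direction `x` at radius `r`,
    -- has the zonal moments as coefficients.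
    have key : ∀ Q : Measure (Sph 2), ∀ [IsFiniteMeasure Q],
        HasSum (fun k : ℕ => ((k.factorial : ℂ)⁻¹ * (r * Complex.I) ^ k) *
          ((∫ z, (inner ℝ (x : Amb 2) (z : Amb 2)) ^ k ∂Q : ℝ) : ℂ))
          (charFun (Q.map ((↑) : Sph 2 → Amb 2)) (r • (x : Amb 2))) := by
      intro Q _
      have e : ∀ k : ℕ, ((k.factorial : ℂ)⁻¹ * (r * Complex.I) ^ k) *
          ((∫ z, (inner ℝ (x : Amb 2) (z : Amb 2)) ^ k ∂Q : ℝ) : ℂ) =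
          ∫ z, ((k.factorial : ℂ)⁻¹ * (r * Complex.I) ^ k) *
            ((inner ℝ (x : Amb 2) (z : Amb 2) : ℝ) : ℂ) ^ k ∂Q := by
        intro k
        rw [integral_const_mul, ← integral_complex_ofReal]
        simp
      simp only [e]
      rw [charFun_apply, integral_map hemb.measurable.aemeasurable (by fun_prop)]
      refine hasSum_integral_of_dominated_convergence (fun k _ => |r| ^ k / k.factorial)
        ?_ ?_ ?_ ?_ ?_
      · exact fun k => Continuous.aestronglyMeasurable (by fun_prop)
      · refine fun k => Filter.Eventually.of_forall fun z => ?_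
        have h1 : ‖((inner ℝ (x : Amb 2) (z : Amb 2) : ℝ) : ℂ)‖ ^ k ≤ 1 := by
          refine pow_le_one₀ (norm_nonneg _) ?_
          rw [Complex.norm_real]
          exact abs_inner_le_one x z
        rw [norm_mul, norm_mul, norm_pow, norm_pow, norm_mul, norm_inv, Complex.norm_I,
          Complex.norm_real, Complex.norm_natCast, mul_one, Real.norm_eq_abs, div_eq_inv_mul]
        exact mul_le_of_le_one_right (by positivity) h1
      · exact Filter.Eventually.of_forall fun _ => Real.summable_pow_div_factorial _
      · exact integrable_const _
      · refine Filter.Eventually.of_forall fun z => ?_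
        have h2 := NormedSpace.exp_series_hasSum_exp' (𝕂 := ℂ) (𝔸 := ℂ)
          ((inner ℝ (z : Amb 2) (r • (x : Amb 2)) : ℝ) * Complex.I)
        rw [← Complex.exp_eq_exp_ℂ] at h2
        have h3 : (fun k : ℕ => ((k.factorial : ℂ)⁻¹ * (r * Complex.I) ^ k) *
            ((inner ℝ (x : Amb 2) (z : Amb 2) : ℝ) : ℂ) ^ k) = fun k : ℕ => (k.factorial : ℂ)⁻¹ •
              ((inner ℝ (z : Amb 2) (r • (x : Amb 2)) : ℝ) * Complex.I) ^ k := by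
          funext k
          rw [inner_smul_right, real_inner_comm, smul_eq_mul]
          push_cast
          ring
        rw [h3]
        exact h2
    have h1 := key P
    have h2 := key N
    have heq : ∀ k : ℕ, (∫ z, (inner ℝ (x : Amb 2) (z : Amb 2)) ^ k ∂P) =
        ∫ z, (inner ℝ (x : Amb 2) (z : Amb 2)) ^ k ∂N := fun k => sub_eq_zero.mp (h k x)
    simp only [heq] at h1
    exact h1.unique h2
  ext s hs
  have := congrArg (fun m => m (((↑) : Sph 2 → Amb 2) '' s)) hmap
  simpa [hemb.map_apply, preimage_image_eq _ hemb.injective] using this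

/-- Injectivity of the logarithmic potential. -/
theorem measure_eq_of_log_potential (hPN : P univ = N univ) {c : ℝ}
    (hc : ∀ᵐ x ∂(sphVol 2), ∫ y, Real.log (chord x y) ∂P - ∫ y, Real.log (chord x y) ∂N = c) :
    P = N :=
  measure_eq_of_momentDiff_eq_zero fun k x => momentDiff_eq_zero hPN hc k x

end Moments


/-! ### The Green potential and the conformal factor -/

section Potential

/-- The Green function off the diagonal, in terms of `1 - ⟨x, y⟩`. -/
def greenReal (x y : Sph 2) : ℝ :=
  -(1 / (4 * Real.pi)) * Real.log (chord x y) + (Real.log 2 - 1) / (4 * Real.pi)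

/-- Since `|x - y|² / 4 = chord x y / 2`, the logarithm of `|x - y| / 2` is half that of `chord x y
/ 2`. -/
theorem green_eq {x y : Sph 2} (h : x ≠ y) : green x y = (greenReal x y : EReal) := by
  have hd : 0 < dist x y := dist_pos.mpr h
  unfold green greenReal
  rw [if_neg h, chord_eq_dist_sq, Real.log_div (by positivity) (by norm_num),
    Real.log_div (by positivity) (by norm_num), Real.log_pow]
  congr 1
  field_simp
  push_cast
  ring

theorem ae_ne_of_lintegral_kap {m : Measure (Sph 2)} {x : Sph 2} (h : ∫⁻ y, kap x y ∂m ≠ ⊤) :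
    ∀ᵐ y ∂m, x ≠ y := by
  filter_upwards [ae_lt_top (measurable_kap_right x) h] with y hy hxy
  rw [hxy, kap_self] at hy
  exact lt_irrefl _ hy

theorem integrable_greenReal {m : Measure (Sph 2)} [IsFiniteMeasure m] {x : Sph 2}
    (h : ∫⁻ y, kap x y ∂m ≠ ⊤) : Integrable (greenReal x) m :=
  ((integrable_log_chord h).const_mul _).add (integrable_const _)

theorem lintegral_green {m : Measure (Sph 2)} {x : Sph 2} (h : ∫⁻ y, kap x y ∂m ≠ ⊤) :
    ∫⁻ y, (green x y).toENNReal ∂m = ∫⁻ y, ENNReal.ofReal (greenReal x y) ∂m := by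
  refine lintegral_congr_ae ?_
  filter_upwards [ae_ne_of_lintegral_kap h] with y hy
  rw [green_eq hy, EReal.real_coe_toENNReal]

theorem lintegral_neg_green {m : Measure (Sph 2)} {x : Sph 2} (h : ∫⁻ y, kap x y ∂m ≠ ⊤) :
    ∫⁻ y, (-green x y).toENNReal ∂m = ∫⁻ y, ENNReal.ofReal (-greenReal x y) ∂m := by
  refine lintegral_congr_ae ?_
  filter_upwards [ae_ne_of_lintegral_kap h] with y hy
  rw [green_eq hy, ← EReal.coe_neg, EReal.real_coe_toENNReal]

theorem lintegral_ofReal_ne_top {m : Measure (Sph 2)} {g : Sph 2 → ℝ} (hg : Integrable g m) :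
    ∫⁻ y, ENNReal.ofReal (g y) ∂m ≠ ⊤ := by
  refine ne_top_of_le_ne_top hg.2.ne (lintegral_mono fun y => ?_)
  rw [← ofReal_norm]
  exact ENNReal.ofReal_le_ofReal (le_abs_self _)

variable {μ : SignedMeasure (Sph 2)}

/-- At the points where the kernel is integrable, the potential is defined and finite. -/
theorem potential_eq_sub {x : Sph 2}
    (hp : ∫⁻ y, kap x y ∂μ.toJordanDecomposition.posPart ≠ ⊤)
    (hn : ∫⁻ y, kap x y ∂μ.toJordanDecomposition.negPart ≠ ⊤) :
    PotentialDefinedAt μ x ∧ potential μ x =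
      ((∫ y, greenReal x y ∂μ.toJordanDecomposition.posPart -
        ∫ y, greenReal x y ∂μ.toJordanDecomposition.negPart : ℝ) : EReal) := by
  have ip := integrable_greenReal hp
  have im := integrable_greenReal hn
  have h1 := lintegral_ofReal_ne_top ip
  have h2 := lintegral_ofReal_ne_top ip.neg
  have h3 := lintegral_ofReal_ne_top im
  have h4 := lintegral_ofReal_ne_top im.neg
  simp only [Pi.neg_apply] at h2 h4
  unfold PotentialDefinedAt potential potentialPos potentialNeg
  rw [lintegral_green hp, lintegral_green hn, lintegral_neg_green hp, lintegral_neg_green hn]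
  refine ⟨Or.inl (ENNReal.add_ne_top.mpr ⟨h1, h4⟩), ?_⟩
  rw [integral_eq_lintegral_pos_part_sub_lintegral_neg_part ip,
    integral_eq_lintegral_pos_part_sub_lintegral_neg_part im]
  generalize ∫⁻ y, ENNReal.ofReal (greenReal x y) ∂μ.toJordanDecomposition.posPart = a at *
  generalize ∫⁻ y, ENNReal.ofReal (-greenReal x y) ∂μ.toJordanDecomposition.posPart = b at *
  generalize ∫⁻ y, ENNReal.ofReal (greenReal x y) ∂μ.toJordanDecomposition.negPart = c at *
  generalize ∫⁻ y, ENNReal.ofReal (-greenReal x y) ∂μ.toJordanDecomposition.negPart = d at *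
  lift a to NNReal using h1
  lift b to NNReal using h2
  lift c to NNReal using h3
  lift d to NNReal using h4
  have hc : ∀ r : NNReal, ((r : ℝ≥0∞) : EReal) = ((r : ℝ) : EReal) := fun r => rfl
  rw [← ENNReal.coe_add, ← ENNReal.coe_add, hc, hc, ← EReal.coe_sub]
  simp only [ENNReal.coe_toReal]
  congr 1
  push_cast
  ring

theorem posPart_univ_eq_negPart_univ (hμ : μ univ = 0) :
    μ.toJordanDecomposition.posPart univ = μ.toJordanDecomposition.negPart univ := by
  have h := congrArg (fun m => m univ) μ.toSignedMeasure_toJordanDecomposition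
  simp only [JordanDecomposition.toSignedMeasure, sub_apply,
    Measure.toSignedMeasure_apply_measurable MeasurableSet.univ, hμ, sub_eq_zero] at h
  exact (measureReal_eq_measureReal_iff).mp h

/-- The additive constant of the Green function drops out because `μ` has total mass zero. -/
theorem potential_eq_log {x : Sph 2} (hμ : μ univ = 0)
    (hp : ∫⁻ y, kap x y ∂μ.toJordanDecomposition.posPart ≠ ⊤)
    (hn : ∫⁻ y, kap x y ∂μ.toJordanDecomposition.negPart ≠ ⊤) :
    PotentialDefinedAt μ x ∧ potential μ x =
      ((-(1 / (4 * Real.pi)) * (∫ y, Real.log (chord x y) ∂μ.toJordanDecomposition.posPart -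
        ∫ y, Real.log (chord x y) ∂μ.toJordanDecomposition.negPart) : ℝ) : EReal) := by
  refine ⟨(potential_eq_sub hp hn).1, ?_⟩
  rw [(potential_eq_sub hp hn).2]
  congr 1
  unfold greenReal
  rw [integral_add ((integrable_log_chord hp).const_mul _) (integrable_const _),
    integral_add ((integrable_log_chord hn).const_mul _) (integrable_const _),
    integral_const_mul, integral_const_mul, integral_const, integral_const, measureReal_def,
    measureReal_def, posPart_univ_eq_negPart_univ hμ]
  ring

/-- The conformal factor is almost everywhere the exponential of the logarithmic potential. -/
theorem ae_eq_exp_log_potential {f : RP 2 → ℝ≥0∞} (hμ : μ univ = 0) (hf : IsExpPotential f μ) :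
    ∀ᵐ x ∂(sphVol 2), f (proj x) = ENNReal.ofReal (Real.exp (-(1 / (4 * Real.pi)) *
      (∫ y, Real.log (chord x y) ∂μ.toJordanDecomposition.posPart -
        ∫ y, Real.log (chord x y) ∂μ.toJordanDecomposition.negPart))) := by
  filter_upwards [lintegral_kap_ae_ne_top μ.toJordanDecomposition.posPart,
    lintegral_kap_ae_ne_top μ.toJordanDecomposition.negPart] with x hp hn
  obtain ⟨h1, h2⟩ := potential_eq_log hμ hp hn
  rw [hf x h1, h2, EReal.exp_coe]

/-- If the conformal factor is constant almost everywhere, the measure vanishes. -/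
theorem measure_eq_zero_of_ae_const {f : RP 2 → ℝ≥0∞} (hμ : μ univ = 0) (hf : IsExpPotential f μ)
    {c : ℝ≥0∞} (hc : ∀ᵐ x ∂(sphVol 2), f (proj x) = c) : μ = 0 := by
  have hpi := Real.pi_pos
  have key : μ.toJordanDecomposition.posPart = μ.toJordanDecomposition.negPart := by
    refine measure_eq_of_log_potential (posPart_univ_eq_negPart_univ hμ)
      (c := -(4 * Real.pi) * Real.log c.toReal) ?_
    filter_upwards [hc, ae_eq_exp_log_potential hμ hf] with x h1 h2
    rw [← h1, h2, ENNReal.toReal_ofReal (Real.exp_pos _).le, Real.log_exp]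
    field_simp
  rw [← μ.toSignedMeasure_toJordanDecomposition, JordanDecomposition.toSignedMeasure]
  simp only [key, sub_self]

/-- The zero potential is defined everywhere, so `f = 1` at every point. Equality almost everywhere
would not be enough, since the systole is sensitive to null sets. -/
theorem eq_one_of_measure_eq_zero {f : RP 2 → ℝ≥0∞} (hf : IsExpPotential f 0) :
    f = roundFactor 2 := by
  funext p
  obtain ⟨x, rfl⟩ := Quotient.exists_rep p
  have hj := SignedMeasure.toJordanDecomposition_zero (α := Sph 2)
  have h1 : potentialPos 0 x = 0 := by simp [potentialPos, hj]
  have h2 : potentialNeg 0 x = 0 := by simp [potentialNeg, hj]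
  have h3 := hf x (Or.inl (by rw [h1]; exact ENNReal.zero_ne_top))
  rw [potential, h1, h2] at h3
  change f (proj x) = 1
  rw [h3]
  simp

theorem hasConstantCurvature_roundFactor : HasConstantCurvature (roundFactor 2) 0 := by
  refine ⟨1, fun s _ => ?_⟩
  simp [curvatureMeasure, liftedArea, roundFactor, measureReal_def]

end Potential


/-! ### Regularity of metrics of constant curvature -/

section Regularity

open Filter Topology

/-- The logarithmic potential of a measure on the sphere. -/
def logPot (m : Measure (Sph 2)) (x : Sph 2) : ℝ := ∫ y, Real.log (chord x y) ∂m

theorem measurable_logPot (m : Measure (Sph 2)) [SFinite m] : Measurable (logPot m) :=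
  (StronglyMeasurable.integral_prod_right' (ν := m)
    (f := fun p : Sph 2 × Sph 2 => Real.log (chord p.1 p.2))
    measurable_log_chord.stronglyMeasurable).measurable

theorem lintegral_kap_le_of_le_smul {m : Measure (Sph 2)} {C : ℝ≥0∞} (h : m ≤ C • sphVol 2)
    (x : Sph 2) : ∫⁻ y, kap x y ∂m ≤ C * kapMass :=
  (lintegral_mono' h le_rfl).trans (by
    rw [lintegral_smul_measure, smul_eq_mul, lintegral_kap_eq]; rfl)

theorem integral_rpow_chord_le {m : Measure (Sph 2)} {x : Sph 2} {C : ℝ≥0∞} (hC : C ≠ ⊤)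
    (h : ∫⁻ y, kap x y ∂m ≤ C) : ∫ y, chord x y ^ (-(1 / 4) : ℝ) ∂m ≤ C.toReal := by
  rw [integral_eq_lintegral_of_nonneg_ae (Eventually.of_forall fun y =>
    Real.rpow_nonneg (chord_nonneg x y) _)
    ((measurable_chord_right x).pow_const _).aestronglyMeasurable]
  exact ENNReal.toReal_mono hC ((lintegral_mono fun y => ofReal_rpow_le_kap x y).trans h)

theorem abs_logPot_le_of_le_smul {m : Measure (Sph 2)} {C : ℝ≥0∞} (hC : C ≠ ⊤)
    (h : m ≤ C • sphVol 2) (x : Sph 2) : |logPot m x| ≤ 4 * (C * kapMass).toReal := by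
  have hk := lintegral_kap_le_of_le_smul h x
  have hfin := ENNReal.mul_ne_top hC kapMass_ne_top
  have hk' := ne_top_of_le_ne_top hfin hk
  calc |logPot m x| ≤ ∫ y, |Real.log (chord x y)| ∂m := abs_integral_le_integral_abs
    _ ≤ ∫ y, 4 * chord x y ^ (-(1 / 4) : ℝ) ∂m :=
      integral_mono (integrable_log_chord hk').abs ((integrable_rpow_chord hk').const_mul 4)
        fun y => abs_log_chord_le x y
    _ ≤ _ := by
      rw [integral_const_mul]
      gcongr
      exact integral_rpow_chord_le hfin hk

/-- The factor `2` is needed only for `1 ≤ d ≤ 2`, where `d^{-1/4}` may fall below `1` but not below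
`1/2`. -/
theorem rpow_neg_le_two_mul {d a : ℝ} (hd : 0 < d) (hd2 : d ≤ 2) (ha : 0 ≤ a) (ha4 : a ≤ 1 / 4) :
    d ^ (-a) ≤ 2 * d ^ (-(1 / 4) : ℝ) := by
  rcases le_total d 1 with h1 | h1
  · have := Real.rpow_le_rpow_of_exponent_ge hd h1 (by linarith : -(1 / 4) ≤ -a)
    have := Real.rpow_pos_of_pos hd (-(1 / 4) : ℝ)
    linarith
  · have h2 : d ^ (-a) ≤ 1 := Real.rpow_le_one_of_one_le_of_nonpos h1 (by linarith)
    have h4 : (2 : ℝ)⁻¹ ≤ d ^ (-(1 / 4) : ℝ) := by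
      calc (2 : ℝ)⁻¹ ≤ d⁻¹ := by gcongr
        _ = d ^ (-1 : ℝ) := (Real.rpow_neg_one d).symm
        _ ≤ _ := Real.rpow_le_rpow_of_exponent_le h1 (by norm_num)
    linarith

/-- Exponential integrability of the potential of a measure of small mass. -/
theorem exists_exp_logPot_le {m : Measure (Sph 2)} [IsFiniteMeasure m]
    (hm : m.real univ ≤ Real.pi / 4) : ∃ A : ℝ≥0∞, A ≠ ⊤ ∧ ∀ x, ∫⁻ y, kap x y ∂m ≠ ⊤ →
      ENNReal.ofReal (Real.exp (-(1 / Real.pi) * logPot m x)) ≤ 1 + A * ∫⁻ y, kap x y ∂m := by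
  have hpi := Real.pi_pos
  rcases eq_or_ne m 0 with rfl | hm0
  · exact ⟨0, ENNReal.zero_ne_top, fun x _ => by simp [logPot]⟩
  have : NeZero m := ⟨hm0⟩
  have hs : 0 < m.real univ := measureReal_univ_pos
  set s := m.real univ with hsdef
  refine ⟨ENNReal.ofReal (s⁻¹ * 2), ENNReal.ofReal_ne_top, fun x hx => ?_⟩
  have hlog := integrable_log_chord hx
  have hne := ae_ne_of_lintegral_kap hx
  have hbd : ∀ᵐ y ∂m, Real.exp (-(s / Real.pi) * Real.log (chord x y)) ≤
      2 * chord x y ^ (-(1 / 4) : ℝ) := by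
    filter_upwards [hne] with y hy
    have := rpow_neg_le_two_mul (chord_pos hy) (chord_le_two x y)
      (by positivity : 0 ≤ s / Real.pi) (by rw [div_le_iff₀ hpi]; linarith)
    rwa [Real.rpow_def_of_pos (chord_pos hy), mul_comm] at this
  have hint : Integrable (fun y => Real.exp (-(s / Real.pi) * Real.log (chord x y))) m :=
    ((integrable_rpow_chord hx).const_mul 2).mono'
      (((measurable_chord_right x).log.const_mul _).exp.aestronglyMeasurable)
      (hbd.mono fun y hy => by rwa [Real.norm_eq_abs, abs_of_pos (Real.exp_pos _)])
  -- Jensen for the normalized measure: the exponential of the potential is at most the mean of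
  -- `chord^{-s/π}`, and the bound on the mass is exactly `s / π ≤ 1/4`.
  have hJ := convexOn_exp.map_average_le (μ := m)
    (f := fun y => -(s / Real.pi) * Real.log (chord x y)) Real.continuous_exp.continuousOn
    isClosed_univ (Eventually.of_forall fun _ => mem_univ _) (hlog.const_mul _) hint
  rw [average_eq, average_eq, integral_const_mul, smul_eq_mul, smul_eq_mul, ← hsdef] at hJ
  have e1 : s⁻¹ * (-(s / Real.pi) * ∫ y, Real.log (chord x y) ∂m) =
      -(1 / Real.pi) * logPot m x := by
    unfold logPot
    field_simp
  rw [e1] at hJ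
  have h2 : ∫ y, Real.exp (-(s / Real.pi) * Real.log (chord x y)) ∂m ≤
      2 * (∫⁻ y, kap x y ∂m).toReal := by
    refine (integral_mono_ae hint ((integrable_rpow_chord hx).const_mul 2) hbd).trans ?_
    rw [integral_const_mul]
    gcongr
    exact integral_rpow_chord_le hx le_rfl
  calc ENNReal.ofReal (Real.exp (-(1 / Real.pi) * logPot m x))
      ≤ ENNReal.ofReal (s⁻¹ * 2 * (∫⁻ y, kap x y ∂m).toReal) := by
        refine ENNReal.ofReal_le_ofReal (hJ.trans ?_)
        rw [mul_assoc]
        gcongr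
    _ = ENNReal.ofReal (s⁻¹ * 2) * ∫⁻ y, kap x y ∂m := by
        rw [ENNReal.ofReal_mul (by positivity), ENNReal.ofReal_toReal hx]
    _ ≤ _ := le_add_self

variable {m : Measure (Sph 2)} [IsFiniteMeasure m] {c : ℝ}

/-- The superlevel sets of a real-valued function decrease to the empty set, and `m` is finite. -/
theorem exists_measure_lt_le (m : Measure (Sph 2)) [IsFiniteMeasure m] {r : Sph 2 → ℝ}
    (hrm : Measurable r) {ε : ℝ≥0∞} (hε : 0 < ε) : ∃ M : ℕ, m {x | (M : ℝ) < r x} ≤ ε := by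
  have ht := tendsto_measure_iInter_atTop (μ := m) (s := fun n : ℕ => {x | (n : ℝ) < r x})
    (fun n => (measurableSet_lt measurable_const hrm).nullMeasurableSet)
    (fun a b hab x (hx : (b : ℝ) < r x) => lt_of_le_of_lt (by exact_mod_cast hab) hx)
    ⟨0, measure_ne_top _ _⟩
  have he : ⋂ n : ℕ, {x | (n : ℝ) < r x} = ∅ := by
    ext x
    simp only [mem_iInter, mem_ofPred_eq, mem_empty_iff_false, iff_false, not_forall, not_lt]
    exact exists_nat_ge (r x)
  rw [he, measure_empty] at ht
  exact (ht.eventually (ge_mem_nhds hε)).exists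

/-- The Brezis–Merle step: the density, a priori only integrable, is in `L²`. The measure is split
by the size of its own density. The part of bounded density has bounded potential; the other part
has small mass, so that the exponential of its potential is integrable. -/
theorem lintegral_exp_logPot_ne_top (hm : m = (sphVol 2).withDensity fun x =>
    ENNReal.ofReal (Real.exp (2 * (c - 1 / (4 * Real.pi) * logPot m x)))) :
    ∫⁻ x, ENNReal.ofReal (Real.exp (2 * (c - 1 / (4 * Real.pi) * logPot m x)) ^ 2)
      ∂(sphVol 2) ≠ ⊤ := by
  have hpi := Real.pi_pos
  have hV := measurable_logPot m
  set r : Sph 2 → ℝ := fun x => Real.exp (2 * (c - 1 / (4 * Real.pi) * logPot m x)) with hr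
  have hrm : Measurable r := by fun_prop
  -- The squared density is `exp (4c - logPot m / π)`, which is why the exponent `1/π` and the mass
  -- threshold `π / 4` are the relevant ones.
  obtain ⟨M, hM⟩ := exists_measure_lt_le m hrm
    (ENNReal.ofReal_pos.mpr (by positivity : 0 < Real.pi / 4))
  set S := {x | (M : ℝ) < r x} with hS
  have hSm : MeasurableSet S := measurableSet_lt measurable_const hrm
  have h1 : m.restrict Sᶜ ≤ (M : ℝ≥0∞) • sphVol 2 := by
    refine Measure.le_iff.mpr fun t ht => ?_
    rw [Measure.restrict_apply ht, Measure.smul_apply, smul_eq_mul]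
    nth_rewrite 1 [hm]
    rw [withDensity_apply _ (ht.inter hSm.compl)]
    calc ∫⁻ x in t ∩ Sᶜ, ENNReal.ofReal (r x) ∂(sphVol 2)
        ≤ ∫⁻ x in t ∩ Sᶜ, (M : ℝ≥0∞) ∂(sphVol 2) := by
          refine setLIntegral_mono measurable_const fun x hx => ?_
          have : r x ≤ M := not_lt.mp hx.2
          exact (ENNReal.ofReal_le_ofReal this).trans (by rw [ENNReal.ofReal_natCast])
      _ ≤ _ := by
          rw [setLIntegral_const]
          gcongr
          exact inter_subset_left
  have h2 : (m.restrict S).real univ ≤ Real.pi / 4 := by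
    rw [measureReal_restrict_apply_univ, measureReal_def]
    exact ENNReal.toReal_le_of_le_ofReal (by positivity) hM
  obtain ⟨A, hA, hAx⟩ := exists_exp_logPot_le h2
  set C := 4 * ((M : ℝ≥0∞) * kapMass).toReal with hC
  have hb : ∀ᵐ x ∂(sphVol 2), ENNReal.ofReal (r x ^ 2) ≤
      ENNReal.ofReal (Real.exp (4 * c + C / Real.pi)) *
        (1 + A * ∫⁻ y, kap x y ∂(m.restrict S)) := by
    filter_upwards [lintegral_kap_ae_ne_top m] with x hx
    have hxS : ∫⁻ y, kap x y ∂(m.restrict S) ≠ ⊤ :=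
      ne_top_of_le_ne_top hx (setLIntegral_le_lintegral _ _)
    have hsplit : logPot m x = logPot (m.restrict S) x + logPot (m.restrict Sᶜ) x :=
      (integral_add_compl hSm (integrable_log_chord hx)).symm
    have h3 := (abs_le.mp (abs_logPot_le_of_le_smul (ENNReal.natCast_ne_top M) h1 x)).1
    refine le_trans ?_ (mul_le_mul_right (hAx x hxS) _)
    rw [← ENNReal.ofReal_mul (Real.exp_pos _).le, ← Real.exp_add]
    refine ENNReal.ofReal_le_ofReal ?_
    rw [hr, ← Real.exp_nat_mul, Real.exp_le_exp, hsplit]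
    have h4 : -(logPot (m.restrict Sᶜ) x / Real.pi) ≤ C / Real.pi := by
      rw [← neg_div]
      gcongr
      linarith
    have e : ((2 : ℕ) : ℝ) * (2 * (c - 1 / (4 * Real.pi) *
        (logPot (m.restrict S) x + logPot (m.restrict Sᶜ) x))) =
        4 * c + -(logPot (m.restrict Sᶜ) x / Real.pi) +
          -(1 / Real.pi) * logPot (m.restrict S) x := by
      push_cast
      field_simp
      ring
    rw [e]
    linarith
  refine ne_top_of_le_ne_top ?_ (lintegral_mono_ae hb)
  have hkm : Measurable fun x => ∫⁻ y, kap x y ∂(m.restrict S) :=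
    Measurable.lintegral_prod_right' (f := fun p : Sph 2 × Sph 2 => kap p.1 p.2) measurable_kap
  rw [lintegral_const_mul _ (by fun_prop), lintegral_add_left measurable_const,
    lintegral_const_mul _ hkm, lintegral_lintegral_swap (f := kap) measurable_kap.aemeasurable]
  have : ∀ y, ∫⁻ x, kap x y ∂(sphVol 2) = kapMass := fun y => by
    simp only [kap_comm _ y]
    exact lintegral_kap_eq y
  simp only [this, lintegral_const]
  refine ENNReal.mul_ne_top ENNReal.ofReal_ne_top (ENNReal.add_ne_top.mpr
    ⟨by simp, ENNReal.mul_ne_top hA (ENNReal.mul_ne_top kapMass_ne_top (measure_ne_top _ _))⟩)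

/-- From `r |log| ≤ r² + log²` and the previous `L²` bound, the potential is bounded uniformly in
the point, and hence so is the density, which is its exponential. -/
theorem exists_le_smul_sphVol (hm : m = (sphVol 2).withDensity fun x =>
    ENNReal.ofReal (Real.exp (2 * (c - 1 / (4 * Real.pi) * logPot m x)))) :
    ∃ C : ℝ≥0∞, C ≠ ⊤ ∧ m ≤ C • sphVol 2 := by
  have hpi := Real.pi_pos
  have hL2 := lintegral_exp_logPot_ne_top hm
  have hV := measurable_logPot m
  set r : Sph 2 → ℝ := fun x => Real.exp (2 * (c - 1 / (4 * Real.pi) * logPot m x)) with hr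
  have hrm : Measurable r := by fun_prop
  have hbound : ∃ B : ℝ, ∀ x, |logPot m x| ≤ B := by
    refine ⟨(64 * kapMass + ∫⁻ x, ENNReal.ofReal (r x ^ 2) ∂(sphVol 2)).toReal, fun x => ?_⟩
    have hfin : 64 * kapMass + ∫⁻ x, ENNReal.ofReal (r x ^ 2) ∂(sphVol 2) ≠ ⊤ :=
      ENNReal.add_ne_top.mpr ⟨ENNReal.mul_ne_top (by norm_num) kapMass_ne_top, hL2⟩
    refine (norm_integral_le_lintegral_norm (fun y => Real.log (chord x y))).trans
      (ENNReal.toReal_mono hfin ?_)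
    have hlm : Measurable fun y => ENNReal.ofReal ‖Real.log (chord x y)‖ :=
      (measurable_chord_right x).log.norm.ennreal_ofReal
    nth_rewrite 1 [hm]
    rw [lintegral_withDensity_eq_lintegral_mul _ hrm.ennreal_ofReal hlm]
    calc ∫⁻ y, ENNReal.ofReal (r y) * ENNReal.ofReal ‖Real.log (chord x y)‖ ∂(sphVol 2)
        ≤ ∫⁻ y, (64 * kap x y + ENNReal.ofReal (r y ^ 2)) ∂(sphVol 2) := by
          refine lintegral_mono fun y => ?_
          rw [← ENNReal.ofReal_mul (Real.exp_pos _).le]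
          have h1 : r y * ‖Real.log (chord x y)‖ ≤ 64 * chord x y ^ (-(1 / 4) : ℝ) + r y ^ 2 := by
            have := sq_log_chord_le x y
            rw [Real.norm_eq_abs]
            nlinarith [sq_nonneg (r y - |Real.log (chord x y)|), sq_abs (Real.log (chord x y)),
              sq_nonneg (r y), sq_nonneg (Real.log (chord x y))]
          refine (ENNReal.ofReal_le_ofReal h1).trans ?_
          rw [ENNReal.ofReal_add (mul_nonneg (by norm_num) (Real.rpow_nonneg (chord_nonneg x y) _))
            (sq_nonneg _), ENNReal.ofReal_mul (by norm_num)]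
          gcongr
          · norm_num
          · exact ofReal_rpow_le_kap x y
      _ = _ := by
          rw [lintegral_add_left ((measurable_kap_right x).const_mul _),
            lintegral_const_mul _ (measurable_kap_right x), lintegral_kap_eq]
          rfl
  obtain ⟨B, hB⟩ := hbound
  refine ⟨ENNReal.ofReal (Real.exp (2 * (c + 1 / (4 * Real.pi) * B))), ENNReal.ofReal_ne_top,
    Measure.le_iff.mpr fun t ht => ?_⟩
  rw [Measure.smul_apply, smul_eq_mul]
  nth_rewrite 1 [hm]
  rw [withDensity_apply _ ht, ← setLIntegral_const]
  refine lintegral_mono fun x => ENNReal.ofReal_le_ofReal (Real.exp_le_exp.mpr ?_)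
  have h1 := (abs_le.mp (hB x)).1
  have h2 : 1 / (4 * Real.pi) * (-B) ≤ 1 / (4 * Real.pi) * logPot m x := by gcongr
  linarith

/-- The potentials of the logarithm truncated at `-(N + 1)` are continuous and converge uniformly:
where truncation acts, `|log| ≥ N + 1`, so the error is at most `log² / (N + 1)`, with uniformly
bounded integral. -/
theorem continuous_logPot {C : ℝ≥0∞} (hC : C ≠ ⊤) (h : m ≤ C • sphVol 2) :
    Continuous (logPot m) := by
  have hfin := ENNReal.mul_ne_top hC kapMass_ne_top
  set F : ℕ → Sph 2 → ℝ := fun N x =>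
    ∫ y, Real.log (max (chord x y) (Real.exp (-(N + 1 : ℝ)))) ∂m with hF
  have hpos : ∀ (N : ℕ) x y, 0 < max (chord x y) (Real.exp (-(N + 1 : ℝ))) := fun N x y =>
    lt_of_lt_of_le (Real.exp_pos _) (le_max_right _ _)
  have hcont2 : ∀ N : ℕ, Continuous fun p : Sph 2 × Sph 2 =>
      Real.log (max (chord p.1 p.2) (Real.exp (-(N + 1 : ℝ)))) := fun N =>
    (continuous_chord.max continuous_const).log fun p => (hpos N p.1 p.2).ne'
  have hbd : ∀ (N : ℕ) x y,
      ‖Real.log (max (chord x y) (Real.exp (-(N + 1 : ℝ))))‖ ≤ N + 1 := by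
    intro N x y
    rw [Real.norm_eq_abs, abs_le]
    constructor
    · have := Real.log_le_log (Real.exp_pos _)
        (le_max_right (chord x y) (Real.exp (-(N + 1 : ℝ))))
      rwa [Real.log_exp] at this
    · refine (Real.log_le_sub_one_of_pos (hpos N x y)).trans ?_
      have h1 := chord_le_two x y
      have h2 : Real.exp (-(N + 1 : ℝ)) ≤ 1 := Real.exp_le_one_iff.mpr (by linarith)
      have h3 : max (chord x y) (Real.exp (-(N + 1 : ℝ))) ≤ 2 := max_le h1 (by linarith)
      have : (0 : ℝ) ≤ N := N.cast_nonneg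
      linarith
  have hFc : ∀ N, Continuous (F N) := fun N =>
    continuous_of_dominated (bound := fun _ => (N + 1 : ℝ))
      (fun x => ((hcont2 N).comp (Continuous.prodMk_right x)).aestronglyMeasurable)
      (fun x => Eventually.of_forall (hbd N x)) (integrable_const _)
      (Eventually.of_forall fun y => (hcont2 N).comp (Continuous.prodMk_left y))
  have herr : ∀ N x, |F N x - logPot m x| ≤ 64 * (C * kapMass).toReal / (N + 1) := by
    intro N x
    have hk := lintegral_kap_le_of_le_smul h x
    have hk' := ne_top_of_le_ne_top hfin hk
    have hlog := integrable_log_chord hk'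
    have hi : Integrable (fun y => Real.log (max (chord x y) (Real.exp (-(N + 1 : ℝ))))) m :=
      (integrable_const (N + 1 : ℝ)).mono'
        ((hcont2 N).comp (Continuous.prodMk_right x)).aestronglyMeasurable
        (Eventually.of_forall (hbd N x))
    have hN : (0 : ℝ) < N + 1 := by positivity
    rw [hF, logPot]
    dsimp only
    rw [← integral_sub hi hlog, ← Real.norm_eq_abs]
    calc ‖∫ y, (Real.log (max (chord x y) (Real.exp (-(N + 1 : ℝ)))) - Real.log (chord x y)) ∂m‖
        ≤ ∫ y, 64 / (N + 1) * chord x y ^ (-(1 / 4) : ℝ) ∂m := by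
          refine norm_integral_le_of_norm_le ((integrable_rpow_chord hk').const_mul _) ?_
          filter_upwards [ae_ne_of_lintegral_kap hk'] with y hy
          have hd := chord_pos hy
          have hsq := sq_log_chord_le x y
          rcases le_total (Real.exp (-(N + 1 : ℝ))) (chord x y) with h1 | h1
          · rw [max_eq_left h1, sub_self, norm_zero]
            exact mul_nonneg (by positivity) (Real.rpow_nonneg hd.le _)
          · rw [max_eq_right h1, Real.log_exp, Real.norm_eq_abs]
            have h2 : Real.log (chord x y) ≤ -(N + 1 : ℝ) := by
              rw [← Real.log_exp (-(N + 1 : ℝ))]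
              exact Real.log_le_log hd h1
            rw [abs_of_nonneg (by linarith), div_mul_eq_mul_div, le_div_iff₀ hN]
            nlinarith
      _ ≤ _ := by
          rw [integral_const_mul, div_mul_eq_mul_div]
          gcongr
          exact integral_rpow_chord_le hfin hk
  have hu : TendstoUniformly F (logPot m) atTop := by
    rw [Metric.tendstoUniformly_iff]
    intro ε hε
    have ht : Tendsto (fun N : ℕ => 64 * (C * kapMass).toReal / ((N : ℝ) + 1)) atTop (𝓝 0) :=
      tendsto_const_nhds.div_atTop (tendsto_atTop_add_const_right _ _ tendsto_natCast_atTop_atTop)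
    filter_upwards [ht.eventually (gt_mem_nhds hε)] with N hN x
    rw [dist_comm, Real.dist_eq]
    exact (herr N x).trans_lt hN
  exact hu.continuous (Eventually.of_forall hFc).frequently

/-- A continuous solution of the Liouville equation on the sphere, in integral form: a metric
`exp (2 w) g₀` of curvature one. -/
structure IsLiouville (w : Sph 2 → ℝ) : Prop where
  continuous : Continuous w
  mass : ∫ x, Real.exp (2 * w x) ∂(sphVol 2) = 4 * Real.pi
  eq : ∃ c : ℝ, ∀ x, w x = c - 1 / (4 * Real.pi) *
    ∫ y, Real.log (chord x y) * Real.exp (2 * w y) ∂(sphVol 2)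

theorem logPot_sphVol (x : Sph 2) : logPot (sphVol 2) x = logPot (sphVol 2) north := by
  obtain ⟨A, hA⟩ := exists_sphMap_eq north x
  unfold logPot
  rw [← integral_sphMap A (measurable_chord_right x).log]
  simp only [← hA, chord_sphMap]

theorem isLiouville_of_withDensity (hmass : m univ = sphVol 2 univ)
    (hm : m = (sphVol 2).withDensity fun x =>
      ENNReal.ofReal (Real.exp (2 * (c - 1 / (4 * Real.pi) * logPot m x)))) :
    IsLiouville fun x => c - 1 / (4 * Real.pi) * logPot m x := by
  obtain ⟨C, hC, hle⟩ := exists_le_smul_sphVol hm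
  have hV := continuous_logPot hC hle
  have hnn : ∀ᵐ x ∂(sphVol 2), 0 ≤ Real.exp (2 * (c - 1 / (4 * Real.pi) * logPot m x)) :=
    Eventually.of_forall fun x => (Real.exp_pos _).le
  have hcont : Continuous fun x => Real.exp (2 * (c - 1 / (4 * Real.pi) * logPot m x)) := by
    fun_prop
  refine ⟨by fun_prop, ?_, c, fun x => ?_⟩
  · rw [integral_eq_lintegral_of_nonneg_ae hnn hcont.aestronglyMeasurable, ← setLIntegral_univ,
      ← withDensity_apply _ MeasurableSet.univ, ← hm, hmass, sphVol_two_univ,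
      ENNReal.toReal_ofReal (by positivity)]
  · congr 2
    have h1 : logPot m x = ∫ y, Real.log (chord x y) ∂((sphVol 2).withDensity fun x =>
      ENNReal.ofReal (Real.exp (2 * (c - 1 / (4 * Real.pi) * logPot m x)))) := by
      rw [← hm]; rfl
    rw [h1, integral_withDensity_eq_integral_toReal_smul hcont.measurable.ennreal_ofReal
      (Eventually.of_forall fun _ => ENNReal.ofReal_lt_top)]
    refine integral_congr_ae (Eventually.of_forall fun y => ?_)
    simp only [smul_eq_mul]
    rw [ENNReal.toReal_ofReal (Real.exp_pos _).le, mul_comm]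

/-- A metric of constant curvature has, up to a constant, a continuous conformal factor solving
the Liouville equation. -/
theorem exists_isLiouville {μ : SignedMeasure (Sph 2)} {f : RP 2 → ℝ≥0∞} (hμ : μ univ = 0)
    (hf : IsExpPotential f μ) (hK : HasConstantCurvature f μ) :
    ∃ (w : Sph 2 → ℝ) (b : ℝ), IsLiouville w ∧
      ∀ᵐ x ∂(sphVol 2), f (proj x) = ENNReal.ofReal (Real.exp (w x + b)) := by
  have hpi := Real.pi_pos
  obtain ⟨K, hK⟩ := hK
  set P := μ.toJordanDecomposition.posPart with hP
  set N := μ.toJordanDecomposition.negPart with hN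
  -- Gauss–Bonnet on the whole sphere. It forces `K` and the area to be positive, and also the area
  -- to be finite, since an infinite one would have real value zero.
  have hA : 4 * Real.pi = K * (liftedArea f univ).toReal := by
    rw [← hK univ MeasurableSet.univ, curvatureMeasure, hμ, measureReal_def, sphVol_two_univ,
      ENNReal.toReal_ofReal (by positivity), add_zero]
  have hA0 : 0 < (liftedArea f univ).toReal :=
    lt_of_le_of_ne ENNReal.toReal_nonneg fun h => by rw [← h, mul_zero] at hA; linarith
  have hK0 : 0 < K := by
    by_contra hneg
    nlinarith
  have hAfin : liftedArea f univ ≠ ⊤ := fun h => by rw [h] at hA0; simp at hA0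
  -- Adding `log K / 2` scales the metric to curvature one.
  set w₀ : Sph 2 → ℝ := fun x =>
    Real.log K / 2 + -(1 / (4 * Real.pi)) * (logPot P x - logPot N x) with hw₀
  have hw₀m : Measurable w₀ := by
    have := measurable_logPot P
    have := measurable_logPot N
    fun_prop
  have hfw : ∀ᵐ x ∂(sphVol 2), f (proj x) = ENNReal.ofReal (Real.exp (w₀ x - Real.log K / 2)) := by
    filter_upwards [ae_eq_exp_log_potential hμ hf] with x hx
    rw [hx, hw₀]
    congr 2
    simp only [logPot]
    ring
  set m := (sphVol 2).withDensity fun x => ENNReal.ofReal (Real.exp (2 * w₀ x)) with hm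
  have hmapply : ∀ s, MeasurableSet s → m s = ENNReal.ofReal K * liftedArea f s := by
    intro s hs
    rw [hm, withDensity_apply _ hs, liftedArea, ← lintegral_const_mul' _ _ ENNReal.ofReal_ne_top]
    refine lintegral_congr_ae (ae_restrict_of_ae ?_)
    filter_upwards [hfw] with x hx
    rw [hx, ← ENNReal.ofReal_pow (Real.exp_pos _).le, ← ENNReal.ofReal_mul hK0.le]
    congr 1
    have e : 2 * w₀ x = Real.log K + (2 : ℕ) * (w₀ x - Real.log K / 2) := by
      push_cast
      ring
    rw [← Real.exp_nat_mul, e, Real.exp_add, Real.exp_log hK0]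
  have hmuniv : m univ ≠ ⊤ := by
    rw [hmapply univ MeasurableSet.univ]
    exact ENNReal.mul_ne_top ENNReal.ofReal_ne_top hAfin
  have : IsFiniteMeasure m := ⟨lt_top_iff_ne_top.mpr hmuniv⟩
  -- The curvature equation `sphVol + P - N = K · area`, written without subtraction. Taking
  -- logarithmic potentials of both sides gives the Liouville equation, as the potential of the
  -- round measure is constant.
  have hbal : P + sphVol 2 = m + N := by
    ext s hs
    rw [← ENNReal.toReal_eq_toReal_iff' (measure_ne_top _ _) (measure_ne_top _ _),
      Measure.add_apply, Measure.add_apply, ENNReal.toReal_add (measure_ne_top _ _)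
      (measure_ne_top _ _), ENNReal.toReal_add (measure_ne_top _ _) (measure_ne_top _ _),
      hmapply s hs, ENNReal.toReal_mul, ENNReal.toReal_ofReal hK0.le, ← hK s hs, curvatureMeasure]
    have h := congrArg (fun m => m s) μ.toSignedMeasure_toJordanDecomposition
    simp only [JordanDecomposition.toSignedMeasure, sub_apply,
      Measure.toSignedMeasure_apply_measurable hs] at h
    rw [← h]
    simp only [measureReal_def, hP, hN]
    ring
  have hmass : m univ = sphVol 2 univ := by
    have h := congrArg (fun m : Measure (Sph 2) => m univ) hbal
    simp only [Measure.add_apply] at h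
    rw [hP, hN, posPart_univ_eq_negPart_univ hμ, add_comm] at h
    exact ((ENNReal.add_left_inj (measure_ne_top _ _)).mp h).symm
  set c := Real.log K / 2 + 1 / (4 * Real.pi) * logPot (sphVol 2) north with hc
  have hww : ∀ᵐ x ∂(sphVol 2), w₀ x = c - 1 / (4 * Real.pi) * logPot m x := by
    filter_upwards [lintegral_kap_ae_ne_top P, lintegral_kap_ae_ne_top N,
      lintegral_kap_ae_ne_top m] with x h1 h2 h3
    have h := congrArg (fun m : Measure (Sph 2) => logPot m x) hbal
    simp only [logPot] at h
    rw [integral_add_measure (integrable_log_chord h1)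
        (integrable_log_chord (lintegral_kap_sphVol_ne_top x)),
      integral_add_measure (integrable_log_chord h3) (integrable_log_chord h2)] at h
    change logPot P x + logPot (sphVol 2) x = logPot m x + logPot N x at h
    rw [logPot_sphVol] at h
    simp only [hw₀, hc]
    linear_combination -(1 / (4 * Real.pi)) * h
  have hmeq : m = (sphVol 2).withDensity fun x =>
      ENNReal.ofReal (Real.exp (2 * (c - 1 / (4 * Real.pi) * logPot m x))) := by
    nth_rewrite 1 [hm]
    refine withDensity_congr_ae ?_
    filter_upwards [hww] with x hx
    rw [hx]
  refine ⟨_, -(Real.log K / 2), isLiouville_of_withDensity hmass hmeq, ?_⟩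
  filter_upwards [hfw, hww] with x h1 h2
  rw [h1, h2]
  rfl

theorem eq_of_ae_eq_of_continuous {v w : Sph 2 → ℝ} (hv : Continuous v) (hw : Continuous w)
    (h : ∀ᵐ x ∂(sphVol 2), v x = w x) : v = w :=
  Measure.eq_of_ae_eq h hv hw

/-- The lift of `f` takes equal values at antipodal points, and continuity removes the exceptional
null set. -/
theorem even_of_ae_eq {w : Sph 2 → ℝ} (hw : Continuous w) {f : RP 2 → ℝ≥0∞} {b : ℝ}
    (h : ∀ᵐ x ∂(sphVol 2), f (proj x) = ENNReal.ofReal (Real.exp (w x + b))) (x : Sph 2) :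
    w (-x) = w x := by
  have h' := measurePreserving_neg_sphVol.quasiMeasurePreserving.ae h
  refine congrFun (eq_of_ae_eq_of_continuous (hw.comp continuous_neg) hw ?_) x
  filter_upwards [h, h'] with x h1 h2
  rw [proj_neg, h1, ENNReal.ofReal_eq_ofReal_iff (Real.exp_pos _).le (Real.exp_pos _).le,
    Real.exp_eq_exp] at h2
  simp only [Function.comp_apply]
  linarith

end Regularity


/-! ### The reflected kernel on the cylinder -/

section CylinderKernel

open Filter Topology

/-- The reflection of the cylinder in the circle `t = a`. -/
def cylRefl (a : ℝ) (p : ℝ × ℝ) : ℝ × ℝ := (2 * a - p.1, p.2)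

theorem cylRefl_cylRefl (a : ℝ) (p : ℝ × ℝ) : cylRefl a (cylRefl a p) = p := by
  simp [cylRefl]

theorem continuous_cylRefl (a : ℝ) : Continuous (cylRefl a) := by
  unfold cylRefl
  fun_prop

theorem measurePreserving_cylRefl (a : ℝ) : MeasurePreserving (cylRefl a) cylVol cylVol :=
  (Measure.measurePreserving_sub_left volume (2 * a)).prod (MeasurePreserving.id _)

theorem integral_cylRefl (a : ℝ) (F : ℝ × ℝ → ℝ) :
    ∫ p, F (cylRefl a p) ∂cylVol = ∫ p, F p ∂cylVol := by
  refine (measurePreserving_cylRefl a).integral_comp' (f :=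
    ⟨⟨cylRefl a, cylRefl a, cylRefl_cylRefl a, cylRefl_cylRefl a⟩,
      (continuous_cylRefl a).measurable, (continuous_cylRefl a).measurable⟩) F

theorem integrable_cylRefl (a : ℝ) {F : ℝ × ℝ → ℝ} (hF : Integrable F cylVol) :
    Integrable (fun p => F (cylRefl a p)) cylVol :=
  (measurePreserving_cylRefl a).integrable_comp_of_integrable hF

theorem integrable_cylVol_fst {g : ℝ → ℝ} (hg : Integrable g) :
    Integrable (fun p : ℝ × ℝ => g p.1) cylVol :=
  hg.comp_fst _

theorem integral_cylVol_fst (g : ℝ → ℝ) :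
    ∫ p, g p.1 ∂cylVol = 2 * Real.pi * ∫ t, g t := by
  have hpi := Real.pi_pos
  rw [cylVol, integral_fun_fst]
  simp only [measureReal_restrict_apply_univ, smul_eq_mul, Real.volume_real_Ioo]
  rw [max_eq_left (by linarith)]
  ring

theorem ae_fst_ne (t : ℝ) : ∀ᵐ p ∂cylVol, p.1 ≠ t :=
  (Measure.quasiMeasurePreserving_fst (μ := (volume : Measure ℝ))
    (ν := (volume : Measure ℝ).restrict (Ioo (-Real.pi) Real.pi))).ae (Measure.ae_ne volume t)

/-- The distance function `cosh (t - t') - cos (θ - θ')` of the cylinder. -/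
def gap (p q : ℝ × ℝ) : ℝ := Real.cosh (p.1 - q.1) - Real.cos (p.2 - q.2)

theorem gap_cylRefl_cylRefl (a : ℝ) (p q : ℝ × ℝ) :
    gap (cylRefl a p) (cylRefl a q) = gap p q := by
  unfold gap cylRefl
  rw [← Real.cosh_neg]
  ring_nf

theorem gap_pos {p q : ℝ × ℝ} (h : q.1 ≠ p.1) : 0 < gap p q := by
  have := Real.one_lt_cosh.mpr (sub_ne_zero.mpr h.symm)
  have := Real.cos_le_one (p.2 - q.2)
  unfold gap
  linarith

theorem sq_div_two_le_cosh_sub_one (s : ℝ) : s ^ 2 / 2 ≤ Real.cosh s - 1 := by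
  have h1 : Real.cosh s = 1 + 2 * Real.sinh (s / 2) ^ 2 := by
    have h2 := Real.cosh_two_mul (s / 2)
    have h3 := Real.cosh_sq (s / 2)
    rw [mul_div_cancel₀ s (by norm_num : (2 : ℝ) ≠ 0)] at h2
    linarith
  have h4 : (s / 2) ^ 2 ≤ Real.sinh (s / 2) ^ 2 := by
    rw [← sq_abs, ← sq_abs (Real.sinh (s / 2)), Real.abs_sinh]
    gcongr
    exact Real.self_le_sinh_iff.mpr (abs_nonneg _)
  nlinarith

/-- The reflected kernel `log (gap (p^a) q / gap p q)`. -/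
def reflKer (a : ℝ) (p q : ℝ × ℝ) : ℝ := Real.log (gap (cylRefl a p) q) - Real.log (gap p q)

theorem reflKer_cylRefl (a : ℝ) (p q : ℝ × ℝ) : reflKer a p (cylRefl a q) = -reflKer a p q := by
  unfold reflKer
  rw [gap_cylRefl_cylRefl, ← gap_cylRefl_cylRefl a p (cylRefl a q), cylRefl_cylRefl]
  ring

/-- Reflecting one of two points lying on the same side of `t = a` moves it away from the other.
This sign of the kernel plays the part of the maximum principle. -/
theorem gap_le_gap_cylRefl {a : ℝ} {p q : ℝ × ℝ} (hp : a ≤ p.1) (hq : a ≤ q.1) :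
    gap p q ≤ gap (cylRefl a p) q := by
  unfold gap cylRefl
  dsimp only
  gcongr
  rw [Real.cosh_le_cosh]
  exact sq_le_sq.mp (by nlinarith)

theorem reflKer_nonneg {a : ℝ} {p q : ℝ × ℝ} (hp : a ≤ p.1) (hq : a ≤ q.1) (hne : q.1 ≠ p.1) :
    0 ≤ reflKer a p q :=
  sub_nonneg.mpr (Real.log_le_log (gap_pos hne) (gap_le_gap_cylRefl hp hq))

theorem reflKer_pos {a : ℝ} {p q : ℝ × ℝ} (hp : a < p.1) (hq : a < q.1) (hne : q.1 ≠ p.1) :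
    0 < reflKer a p q := by
  refine sub_pos.mpr (Real.log_lt_log (gap_pos hne) ?_)
  unfold gap cylRefl
  dsimp only
  gcongr
  rw [Real.cosh_lt_cosh]
  exact sq_lt_sq.mp (by nlinarith)

/-- The singular weight `|s|^(-1/4)`. -/
def sing (s : ℝ) : ℝ := |s| ^ (-(1 / 4) : ℝ)

theorem sing_nonneg (s : ℝ) : 0 ≤ sing s := Real.rpow_nonneg (abs_nonneg s) _

theorem sing_pow_eight (s : ℝ) : sing s ^ 8 = (s ^ 2)⁻¹ := by
  unfold sing
  rw [← Real.rpow_natCast, ← Real.rpow_mul (abs_nonneg s), ← sq_abs s,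
    ← Real.rpow_natCast (|s|) 2, ← Real.rpow_neg (abs_nonneg s)]
  norm_num

theorem sing_pow_three (s : ℝ) : sing s ^ 3 = |s| ^ (-(3 / 4) : ℝ) := by
  unfold sing
  rw [← Real.rpow_natCast, ← Real.rpow_mul (abs_nonneg s)]
  norm_num

/-- With `s = p.1 - q.1`, the reflected gap is at most `2 e^{2(q.1 - a)} cosh s` and the gap is at
least `cosh s - 1`. The logarithm of the quotient grows linearly in `q.1 - a`, uniformly in `p`, up
to an integrable singularity in `s` alone. -/
theorem reflKer_le {a : ℝ} {p q : ℝ × ℝ} (hq : a ≤ q.1) (hne : q.1 ≠ p.1) :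
    reflKer a p q ≤ 1 + 2 * (q.1 - a) + 5 * sing (p.1 - q.1) ^ 2 := by
  set s := p.1 - q.1 with hs
  have hs0 : s ≠ 0 := sub_ne_zero.mpr hne.symm
  have hs2 : 0 < s ^ 2 := by positivity
  have hc := Real.cosh_pos s
  have hcs := sq_div_two_le_cosh_sub_one s
  have h1 : gap (cylRefl a p) q ≤ 2 * (Real.exp (2 * (q.1 - a)) * Real.cosh s) := by
    have e : Real.cosh ((cylRefl a p).1 - q.1) = Real.cosh (s + 2 * (q.1 - a)) := by
      rw [← Real.cosh_neg, hs, cylRefl]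
      ring_nf
    have h2 : Real.cosh (s + 2 * (q.1 - a)) ≤ Real.exp (2 * (q.1 - a)) * Real.cosh s := by
      rw [Real.cosh_eq, Real.cosh_eq, neg_add, Real.exp_add, Real.exp_add]
      have h3 : Real.exp (-(2 * (q.1 - a))) ≤ Real.exp (2 * (q.1 - a)) :=
        Real.exp_le_exp.mpr (by linarith)
      have := Real.exp_pos (-s)
      nlinarith
    have h4 := Real.neg_one_le_cos ((cylRefl a p).2 - q.2)
    have h5 := Real.one_le_cosh (s + 2 * (q.1 - a))
    unfold gap
    rw [e]
    linarith
  have h2 : Real.cosh s - 1 ≤ gap p q := by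
    unfold gap
    linarith [Real.cos_le_one (p.2 - q.2)]
  have hpos : 0 < Real.cosh s - 1 := by nlinarith
  have h3 : Real.cosh s / (Real.cosh s - 1) ≤ 1 + 2 * sing s ^ 8 := by
    rw [sing_pow_eight, div_le_iff₀ hpos]
    have : 1 ≤ 2 * (s ^ 2)⁻¹ * (Real.cosh s - 1) := by
      rw [mul_comm 2, mul_assoc, ← div_eq_inv_mul, le_div_iff₀ hs2]
      linarith
    linarith
  -- The constant `5/4` is chosen so that `(5/4)^4 ≥ 2`; the fourth power becomes a factor `4` after
  -- taking logarithms.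
  have h4 : 1 + 2 * sing s ^ 8 ≤ (1 + 5 / 4 * sing s ^ 2) ^ 4 := by
    have := sing_nonneg s
    nlinarith [pow_nonneg this 2, pow_nonneg this 4, pow_nonneg this 6, pow_nonneg this 8]
  have h5 : Real.log (Real.cosh s / (Real.cosh s - 1)) ≤ 5 * sing s ^ 2 := by
    have hx : 0 < 1 + 5 / 4 * sing s ^ 2 := by positivity
    calc Real.log (Real.cosh s / (Real.cosh s - 1))
        ≤ Real.log ((1 + 5 / 4 * sing s ^ 2) ^ 4) :=
          Real.log_le_log (by positivity) (h3.trans h4)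
      _ = 4 * Real.log (1 + 5 / 4 * sing s ^ 2) := by rw [Real.log_pow]; norm_num
      _ ≤ 4 * (5 / 4 * sing s ^ 2) := by
          gcongr
          linarith [Real.log_le_sub_one_of_pos hx]
      _ = _ := by ring
  rw [Real.log_div hc.ne' hpos.ne'] at h5
  have h6 : Real.log (Real.cosh s - 1) ≤ Real.log (gap p q) := Real.log_le_log hpos h2
  have h7 : Real.log (gap (cylRefl a p) q) ≤ 1 + 2 * (q.1 - a) + Real.log (Real.cosh s) := by
    rcases lt_or_ge 0 (gap (cylRefl a p) q) with hg | hg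
    · refine (Real.log_le_log hg h1).trans ?_
      rw [Real.log_mul (by norm_num) (by positivity), Real.log_mul (Real.exp_pos _).ne' hc.ne',
        Real.log_exp]
      linarith [Real.log_two_lt_d9]
    -- The reflected point may coincide with `q`; the logarithm then has its default value `0`.
    · have h8 : gap (cylRefl a p) q = 0 := by
        refine le_antisymm hg ?_
        unfold gap
        linarith [Real.one_le_cosh ((cylRefl a p).1 - q.1), Real.cos_le_one ((cylRefl a p).2 - q.2)]
      rw [h8, Real.log_zero]
      linarith [Real.log_nonneg (Real.one_le_cosh s)]
  unfold reflKer
  linarith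

/-- Trades a small multiple of a stronger, still integrable singularity for a bounded term, so that
the singular part of the kernel can be made small without using the smallness of the excess set. -/
theorem sq_le_mul_pow_three_add {x ε : ℝ} (hx : 0 ≤ x) (hε : 0 < ε) :
    x ^ 2 ≤ ε * x ^ 3 + 1 / ε ^ 2 := by
  have h : (ε * x) ^ 2 ≤ (ε * x) ^ 3 + 1 := by
    have hy : 0 ≤ ε * x := by positivity
    rcases le_total (ε * x) 1 with h1 | h1
    · nlinarith [pow_nonneg hy 3]
    · nlinarith [mul_nonneg (sq_nonneg (ε * x)) (sub_nonneg.mpr h1)]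
  have e : ε * x ^ 3 + 1 / ε ^ 2 - x ^ 2 = ((ε * x) ^ 3 + 1 - (ε * x) ^ 2) / ε ^ 2 := by
    field_simp
  have : 0 ≤ ((ε * x) ^ 3 + 1 - (ε * x) ^ 2) / ε ^ 2 := div_nonneg (by linarith) (by positivity)
  linarith

/-- The exponent is `-3/4 > -1`. -/
theorem integrable_indicator_sing :
    Integrable ((Ioc (-1 : ℝ) 1).indicator fun s => sing s ^ 3) := by
  rw [integrable_indicator_iff measurableSet_Ioc]
  have h := (intervalIntegral.intervalIntegrable_cpow' (a := -1) (b := 1)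
    (r := ((-(3 / 4) : ℝ) : ℂ)) (by rw [Complex.ofReal_re]; norm_num)).norm
  rw [intervalIntegrable_iff_integrableOn_Ioc_of_le (by norm_num)] at h
  refine h.congr_fun (fun s _ => ?_) measurableSet_Ioc
  dsimp only
  rw [Complex.norm_cpow_real, Complex.norm_real, Real.norm_eq_abs, sing_pow_three]

theorem sing_pow_three_le (s : ℝ) :
    sing s ^ 3 ≤ (Ioc (-1 : ℝ) 1).indicator (fun s => sing s ^ 3) s + 1 := by
  by_cases hs : s ∈ Ioc (-1 : ℝ) 1
  · rw [indicator_of_mem hs]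
    linarith
  · rw [indicator_of_notMem hs, zero_add, sing_pow_three]
    refine Real.rpow_le_one_of_one_le_of_nonpos ?_ (by norm_num)
    rw [le_abs]
    by_contra hcon
    push Not at hcon
    exact hs ⟨by linarith [hcon.2], hcon.1.le⟩

theorem measurable_sing : Measurable sing := by
  unfold sing
  fun_prop

/-- The singular weights centred at the various points are uniformly integrable. -/
theorem exists_integral_sing_le : ∃ C : ℝ, 0 < C ∧ ∀ t : ℝ,
    Integrable (fun q : ℝ × ℝ => sing (t - q.1) ^ 3 * Real.exp (-|q.1|)) cylVol ∧
      ∫ q, sing (t - q.1) ^ 3 * Real.exp (-|q.1|) ∂cylVol ≤ C := by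
  have hpi := Real.pi_pos
  set χ := (Ioc (-1 : ℝ) 1).indicator fun s => sing s ^ 3 with hχ
  have hχ0 : ∀ s, 0 ≤ χ s := fun s => indicator_nonneg (fun s _ => pow_nonneg (sing_nonneg s) 3) s
  have he : Integrable fun s : ℝ => Real.exp (-|s|) := by
    have := integrable_exp_neg_mul_abs zero_lt_one
    simpa using this
  -- Near the singularity the exponential is bounded by `1`; away from it the singular weight is.
  have hb : ∀ t s : ℝ, sing (t - s) ^ 3 * Real.exp (-|s|) ≤ χ (t - s) + Real.exp (-|s|) := by
    intro t s
    have h1 := sing_pow_three_le (t - s)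
    have h2 : Real.exp (-|s|) ≤ 1 := Real.exp_le_one_iff.mpr (by linarith [abs_nonneg s])
    have h3 := Real.exp_pos (-|s|)
    have h4 := hχ0 (t - s)
    calc sing (t - s) ^ 3 * Real.exp (-|s|) ≤ (χ (t - s) + 1) * Real.exp (-|s|) := by gcongr
      _ ≤ _ := by nlinarith
  have hi : ∀ t : ℝ, Integrable fun s : ℝ => χ (t - s) + Real.exp (-|s|) := fun t =>
    (integrable_indicator_sing.comp_sub_left t).add he
  refine ⟨2 * Real.pi * ((∫ s, χ s) + ∫ s : ℝ, Real.exp (-|s|)) + 1, ?_, fun t => ?_⟩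
  · have h1 : 0 ≤ ∫ s, χ s := integral_nonneg hχ0
    have h2 : 0 ≤ ∫ s : ℝ, Real.exp (-|s|) := integral_nonneg fun s => (Real.exp_pos _).le
    positivity
  · have hint : Integrable (fun s : ℝ => sing (t - s) ^ 3 * Real.exp (-|s|)) := by
      refine (hi t).mono' ?_ (Eventually.of_forall fun s => ?_)
      · have := measurable_sing
        exact Measurable.aestronglyMeasurable (by fun_prop)
      · rw [Real.norm_eq_abs, abs_of_nonneg (mul_nonneg (pow_nonneg (sing_nonneg _) 3)
          (Real.exp_pos _).le)]
        exact hb t s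
    refine ⟨integrable_cylVol_fst hint, ?_⟩
    rw [integral_cylVol_fst (fun s => sing (t - s) ^ 3 * Real.exp (-|s|))]
    have h1 := integral_mono hint (hi t) (hb t)
    rw [integral_add (integrable_indicator_sing.comp_sub_left t) he,
      integral_sub_left_eq_self (fun s => χ s) volume t] at h1
    nlinarith

end CylinderKernel


/-! ### The conformal factor on the cylinder and the smallness principle -/

section MovingPlanes

open Filter Topology

/-- The conformal factor of the metric `exp (2 w) g₀` with respect to the flat cylinder. -/
def cylFactor (w : Sph 2 → ℝ) (p : ℝ × ℝ) : ℝ := w (cyl p) - Real.log (Real.cosh p.1)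

theorem continuous_cylFactor {w : Sph 2 → ℝ} (hw : Continuous w) : Continuous (cylFactor w) := by
  have hc := continuous_cyl
  have h1 : Continuous fun p : ℝ × ℝ => Real.log (Real.cosh p.1) :=
    (Real.continuous_cosh.comp continuous_fst).log fun p => (Real.cosh_pos _).ne'
  exact (hw.comp hc).sub h1

/-- Subtracting `log cosh t` absorbs the density of the round measure, so `exp (2 * cylFactor w)` is
the area density relative to the flat cylinder. -/
theorem exp_two_mul_cylFactor (w : Sph 2 → ℝ) (p : ℝ × ℝ) :
    Real.exp (2 * cylFactor w p) = (Real.cosh p.1 ^ 2)⁻¹ * Real.exp (2 * w (cyl p)) := by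
  have hc := Real.cosh_pos p.1
  have e : 2 * cylFactor w p = 2 * w (cyl p) - Real.log (Real.cosh p.1 ^ 2) := by
    rw [cylFactor, Real.log_pow]
    push_cast
    ring
  rw [e, Real.exp_sub, Real.exp_log (by positivity), div_eq_inv_mul]

/-- On the cylinder the antipodal map is the reflection in the equator composed with a half turn. -/
theorem neg_cyl (t θ : ℝ) : -cyl (t, θ) = cyl (-t, θ + Real.pi) := by
  ext i
  rw [coe_cyl]
  change -(cyl (t, θ) : Amb 2) i = _
  rw [coe_cyl]
  fin_cases i <;> simp [neg_div]

theorem cylFactor_neg {w : Sph 2 → ℝ} (heven : ∀ x, w (-x) = w x) (t θ : ℝ) :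
    cylFactor w (-t, θ + Real.pi) = cylFactor w (t, θ) := by
  unfold cylFactor
  rw [← neg_cyl, heven, Real.cosh_neg]

theorem cylFactor_add_two_pi (w : Sph 2 → ℝ) (t θ : ℝ) :
    cylFactor w (t, θ + 2 * Real.pi) = cylFactor w (t, θ) := by
  have : cyl (t, θ + 2 * Real.pi) = cyl (t, θ) := by
    ext1
    rw [coe_cyl, coe_cyl, Real.cos_add_two_pi, Real.sin_add_two_pi]
  unfold cylFactor
  rw [this]

variable {w : Sph 2 → ℝ}

theorem exp_two_mul_cylFactor_le {M : ℝ} (hM : ∀ x, Real.exp (2 * w x) ≤ M) (p : ℝ × ℝ) :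
    Real.exp (2 * cylFactor w p) ≤ 4 * M * Real.exp (-(2 * |p.1|)) := by
  have hM0 : 0 < M := (Real.exp_pos _).trans_le (hM (cyl p))
  have h3 : Real.exp |p.1| ≤ 2 * Real.cosh p.1 := by
    rw [← Real.cosh_abs, Real.cosh_eq]
    have := Real.exp_pos (-|p.1|)
    linarith
  rw [exp_two_mul_cylFactor]
  calc (Real.cosh p.1 ^ 2)⁻¹ * Real.exp (2 * w (cyl p))
      ≤ ((Real.exp |p.1| / 2) ^ 2)⁻¹ * M := by
        gcongr
        · linarith
        · exact hM _
    _ = 4 * M * Real.exp (-(2 * |p.1|)) := by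
        rw [Real.exp_neg, two_mul |p.1|, Real.exp_add]
        field_simp
        norm_num

theorem integrable_exp_cylFactor (hw : Continuous w) :
    Integrable (fun p => Real.exp (2 * cylFactor w p)) cylVol := by
  have hc : Continuous fun x => Real.exp (2 * w x) := by fun_prop
  have h := (integrable_sphVol_two hc.measurable).mp (integrable_of_continuous hc)
  simpa only [exp_two_mul_cylFactor] using h

theorem integral_exp_cylFactor (hw : IsLiouville w) :
    ∫ p, Real.exp (2 * cylFactor w p) ∂cylVol = 4 * Real.pi := by
  have hw' := hw.continuous
  have hc : Continuous fun x => Real.exp (2 * w x) := by fun_prop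
  rw [← hw.mass, integral_sphVol_two hc.measurable]
  simp only [exp_two_mul_cylFactor]

theorem log_chord_cyl {p q : ℝ × ℝ} (h : q.1 ≠ p.1) : Real.log (chord (cyl p) (cyl q)) =
    Real.log (gap p q) - Real.log (Real.cosh p.1) - Real.log (Real.cosh q.1) := by
  have h1 := (Real.cosh_pos p.1).ne'
  have h2 := (Real.cosh_pos q.1).ne'
  have h3 : chord (cyl p) (cyl q) = gap p q / (Real.cosh p.1 * Real.cosh q.1) :=
    one_sub_inner_cyl p q
  rw [h3, Real.log_div (gap_pos h).ne' (mul_ne_zero h1 h2), Real.log_mul h1 h2]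
  ring

theorem integrable_log_chord_mul_exp (hw : Continuous w) (x : Sph 2) :
    Integrable (fun y => Real.log (chord x y) * Real.exp (2 * w y)) (sphVol 2) := by
  have hc : Continuous fun x => Real.exp (2 * w x) := by fun_prop
  obtain ⟨B, -, hB⟩ := exists_bound_of_continuous hc
  exact Integrable.mul_bdd (c := B) (integrable_log_chord (lintegral_kap_sphVol_ne_top x))
    hc.aestronglyMeasurable (Eventually.of_forall hB)

/-- The integral equation for the difference of the conformal factor and its reflection. -/
theorem cylFactor_sub_cylRefl (hw : IsLiouville w) (a : ℝ) (p : ℝ × ℝ) :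
    Integrable (fun q => reflKer a p q * Real.exp (2 * cylFactor w q)) cylVol ∧
    4 * Real.pi * (cylFactor w p - cylFactor w (cylRefl a p)) =
      ∫ q, reflKer a p q * Real.exp (2 * cylFactor w q) ∂cylVol := by
  have hpi := Real.pi_pos
  obtain ⟨c, hc⟩ := hw.eq
  have hexp : Continuous fun x => Real.exp (2 * w x) := by
    have := hw.continuous
    fun_prop
  -- The `log cosh` terms contribute `k` times the total mass, and they match the difference of the
  -- conformal factors exactly because that mass is `4π`.
  set k := Real.log (Real.cosh (cylRefl a p).1) - Real.log (Real.cosh p.1) with hk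
  have hm : ∀ x : Sph 2, Measurable fun y => Real.log (chord x y) * Real.exp (2 * w y) := fun x =>
    (measurable_chord_right x).log.mul hexp.measurable
  have i1 := integrable_log_chord_mul_exp hw.continuous (cyl (cylRefl a p))
  have i2 := integrable_log_chord_mul_exp hw.continuous (cyl p)
  have j1 := (integrable_sphVol_two (hm _)).mp i1
  have j2 := (integrable_sphVol_two (hm _)).mp i2
  have j3 := (integrable_exp_cylFactor hw.continuous).const_mul k
  have hae : (fun q => (Real.cosh q.1 ^ 2)⁻¹ *
      (Real.log (chord (cyl (cylRefl a p)) (cyl q)) * Real.exp (2 * w (cyl q))) -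
      (Real.cosh q.1 ^ 2)⁻¹ * (Real.log (chord (cyl p) (cyl q)) * Real.exp (2 * w (cyl q))) +
      k * Real.exp (2 * cylFactor w q)) =ᵐ[cylVol]
      fun q => reflKer a p q * Real.exp (2 * cylFactor w q) := by
    filter_upwards [ae_fst_ne p.1, ae_fst_ne (cylRefl a p).1] with q h1 h2
    rw [log_chord_cyl h1, log_chord_cyl h2, exp_two_mul_cylFactor, reflKer, hk]
    ring
  refine ⟨((j1.sub j2).add j3).congr hae, ?_⟩
  rw [← integral_congr_ae hae, integral_add (by exact j1.sub j2) j3, integral_sub j1 j2,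
    ← integral_sphVol_two (hm _), ← integral_sphVol_two (hm _), integral_const_mul,
    integral_exp_cylFactor hw]
  unfold cylFactor
  rw [hc (cyl p), hc (cyl (cylRefl a p)), hk]
  field_simp
  ring

/-- The previous identity is added to its transform under the reflection of `q`, which changes the
sign of the kernel. The new integrand is invariant under that reflection, so its sign need only be
studied beyond `t = a`. -/
theorem integral_reflKer_mul_sub (hw : IsLiouville w) (a : ℝ) (p : ℝ × ℝ) :
    Integrable (fun q => reflKer a p q *
      (Real.exp (2 * cylFactor w q) - Real.exp (2 * cylFactor w (cylRefl a q)))) cylVol ∧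
    8 * Real.pi * (cylFactor w p - cylFactor w (cylRefl a p)) =
      ∫ q, reflKer a p q *
        (Real.exp (2 * cylFactor w q) - Real.exp (2 * cylFactor w (cylRefl a q))) ∂cylVol := by
  obtain ⟨h1, h2⟩ := cylFactor_sub_cylRefl hw a p
  have h3 := integrable_cylRefl a h1
  have h4 := integral_cylRefl a fun q => reflKer a p q * Real.exp (2 * cylFactor w q)
  have e : ∀ q, reflKer a p q *
      (Real.exp (2 * cylFactor w q) - Real.exp (2 * cylFactor w (cylRefl a q))) =
      reflKer a p q * Real.exp (2 * cylFactor w q) +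
        reflKer a p (cylRefl a q) * Real.exp (2 * cylFactor w (cylRefl a q)) := fun q => by
    rw [reflKer_cylRefl]
    ring
  simp only [e]
  refine ⟨h1.add h3, ?_⟩
  rw [integral_add h1 h3, h4, ← h2]
  ring

/-- The part of the half cylinder beyond `t = a` where the conformal factor exceeds its
reflection. -/
def excess (w : Sph 2 → ℝ) (a : ℝ) : Set (ℝ × ℝ) :=
  {q | a < q.1 ∧ cylFactor w (cylRefl a q) < cylFactor w q}

theorem measurableSet_excess (hw : Continuous w) (a : ℝ) : MeasurableSet (excess w a) := by
  have h1 := continuous_cylFactor hw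
  have h2 := h1.comp (continuous_cylRefl a)
  exact (isOpen_lt continuous_const continuous_fst).measurableSet.inter
    (isOpen_lt h2 h1).measurableSet

theorem integrable_exp_neg_abs_fst :
    Integrable (fun q : ℝ × ℝ => Real.exp (-|q.1|)) cylVol := by
  have := integrable_cylVol_fst (integrable_exp_neg_mul_abs zero_lt_one)
  simpa using this

/-- Outside the excess set the left side is not positive. Inside it, `1 - e^{-x} ≤ x` bounds the
difference by `2 H e^{2 cylFactor}`, at most `8 H M e^{-2 q.1}`; one factor `e^{-q.1}` pays for the
linear growth of the kernel, and the other remains as an integrable weight. -/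
theorem reflKer_mul_sub_le {M H ε a : ℝ} (hM : ∀ x, Real.exp (2 * w x) ≤ M) (hε : 0 < ε)
    (ha : 0 ≤ a) (hH0 : 0 ≤ H)
    (hH : ∀ p : ℝ × ℝ, a ≤ p.1 → cylFactor w p - cylFactor w (cylRefl a p) ≤ H)
    {p q : ℝ × ℝ} (hp : a ≤ p.1) (hq : a < q.1) (hne : q.1 ≠ p.1) :
    reflKer a p q * (Real.exp (2 * cylFactor w q) - Real.exp (2 * cylFactor w (cylRefl a q))) ≤
      H * ((excess w a).indicator (fun q => 8 * M * (2 + 5 / ε ^ 2) * Real.exp (-|q.1|)) q +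
        40 * M * ε * (sing (p.1 - q.1) ^ 3 * Real.exp (-|q.1|))) := by
  have hM0 : 0 < M := (Real.exp_pos _).trans_le (hM (cyl p))
  have hL0 := reflKer_nonneg hp hq.le hne
  have hs := sing_nonneg (p.1 - q.1)
  by_cases hex : cylFactor w (cylRefl a q) < cylFactor w q
  · rw [indicator_of_mem (show q ∈ excess w a from ⟨hq, hex⟩)]
    have hq0 : 0 < q.1 := ha.trans_lt hq
    have hL := reflKer_le hq.le hne
    have hρ := exp_two_mul_cylFactor_le hM q
    rw [abs_of_pos hq0] at hρ ⊢
    have h1 : Real.exp (2 * cylFactor w q) - Real.exp (2 * cylFactor w (cylRefl a q)) ≤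
        2 * H * Real.exp (2 * cylFactor w q) := by
      have h2 := Real.add_one_le_exp (2 * cylFactor w (cylRefl a q) - 2 * cylFactor w q)
      have h3 : Real.exp (2 * cylFactor w (cylRefl a q)) = Real.exp (2 * cylFactor w q) *
          Real.exp (2 * cylFactor w (cylRefl a q) - 2 * cylFactor w q) := by
        rw [← Real.exp_add]
        congr 1
        ring
      have h4 := hH q hq.le
      rw [h3]
      nlinarith [Real.exp_pos (2 * cylFactor w q)]
    have h5 : 1 + 2 * (q.1 - a) ≤ 2 * Real.exp q.1 := by
      linarith [Real.add_one_le_exp q.1]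
    have h6 := sq_le_mul_pow_three_add hs hε
    have h7 : 1 ≤ Real.exp q.1 := Real.one_le_exp hq0.le
    have h8 : reflKer a p q ≤
        (2 + 5 / ε ^ 2 + 5 * ε * sing (p.1 - q.1) ^ 3) * Real.exp q.1 := by
      have h9 : 5 * sing (p.1 - q.1) ^ 2 ≤ 5 / ε ^ 2 + 5 * ε * sing (p.1 - q.1) ^ 3 := by
        have : 5 / ε ^ 2 = 5 * (1 / ε ^ 2) := by ring
        rw [this]
        linarith
      have h10 : 0 ≤ 5 / ε ^ 2 + 5 * ε * sing (p.1 - q.1) ^ 3 := by positivity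
      nlinarith
    calc reflKer a p q *
          (Real.exp (2 * cylFactor w q) - Real.exp (2 * cylFactor w (cylRefl a q)))
        ≤ reflKer a p q * (2 * H * Real.exp (2 * cylFactor w q)) := by gcongr
      _ ≤ (2 + 5 / ε ^ 2 + 5 * ε * sing (p.1 - q.1) ^ 3) * Real.exp q.1 *
          (2 * H * (4 * M * Real.exp (-(2 * q.1)))) := by gcongr
      _ = H * (8 * M * (2 + 5 / ε ^ 2) * (Real.exp q.1 * Real.exp (-(2 * q.1))) +
          40 * M * ε * (sing (p.1 - q.1) ^ 3 * (Real.exp q.1 * Real.exp (-(2 * q.1))))) := by ring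
      _ = _ := by
          rw [← Real.exp_add]
          ring_nf
  · refine le_trans (mul_nonpos_of_nonneg_of_nonpos hL0 ?_) ?_
    · rw [sub_nonpos, Real.exp_le_exp]
      linarith
    · refine mul_nonneg hH0 (add_nonneg (indicator_nonneg (fun q _ => ?_) _) ?_) <;> positivity

/-- If the excess set has small mass, it is empty. -/
theorem exists_excess_small (hw : IsLiouville w) : ∃ δ : ℝ, 0 < δ ∧ ∀ a : ℝ, 0 ≤ a →
    ∫ q, (excess w a).indicator (fun q => Real.exp (-|q.1|)) q ∂cylVol ≤ δ →
      ∀ p : ℝ × ℝ, a ≤ p.1 → cylFactor w p ≤ cylFactor w (cylRefl a p) := by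
  have hpi := Real.pi_pos
  have hexp : Continuous fun x => Real.exp (2 * w x) := by
    have := hw.continuous
    fun_prop
  obtain ⟨M, -, hM⟩ := exists_bound_of_continuous hexp
  replace hM : ∀ x, Real.exp (2 * w x) ≤ M := fun x => (le_abs_self _).trans (hM x)
  have hM0 : 0 < M := (Real.exp_pos _).trans_le (hM north)
  obtain ⟨B, hB0, hB⟩ := exists_bound_of_continuous hw.continuous
  obtain ⟨C, hC0, hC⟩ := exists_integral_sing_le
  -- With this `ε` the singular term integrates to at most `π`, and with excess mass at most `π / k`
  -- so does the other term.
  set ε := Real.pi / (40 * M * C) with hε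
  have hε0 : 0 < ε := by positivity
  set k := 8 * M * (2 + 5 / ε ^ 2) with hk
  have hk0 : 0 < k := by positivity
  refine ⟨Real.pi / k, by positivity, fun a ha hsmall => ?_⟩
  -- A contraction: an upper bound `H` for the excess improves to `H / 2`. Each half of the cylinder
  -- contributes at most `2π H`, against the factor `8π` of the integral identity.
  have hstep : ∀ H : ℝ, 0 ≤ H →
      (∀ p : ℝ × ℝ, a ≤ p.1 → cylFactor w p - cylFactor w (cylRefl a p) ≤ H) →
      ∀ p : ℝ × ℝ, a ≤ p.1 → cylFactor w p - cylFactor w (cylRefl a p) ≤ H / 2 := by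
    intro H hH0 hH p hp
    obtain ⟨hi, heq⟩ := integral_reflKer_mul_sub hw a p
    set Q : ℝ × ℝ → ℝ := fun q => (excess w a).indicator (fun q => k * Real.exp (-|q.1|)) q +
        40 * M * ε * (sing (p.1 - q.1) ^ 3 * Real.exp (-|q.1|)) with hQ
    have hQ0 : ∀ q, 0 ≤ Q q := fun q => by
      refine add_nonneg (indicator_nonneg (fun q _ => ?_) _) ?_
      · positivity
      · have := sing_nonneg (p.1 - q.1)
        positivity
    have hind : (fun q : ℝ × ℝ => (excess w a).indicator (fun q => k * Real.exp (-|q.1|)) q) =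
        fun q => k * (excess w a).indicator (fun q => Real.exp (-|q.1|)) q := by
      funext q
      rw [indicator_const_mul]
    have q1 : Integrable (fun q : ℝ × ℝ =>
        (excess w a).indicator (fun q => k * Real.exp (-|q.1|)) q) cylVol :=
      (integrable_exp_neg_abs_fst.const_mul k).indicator (measurableSet_excess hw.continuous a)
    have q2 := (hC p.1).1.const_mul (40 * M * ε)
    have hQi : Integrable Q cylVol := q1.add q2
    have hQle : ∫ q, Q q ∂cylVol ≤ 2 * Real.pi := by
      rw [hQ, integral_add q1 q2, hind, integral_const_mul, integral_const_mul]
      have h1 : k * ∫ q, (excess w a).indicator (fun q => Real.exp (-|q.1|)) q ∂cylVol ≤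
          k * (Real.pi / k) := by gcongr
      have h2 : 40 * M * ε * ∫ q, sing (p.1 - q.1) ^ 3 * Real.exp (-|q.1|) ∂cylVol ≤
          40 * M * ε * C := by
        gcongr
        exact (hC p.1).2
      have h3 : k * (Real.pi / k) = Real.pi := by field_simp
      have h4 : 40 * M * ε * C = Real.pi := by
        rw [hε]
        field_simp
      linarith
    have hle : ∫ q, reflKer a p q * (Real.exp (2 * cylFactor w q) -
        Real.exp (2 * cylFactor w (cylRefl a q))) ∂cylVol ≤
        ∫ q, H * (Q q + Q (cylRefl a q)) ∂cylVol := by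
      refine integral_mono_ae hi ((hQi.add (integrable_cylRefl a hQi)).const_mul H) ?_
      filter_upwards [ae_fst_ne p.1, ae_fst_ne (2 * a - p.1), ae_fst_ne a] with q h1 h2 h3
      have hQq := hQ0 q
      have hQr := hQ0 (cylRefl a q)
      rcases lt_or_gt_of_ne h3 with hq | hq
      · have h4 : a < (cylRefl a q).1 := by
          unfold cylRefl
          dsimp only
          linarith
        have h5 : (cylRefl a q).1 ≠ p.1 := fun h => h2 (by
          unfold cylRefl at h
          dsimp only at h
          linarith)
        have h := reflKer_mul_sub_le hM hε0 ha hH0 hH hp h4 h5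
        rw [reflKer_cylRefl, cylRefl_cylRefl] at h
        change _ ≤ H * Q (cylRefl a q) at h
        nlinarith
      · have h := reflKer_mul_sub_le hM hε0 ha hH0 hH hp hq h1
        change _ ≤ H * Q q at h
        nlinarith
    rw [integral_const_mul, integral_add hQi (integrable_cylRefl a hQi), integral_cylRefl,
      ← heq] at hle
    have : 8 * Real.pi * (cylFactor w p - cylFactor w (cylRefl a p)) ≤ 8 * Real.pi * (H / 2) := by
      nlinarith
    exact le_of_mul_le_mul_left this (by positivity)
  -- The start `2 B` comes from the bound on `w`; the `log cosh` terms help, since for `a ≥ 0`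
  -- reflection does not increase `|t|` beyond the circle.
  have hiter : ∀ n : ℕ, ∀ p : ℝ × ℝ, a ≤ p.1 →
      cylFactor w p - cylFactor w (cylRefl a p) ≤ 2 * B * (1 / 2) ^ n := by
    intro n
    induction n with
    | zero =>
      intro p hp
      have h1 := (abs_le.mp (hB (cyl p))).2
      have h2 := (abs_le.mp (hB (cyl (cylRefl a p)))).1
      have h3 : Real.log (Real.cosh (cylRefl a p).1) ≤ Real.log (Real.cosh p.1) := by
        refine Real.log_le_log (Real.cosh_pos _) (Real.cosh_le_cosh.mpr ?_)
        unfold cylRefl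
        dsimp only
        rw [abs_of_nonneg (ha.trans hp), abs_le]
        constructor <;> linarith
      unfold cylFactor
      linarith
    | succ n ih =>
      intro p hp
      have := hstep _ (by positivity) ih p hp
      rw [pow_succ]
      linarith
  intro p hp
  have ht : Tendsto (fun n : ℕ => 2 * B * (1 / 2 : ℝ) ^ n) atTop (𝓝 (2 * B * 0)) :=
    (tendsto_pow_atTop_nhds_zero_of_lt_one (by norm_num) (by norm_num)).const_mul _
  have := ge_of_tendsto' ht fun n => hiter n p hp
  linarith

end MovingPlanes


/-! ### Moving planes: even solutions are constant -/

section Symmetry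

open Filter Topology

variable {w : Sph 2 → ℝ}

/-- The conformal factor beyond the circle `t = a` is dominated by its reflection. -/
def ReflDominated (w : Sph 2 → ℝ) (a : ℝ) : Prop :=
  ∀ p : ℝ × ℝ, a ≤ p.1 → cylFactor w p ≤ cylFactor w (cylRefl a p)

/-- Beyond the circle the two factors have opposite signs, and the product is invariant under
reflection of `q`. -/
theorem reflKer_mul_sub_nonpos {a : ℝ} (h : ReflDominated w a) {p q : ℝ × ℝ} (hp : a ≤ p.1)
    (h1 : q.1 ≠ p.1) (h2 : q.1 ≠ 2 * a - p.1) :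
    reflKer a p q *
      (Real.exp (2 * cylFactor w q) - Real.exp (2 * cylFactor w (cylRefl a q))) ≤ 0 := by
  have key : ∀ q : ℝ × ℝ, a ≤ q.1 → q.1 ≠ p.1 → reflKer a p q *
      (Real.exp (2 * cylFactor w q) - Real.exp (2 * cylFactor w (cylRefl a q))) ≤ 0 :=
    fun q hq hne => mul_nonpos_of_nonneg_of_nonpos (reflKer_nonneg hp hq hne) (by
      rw [sub_nonpos, Real.exp_le_exp]
      linarith [h q hq])
  rcases le_total a q.1 with hq | hq
  · exact key q hq h1
  · have h3 := key (cylRefl a q) (by unfold cylRefl; dsimp only; linarith) (fun h => h2 (by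
      unfold cylRefl at h; dsimp only at h; linarith))
    rw [reflKer_cylRefl, cylRefl_cylRefl] at h3
    linarith

/-- If equality occurs beyond the circle, the conformal factor is symmetric. -/
theorem cylFactor_cylRefl_of_eq (hw : IsLiouville w) {a : ℝ} (h : ReflDominated w a)
    {p : ℝ × ℝ} (hp : a < p.1) (heq : cylFactor w p = cylFactor w (cylRefl a p)) :
    ∀ q : ℝ × ℝ, q.2 ∈ Icc (-Real.pi) Real.pi → cylFactor w q = cylFactor w (cylRefl a q) := by
  have hpi := Real.pi_pos
  obtain ⟨hi, h0⟩ := integral_reflKer_mul_sub hw a p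
  rw [heq, sub_self, mul_zero] at h0
  have hnp : ∀ᵐ q ∂cylVol, 0 ≤ -(reflKer a p q *
      (Real.exp (2 * cylFactor w q) - Real.exp (2 * cylFactor w (cylRefl a q)))) := by
    filter_upwards [ae_fst_ne p.1, ae_fst_ne (2 * a - p.1)] with q h1 h2
    exact neg_nonneg.mpr (reflKer_mul_sub_nonpos h hp.le h1 h2)
  have hz := (integral_eq_zero_iff_of_nonneg_ae hnp hi.neg).mp (by
    rw [integral_neg, ← h0, neg_zero])
  have hae : ∀ᵐ q ∂cylVol, cylFactor w q = cylFactor w (cylRefl a q) := by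
    filter_upwards [hz, ae_fst_ne p.1, ae_fst_ne (2 * a - p.1), ae_fst_ne a] with q h1 h2 h3 h4
    have h5 : reflKer a p q ≠ 0 := by
      rcases lt_or_gt_of_ne h4 with hq | hq
      · have := reflKer_pos (q := cylRefl a q) hp (by unfold cylRefl; dsimp only; linarith)
          (fun h => h3 (by unfold cylRefl at h; dsimp only at h; linarith))
        rw [reflKer_cylRefl] at this
        linarith
      · exact (reflKer_pos hp hq h2).ne'
    have h6 := (mul_eq_zero.mp (neg_eq_zero.mp h1)).resolve_left h5
    rw [sub_eq_zero, Real.exp_eq_exp] at h6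
    linarith
  have hc := continuous_cylFactor hw.continuous
  have hc' := hc.comp (continuous_cylRefl a)
  have hvol : cylVol = (volume : Measure (ℝ × ℝ)).restrict
      (univ ×ˢ Ioo (-Real.pi) Real.pi) := by
    rw [Measure.volume_eq_prod, ← Measure.prod_restrict, Measure.restrict_univ]
    rfl
  rw [hvol] at hae
  -- The measure only sees angles in the open interval; continuity adds the boundary angles, which
  -- are used for half turns.
  have hon := Measure.eqOn_open_of_ae_eq hae (isOpen_univ.prod isOpen_Ioo) hc.continuousOn
    hc'.continuousOn
  intro q hq
  refine hon.closure hc hc' ?_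
  rw [closure_prod_eq, closure_univ, closure_Ioo (by linarith)]
  exact ⟨mem_univ _, hq⟩

/-- An even solution is not symmetric about a circle other than the equator. -/
theorem not_symmetric (hw : IsLiouville w) (heven : ∀ x, w (-x) = w x) {a : ℝ} (ha : 0 < a) :
    ¬ ∀ q : ℝ × ℝ, q.2 ∈ Icc (-Real.pi) Real.pi → cylFactor w q = cylFactor w (cylRefl a q) := by
  intro hsym
  have hpi := Real.pi_pos
  -- The reflection in `t = a` followed by the antipodal map is the translation by `2a` combined
  -- with a half turn; done twice, it gives the period `4a`.
  have h1 : ∀ t, cylFactor w (t + 2 * a, Real.pi) = cylFactor w (t, 0) := fun t => by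
    rw [hsym _ ⟨by linarith, le_rfl⟩, ← cylFactor_neg heven t 0, cylRefl]
    congr 2 <;> ring
  have h2 : ∀ t, cylFactor w (t + 2 * a, 0) = cylFactor w (t, Real.pi) := fun t => by
    rw [hsym _ ⟨by linarith, hpi.le⟩, ← cylFactor_neg heven t Real.pi, cylRefl,
      ← cylFactor_add_two_pi w _ 0]
    congr 2 <;> ring
  have h3 : ∀ n : ℕ, cylFactor w (4 * a * n, 0) = cylFactor w (0, 0) := by
    intro n
    induction n with
    | zero => simp
    | succ n ih =>
      rw [← ih, ← h1 (4 * a * n), ← h2 (4 * a * n + 2 * a)]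
      congr 2
      push_cast
      ring
  -- Periodicity in `t` is impossible, because the conformal factor tends to `-∞` like `-log cosh
  -- t`.
  obtain ⟨B, -, hB⟩ := exists_bound_of_continuous hw.continuous
  have h4 : ∀ n : ℕ, 4 * a * n ≤ B + Real.log 2 - cylFactor w (0, 0) := by
    intro n
    have hcosh : Real.exp (4 * a * n) ≤ 2 * Real.cosh (4 * a * n) := by
      rw [Real.cosh_eq]
      linarith [Real.exp_pos (-(4 * a * n))]
    have h5 := Real.log_le_log (Real.exp_pos _) hcosh
    rw [Real.log_exp, Real.log_mul (by norm_num) (Real.cosh_pos _).ne'] at h5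
    have h6 := (abs_le.mp (hB (cyl (4 * a * n, 0)))).2
    rw [← h3 n]
    unfold cylFactor
    linarith
  obtain ⟨n, hn⟩ := exists_nat_gt ((B + Real.log 2 - cylFactor w (0, 0)) / (4 * a))
  rw [div_lt_iff₀ (by positivity)] at hn
  linarith [h4 n]

theorem lt_cylRefl_of_reflDominated (hw : IsLiouville w) (heven : ∀ x, w (-x) = w x) {a : ℝ}
    (ha : 0 < a) (h : ReflDominated w a) {p : ℝ × ℝ} (hp : a < p.1) :
    cylFactor w p < cylFactor w (cylRefl a p) :=
  lt_of_le_of_ne (h p hp.le) fun heq =>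
    not_symmetric hw heven ha (cylFactor_cylRefl_of_eq hw h hp heq)

/-- By dominated convergence. It feeds the smallness principle both at the start, as `a → ∞`, and
when the circle is pushed further. -/
theorem tendsto_integral_excess (hw : Continuous w) {l : Filter ℝ} [l.IsCountablyGenerated]
    (h : ∀ᵐ q ∂cylVol, ∀ᶠ a in l, q ∉ excess w a) :
    Tendsto (fun a => ∫ q, (excess w a).indicator (fun q => Real.exp (-|q.1|)) q ∂cylVol) l
      (𝓝 0) := by
  have h0 : (0 : ℝ) = ∫ _, (0 : ℝ) ∂cylVol := by simp
  rw [h0]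
  refine tendsto_integral_filter_of_dominated_convergence (fun q : ℝ × ℝ => Real.exp (-|q.1|))
    (Eventually.of_forall fun a => (integrable_exp_neg_abs_fst.indicator
      (measurableSet_excess hw a)).aestronglyMeasurable)
    (Eventually.of_forall fun a => Eventually.of_forall fun q => ?_)
    integrable_exp_neg_abs_fst ?_
  · refine (norm_indicator_le_norm_self _ _).trans ?_
    rw [Real.norm_eq_abs, abs_of_pos (Real.exp_pos _)]
  · filter_upwards [h] with q hq
    refine tendsto_const_nhds.congr' ?_
    filter_upwards [hq] with a ha
    rw [indicator_of_notMem ha]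

/-- Each point leaves the excess set once `a` has passed it, so the excess mass is small for large
`a`. -/
theorem exists_reflDominated (hw : IsLiouville w) : ∃ a, 0 ≤ a ∧ ReflDominated w a := by
  obtain ⟨δ, hδ, h⟩ := exists_excess_small hw
  have ht := tendsto_integral_excess hw.continuous (l := atTop) (Eventually.of_forall fun q => by
    filter_upwards [eventually_ge_atTop q.1] with a ha hq
    exact not_lt.mpr ha hq.1)
  obtain ⟨a, h1, h2⟩ := ((ht.eventually (ge_mem_nhds hδ)).and (eventually_ge_atTop 0)).exists
  exact ⟨a, h2, h a h2 h1⟩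

/-- At a positive position domination is strict beyond the circle, by evenness. For a fixed point
strictness persists under small moves of the circle, so the excess mass tends to zero as `b`
approaches `a` from below. -/
theorem exists_reflDominated_lt (hw : IsLiouville w) (heven : ∀ x, w (-x) = w x) {a : ℝ}
    (ha : 0 < a) (hdom : ReflDominated w a) : ∃ b, 0 ≤ b ∧ b < a ∧ ReflDominated w b := by
  obtain ⟨δ, hδ, h⟩ := exists_excess_small hw
  have hc := continuous_cylFactor hw.continuous
  have ht := tendsto_integral_excess hw.continuous (l := 𝓝[<] a) (by
    filter_upwards [ae_fst_ne a] with q hq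
    rcases lt_or_gt_of_ne hq with hlt | hgt
    · filter_upwards [nhdsWithin_le_nhds (lt_mem_nhds hlt)] with b hb hmem
      exact lt_asymm hb hmem.1
    · have h1 := lt_cylRefl_of_reflDominated hw heven ha hdom hgt
      have h2 : Continuous fun b => cylFactor w (cylRefl b q) :=
        hc.comp (by unfold cylRefl; fun_prop)
      filter_upwards [nhdsWithin_le_nhds (h2.continuousAt.eventually (lt_mem_nhds h1))]
        with b hb hmem
      exact lt_asymm hb hmem.2)
  obtain ⟨b, ⟨h1, h2⟩, h3⟩ := ((ht.eventually (ge_mem_nhds hδ)).and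
    (nhdsWithin_le_nhds (lt_mem_nhds ha))).and self_mem_nhdsWithin |>.exists
  exact ⟨b, h2.le, h3, h b h2.le h1⟩

/-- Domination is a closed condition in `a`; points on the limiting circle itself are fixed by the
reflection. -/
theorem reflDominated_sInf (hw : Continuous w)
    (hne : {a | 0 ≤ a ∧ ReflDominated w a}.Nonempty) :
    ReflDominated w (sInf {a | 0 ≤ a ∧ ReflDominated w a}) := by
  set S := {a | 0 ≤ a ∧ ReflDominated w a} with hS
  have hbdd : BddBelow S := ⟨0, fun a ha => ha.1⟩
  have hc := continuous_cylFactor hw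
  intro p hp
  rcases hp.eq_or_lt with heq | hlt
  · have : cylRefl (sInf S) p = p := by
      rw [heq]
      ext <;> simp [cylRefl]
      ring
    rw [this]
  · obtain ⟨u, -, hu, huS⟩ := exists_seq_tendsto_sInf hne hbdd
    have h2 : Continuous fun b => cylFactor w (cylRefl b p) :=
      hc.comp (by unfold cylRefl; fun_prop)
    refine ge_of_tendsto ((h2.tendsto _).comp hu) ?_
    filter_upwards [hu.eventually (ge_mem_nhds hlt)] with n hn
    exact (huS n).2 p hn

/-- The method of moving planes: an even solution is symmetric about the equator. -/
theorem cylFactor_symm (hw : IsLiouville w) (heven : ∀ x, w (-x) = w x) (t θ : ℝ) :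
    cylFactor w (-t, θ) = cylFactor w (t, θ) := by
  set S := {a | 0 ≤ a ∧ ReflDominated w a} with hS
  have hbdd : BddBelow S := ⟨0, fun a ha => ha.1⟩
  have hne : S.Nonempty := exists_reflDominated hw
  have hinf := reflDominated_sInf hw.continuous hne
  have h0 : sInf S = 0 := by
    refine le_antisymm (not_lt.mp fun hpos => ?_) (le_csInf hne fun a ha => ha.1)
    obtain ⟨b, hb0, hb, hbd⟩ := exists_reflDominated_lt hw heven hpos hinf
    exact not_lt.mpr (csInf_le hbdd ⟨hb0, hbd⟩) hb
  rw [← hS, h0] at hinf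
  have key : ∀ t, 0 ≤ t → ∀ θ, cylFactor w (t, θ) ≤ cylFactor w (-t, θ) := fun t ht θ => by
    have := hinf (t, θ) ht
    simpa [cylRefl] using this
  -- The antipodal map sends the inequality at angle `θ + π` to the reverse inequality at angle `θ`.
  have key' : ∀ t, 0 ≤ t → ∀ θ, cylFactor w (-t, θ) ≤ cylFactor w (t, θ) := fun t ht θ => by
    have h1 := key t ht (θ + Real.pi)
    have h2 := cylFactor_neg heven (-t) θ
    rw [neg_neg] at h2
    rw [h2, cylFactor_neg heven t θ] at h1
    exact h1
  rcases le_total 0 t with ht | ht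
  · exact le_antisymm (key' t ht θ) (key t ht θ)
  · have h1 := key (-t) (by linarith) θ
    have h2 := key' (-t) (by linarith) θ
    rw [neg_neg] at h1 h2
    exact le_antisymm h1 h2

/-- The equation is invariant under isometries, so the symmetry in the equator holds for every plane
through the origin. -/
theorem IsLiouville.comp_sphMap (hw : IsLiouville w) (A : Amb 2 ≃ₗᵢ[ℝ] Amb 2) :
    IsLiouville fun x => w (sphMap A x) := by
  have hcont := hw.continuous
  obtain ⟨c, hc⟩ := hw.eq
  refine ⟨hcont.comp (continuous_sphMap A), ?_, c, fun x => ?_⟩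
  · rw [← hw.mass, ← integral_sphMap A (g := fun x => Real.exp (2 * w x)) (by fun_prop)]
  · rw [hc, ← integral_sphMap A (g := fun y => Real.log (chord (sphMap A x) y) *
      Real.exp (2 * w y)) ((measurable_chord_right _).log.mul (by fun_prop))]
    simp only [chord_sphMap]

/-- The reflection of the ambient space in the plane of the equator. -/
def equatorRefl : Amb 2 ≃ₗᵢ[ℝ] Amb 2 := (ℝ ∙ (north : Amb 2))ᗮ.reflection

theorem equatorRefl_apply (x : Amb 2) :
    equatorRefl x = x - (2 * inner ℝ (north : Amb 2) x) • (north : Amb 2) := by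
  rw [equatorRefl, Submodule.reflection_orthogonal_apply, Submodule.reflection_singleton_apply]
  simp [norm_eq_of_mem_sphere]
  module

theorem sphMap_equatorRefl_cyl (t θ : ℝ) : sphMap equatorRefl (cyl (t, θ)) = cyl (-t, θ) := by
  ext i
  rw [coe_sphMap, equatorRefl_apply, coe_cyl, coe_cyl, north, EuclideanSpace.inner_single_left]
  fin_cases i <;> simp
  ring

/-- The coordinates miss the poles, whence the detour through almost every point and continuity. -/
theorem comp_equatorRefl (hw : IsLiouville w) (heven : ∀ x, w (-x) = w x) (x : Sph 2) :
    w (sphMap equatorRefl x) = w x := by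
  refine congrFun (eq_of_ae_eq_of_continuous (v := fun x => w (sphMap equatorRefl x))
    (hw.continuous.comp (continuous_sphMap _)) hw.continuous ?_) x
  have hm : MeasurableSet {x | w (sphMap equatorRefl x) = w x} :=
    (isClosed_eq (hw.continuous.comp (continuous_sphMap _)) hw.continuous).measurableSet
  rw [sphVol_two_eq, ae_map_iff continuous_cyl.measurable.aemeasurable hm]
  refine Eventually.of_forall fun p => ?_
  have h := cylFactor_symm hw heven p.1 p.2
  unfold cylFactor at h
  rw [Real.cosh_neg, sub_left_inj, ← sphMap_equatorRefl_cyl] at h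
  exact h

/-- An even solution of the Liouville equation on the sphere is constant. -/
theorem IsLiouville.eq_north (hw : IsLiouville w) (heven : ∀ x, w (-x) = w x) (x : Sph 2) :
    w x = w north := by
  by_cases hx : x = north
  · rw [hx]
  have hd : (x : Amb 2) - north ≠ 0 := sub_ne_zero.mpr fun h => hx (Subtype.ext h)
  -- The reflection in the plane orthogonal to `x - north` exchanges `x` and the north pole; `A`
  -- turns it into the equatorial reflection.
  set v : Sph 2 := ⟨‖(x : Amb 2) - north‖⁻¹ • ((x : Amb 2) - north), by
    rw [mem_sphere_zero_iff_norm, norm_smul, norm_inv, norm_norm,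
      inv_mul_cancel₀ (norm_ne_zero_iff.mpr hd)]⟩ with hv
  obtain ⟨A, hA⟩ := exists_sphMap_eq north v
  have hA' : A (north : Amb 2) = v := congrArg Subtype.val hA
  have h := comp_equatorRefl (hw.comp_sphMap A) (fun x => by rw [sphMap_neg, heven])
    (sphMap A.symm x)
  rw [sphMap_sphMap_symm] at h
  rw [← h]
  congr 1
  ext1
  rw [coe_sphMap, coe_sphMap, equatorRefl_apply, coe_sphMap, map_sub, map_smul, hA',
    LinearIsometryEquiv.apply_symm_apply, ← LinearIsometryEquiv.inner_map_map A, hA',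
    LinearIsometryEquiv.apply_symm_apply]
  have h1 : ‖(x : Amb 2) - north‖ ^ 2 = 2 - 2 * inner ℝ (x : Amb 2) (north : Amb 2) := by
    rw [norm_sub_sq_real]
    simp [norm_eq_of_mem_sphere]
    ring
  have h2 : inner ℝ ((x : Amb 2) - north) (x : Amb 2) =
      1 - inner ℝ (x : Amb 2) (north : Amb 2) := by
    rw [inner_sub_left, real_inner_self_eq_norm_sq, real_inner_comm]
    simp [norm_eq_of_mem_sphere]
  have hn : ‖(x : Amb 2) - north‖ ≠ 0 := norm_ne_zero_iff.mpr hd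
  rw [hv]
  dsimp only
  rw [inner_smul_left, h2, smul_smul]
  have h3 : 2 * ((starRingEnd ℝ) ‖(x : Amb 2) - north‖⁻¹ *
      (1 - inner ℝ (x : Amb 2) (north : Amb 2))) * ‖(x : Amb 2) - north‖⁻¹ = 1 := by
    rw [conj_trivial]
    field_simp
    linarith
  rw [h3, one_smul, sub_sub_cancel]

/-- Descending to the projective plane is what makes the solution even, hence constant; on the
sphere alone the conclusion would fail. -/
theorem measure_eq_zero_of_hasConstantCurvature {μ : SignedMeasure (Sph 2)} {f : RP 2 → ℝ≥0∞}
    (hμ : μ univ = 0) (hf : IsExpPotential f μ) (hK : HasConstantCurvature f μ) : μ = 0 := by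
  obtain ⟨w, b, hw, hfw⟩ := exists_isLiouville hμ hf hK
  refine measure_eq_zero_of_ae_const hμ hf (c := ENNReal.ofReal (Real.exp (w north + b))) ?_
  filter_upwards [hfw] with x hx
  rw [hx, hw.eq_north (even_of_ae_eq hw.continuous hfw)]

end Symmetry

end PuInequality

end

theorem mainTheorem2 :
    (∀ (n : ℕ), 1 ≤ n → ∀ f : RP n → ℝ≥0∞,
      MemLp f (n : ℝ≥0∞) (rpVol n) → sys f ≠ 0 →
      vol f / sys f ^ n ≥ vol (roundFactor n) / sys (roundFactor n) ^ n) ∧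
    (∀ (μ : SignedMeasure (Sph 2)) (f : RP 2 → ℝ≥0∞),
      MemLp f 2 (rpVol 2) → sys f ≠ 0 →
      μ univ = 0 → IsExpPotential f μ →
      (vol f / sys f ^ 2 = vol (roundFactor 2) / sys (roundFactor 2) ^ 2 ↔
        HasConstantCurvature f μ)) := by
  refine ⟨fun n hn f hf hsys => pu_inequality hn hf hsys, fun μ f hf hsys hμ hpot => ⟨fun heq => ?_,
    fun hK => ?_⟩⟩
  · obtain ⟨c, hc⟩ := ae_const_of_pu_equality hf hsys heq
    obtain rfl := measure_eq_zero_of_ae_const hμ hpot hc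
    rw [eq_one_of_measure_eq_zero hpot]
    exact hasConstantCurvature_roundFactor
  · obtain rfl := measure_eq_zero_of_hasConstantCurvature hμ hpot hK
    rw [eq_one_of_measure_eq_zero hpot]
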